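/- Let $M$ be a smooth $m$-dimensional (Hausdorff) manifold and $E\to M$ a smooth real vector bundle of rank $n$. Let $JE\to M$ be its first jet bundle, with fibre $J_xE=\{j_xs\}$; it is again a smooth vector bundle. A *linear connection* of $E$ is a smooth linear morphism $\kappa:E\to JE$ over $M$ that is a section of $JE\to E$; equivalently, it is a smooth section of the affine subbundle $C\subset JE\otimes E^*=\mathrm{Hom}(E,JE)$ of elements projecting onto $\mathrm{id}_E$. A section $s$ is *parallel at $x$* if $j_xs=\kappa(s(x))$, and its covariant derivative is $\nabla s=js-\kappa\circ s$, with values in $\ker(JE\to E)=T^*M\otimes E$. In a linear fibred chart $(x^a,y^i)$ of $E$, with frame $(\mathsf y_i)$, the induced coordinates on $JE$ are $(x^a,y^i,y^i_a)$, those on $JE\otimes E^*$ are $(x^a,y^i_j,y^i_{aj})$, with $y^i_j=\delta^i_j$ on $C$, and $\kappa_a=(\kappa_a{}^i{}_j)$, $\kappa_a{}^i{}_j=y^i_{aj}\circ\kappa$. The curvature of $\kappa$ is the tensor with components $\rho_{ab}=\partial_b\kappa_a-\partial_a\kappa_b+[\kappa_a,\kappa_b]$ (matrices). *Fibre structure.*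 Let $G\subseteq GL(n,\mathbb R)$ be a subgroup and $\mathfrak g$ its Lie algebra (the velocities at the identity of smooth curves in $G$), with basis $(\mathfrak l_I)$ and structure constants $[\mathfrak l_J,\mathfrak l_H]=c^I_{JH}\,\mathfrak l_I$. Let $E$ be endowed with a $G$-structure: at each point a family of *special* frames of the fibre, which is an orbit of the right action of $G$, such that near every point there is a smooth special frame. Let $C_G\subset C$ consist of those $A\in C_x$ for which there is a smooth special frame $(\beta_j)$ near $x$ with $j_x\beta_j=A(\beta_j(x))$ for all $j$. A *gauge field* is a linear connection $\kappa$ of $E$ that is a section of $C_G$, that is, one that preserves the structure. *The overconnection.* Let $\Gamma$ be a smooth torsion-free linear connection of $TM$, with components in the convention $\nabla_av^c=\partial_av^c-\Gamma_a{}^c{}_b\,v^b$. On $JJE$ use the coordinates $(x^a,y^i,\underline y^i_a;y^i_a,y^i_{ab})$, where $(x^a,y^i,\underline y^i_a)$ are the coordinates of the base point in $JE$, and $y^i_a$ and $y^i_{ab}=(y^i_a)_b$ are the derivatives of $y^i$ along $x^a$ and of $y^i_a:JE\to\mathbb R$ along $x^b$. Let $s_\Gamma:JJE\to JJE$ be the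 involution $$\bigl(x^a,y^i,\underline y^i_a;y^i_a,y^i_{ab}\bigr)\circ s_\Gamma=\bigl(x^a,y^i,y^i_a;\underline y^i_a,\;y^i_{ba}+\Gamma_b{}^c{}_a(\underline y^i_c-y^i_c)\bigr),$$ the expression holding in every linear fibred chart. Let $J\kappa:JE\to JJE$, $j_x\varphi\mapsto j_x(\kappa\circ\varphi)$, let $\kappa'=s_\Gamma\circ J\kappa$, a linear connection of $JE$, and let $\kappa^\uparrow=\kappa'\otimes\kappa^*$ be the induced linear connection of $JE\otimes E^*=\mathrm{Hom}(E,JE)$: if $\alpha$ is $\kappa^\uparrow$-parallel at $x$ and $s$ is $\kappa$-parallel at $x$, then $\alpha(s)$ is $\kappa'$-parallel at $x$. **Theorem.** Let $\Gamma$ be a smooth torsion-free linear connection of $TM$ and $\kappa$ a gauge field. Then: 1. $\Gamma$ and $\kappa$ determine $\kappa^\uparrow$: there is exactly one linear connection $\kappa^\uparrow$ of $JE\otimes E^*$ obtained in this way. 2. $\kappa^\uparrow$ is reducible to a connection of $C\to M$ and to a connection of $C_G\to M$: $\kappa^\uparrow(C)\subset JC$ and $\kappa^\uparrow(C_G)\subset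 JC_G$. In every linear fibred chart with special frame, $C_G$ is the affine subbundle of $C$ of those elements whose matrices $y_a=(y^i_{aj})$ lie in $\mathfrak g$; write $y_a=y_a^I\,\mathfrak l_I$ on $C_G$ and $\kappa_a=\kappa_a^I\,\mathfrak l_I$. 3. In every such chart, $\kappa^\uparrow$ has on $C_G$ the coordinate expression (its remaining components, those along the coordinates $y^i_j$, being zero) $$(\kappa^\uparrow_a)^I_b=\partial_b\kappa_a^I+c^I_{JH}\,\kappa_a^J\,y_b^H+\Gamma_a{}^c{}_b\,(\kappa_c^I-y_c^I).$$ 4. The covariant derivative $\nabla\kappa$ of the section $\kappa$ with respect to $\kappa^\uparrow$ is minus the curvature of $\kappa$: it is vertical, and $\nabla_a\kappa_b{}^i{}_j=-\rho_{ab}{}^i{}_j$ in every linear fibred chart. If the frame is special, then $\rho_{ab}=\rho_{ab}^I\,\mathfrak l_I\in\mathfrak g$, $\nabla_a\kappa_b^I=-\rho_{ab}^I$ and $\rho_{ab}^I=\partial_b\kappa_a^I-\partial_a\kappa_b^I+c^I_{JH}\,\kappa_a^J\kappa_b^H$. -/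

import Mathlib

open Bundle Topology Set Filter
open scoped Manifold ContDiff

set_option linter.unusedSectionVars false

noncomputable section

namespace JetConnection

variable {EB : Type*} [NormedAddCommGroup EB] [NormedSpace ℝ EB]
  {M : Type*} [TopologicalSpace M] [ChartedSpace EB M]
  (F : Type*) [NormedAddCommGroup F] [NormedSpace ℝ F]
  (V : M → Type*) [∀ x, AddCommGroup (V x)] [∀ x, Module ℝ (V x)] [∀ x, TopologicalSpace (V x)]
  [TopologicalSpace (TotalSpace F V)] [FiberBundle F V]

/-- The representative of a section in the preferred chart and trivialization at `i`. -/
def localRep (i : M) (s : ∀ y, V y) : EB → F := fun u ↦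
  (trivializationAt F V i ⟨(chartAt EB i).symm u, s ((chartAt EB i).symm u)⟩).2

/-- The common domain of the preferred chart of `M` and the preferred trivialization at `i`. -/
def dom (EB : Type*) [NormedAddCommGroup EB] [NormedSpace ℝ EB]
  {M : Type*} [TopologicalSpace M] [ChartedSpace EB M]
  (F : Type*) [NormedAddCommGroup F] [NormedSpace ℝ F]
  (V : M → Type*) [∀ x, TopologicalSpace (V x)]
  [TopologicalSpace (TotalSpace F V)] [FiberBundle F V] (i : M) : Set M :=
  (trivializationAt F V i).baseSet ∩ (chartAt EB i).source

theorem isOpen_dom (i : M) : IsOpen (dom EB F V i) :=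
  (trivializationAt F V i).open_baseSet.inter (chartAt EB i).open_source

theorem mem_dom (i : M) : i ∈ dom EB F V i :=
  ⟨FiberBundle.mem_baseSet_trivializationAt' i, mem_chart_source EB i⟩

/-- The image of `dom i` in the preferred chart at `i`. -/
def cdom (i : M) : Set EB := (chartAt EB i).target ∩ (chartAt EB i).symm ⁻¹' dom EB F V i

theorem isOpen_cdom (i : M) : IsOpen (cdom (EB := EB) F V i) :=
  (chartAt EB i).symm.isOpen_inter_preimage (isOpen_dom F V i)

theorem mem_cdom {i y : M} (hy : y ∈ dom EB F V i) : chartAt EB i y ∈ cdom F V i :=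
  ⟨(chartAt EB i).map_source hy.2, by simpa [(chartAt EB i).left_inv hy.2] using hy⟩

variable [VectorBundle ℝ F V] [IsManifold 𝓘(ℝ, EB) ∞ M] [ContMDiffVectorBundle ∞ F V 𝓘(ℝ, EB)]

theorem contDiffOn_localRep (i : M) (s : Cₛ^∞⟮𝓘(ℝ, EB); F, V⟯) :
    ContDiffOn ℝ ∞ (localRep (EB := EB) F V i s) (cdom F V i) := by
  rw [← contMDiffOn_iff_contDiffOn]
  have h1 : ContMDiffOn 𝓘(ℝ, EB) 𝓘(ℝ, F) ∞
      (fun y ↦ (trivializationAt F V i ⟨y, s y⟩).2) (dom EB F V i) := by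
    intro y hy
    have := (Bundle.Trivialization.contMDiffAt_section_iff (IB := 𝓘(ℝ, EB)) (n := ∞)
      (trivializationAt F V i) hy.1).1 (s.contMDiff y)
    exact this.contMDiffWithinAt
  exact h1.comp ((contMDiffOn_chart_symm (x := i)).mono inter_subset_left) (fun u hu ↦ hu.2)

theorem localRep_differentiableAt {i y : M} (hy : y ∈ dom EB F V i) (s : Cₛ^∞⟮𝓘(ℝ, EB); F, V⟯) :
    DifferentiableAt ℝ (localRep (EB := EB) F V i s) (chartAt EB i y) :=
  ((contDiffOn_localRep F V i s).contDiffAt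
    ((isOpen_cdom F V i).mem_nhds (mem_cdom F V hy))).differentiableAt (by simp)

variable (EB) in
/-- Value and first derivative at `y` of a section, read in the preferred chart and trivialization
at `i`: the coordinates `(yⁱ, yⁱₐ)` of its first jet. -/
def jetCoord (i y : M) (s : ∀ y, V y) : F × (EB →L[ℝ] F) :=
  (localRep (EB := EB) F V i s (chartAt EB i y), fderiv ℝ (localRep F V i s) (chartAt EB i y))

theorem jetCoord_add {i y : M} (hy : y ∈ dom EB F V i) (s t : Cₛ^∞⟮𝓘(ℝ, EB); F, V⟯) :
    jetCoord EB F V i y (s + t : Cₛ^∞⟮𝓘(ℝ, EB); F, V⟯) =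
      jetCoord EB F V i y s + jetCoord EB F V i y t := by
  have h : EqOn (localRep (EB := EB) F V i (s + t : Cₛ^∞⟮𝓘(ℝ, EB); F, V⟯))
      (localRep F V i s + localRep F V i t) (cdom F V i) := fun u hu ↦ by
    simpa [localRep] using ((trivializationAt F V i).linear ℝ hu.2.1).map_add _ _
  have hm := mem_cdom F V hy
  refine Prod.ext (h hm) ?_
  simp only [jetCoord, Prod.snd_add]
  rw [(h.eventuallyEq_of_mem ((isOpen_cdom F V i).mem_nhds hm)).fderiv_eq,
    fderiv_add (localRep_differentiableAt F V hy s) (localRep_differentiableAt F V hy t)]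

theorem jetCoord_smul {i y : M} (hy : y ∈ dom EB F V i) (c : ℝ) (s : Cₛ^∞⟮𝓘(ℝ, EB); F, V⟯) :
    jetCoord EB F V i y (c • s : Cₛ^∞⟮𝓘(ℝ, EB); F, V⟯) = c • jetCoord EB F V i y s := by
  have h : EqOn (localRep (EB := EB) F V i (c • s : Cₛ^∞⟮𝓘(ℝ, EB); F, V⟯))
      (c • localRep F V i s) (cdom F V i) := fun u hu ↦ by
    simpa [localRep] using ((trivializationAt F V i).linear ℝ hu.2.1).map_smul _ _
  have hm := mem_cdom F V hy
  refine Prod.ext (h hm) ?_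
  simp only [jetCoord, Prod.smul_snd]
  rw [(h.eventuallyEq_of_mem ((isOpen_cdom F V i).mem_nhds hm)).fderiv_eq,
    fderiv_const_smul (localRep_differentiableAt F V hy s)]

/-- `jetCoord` as a linear map on smooth sections. -/
def jetCoordₗ {i y : M} (hy : y ∈ dom EB F V i) :
    Cₛ^∞⟮𝓘(ℝ, EB); F, V⟯ →ₗ[ℝ] F × (EB →L[ℝ] F) where
  toFun s := jetCoord EB F V i y s
  map_add' := jetCoord_add F V hy
  map_smul' := jetCoord_smul F V hy

/-- The fibre part of the change of trivialization from `i` to `j`, in the chart at `j`. -/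
def fibTrans (i j : M) : EB → F →L[ℝ] F := fun u ↦
  ((trivializationAt F V i).coordChangeL ℝ (trivializationAt F V j) ((chartAt EB j).symm u) : F →L[ℝ] F)

/-- The change of charts from `j` to `i`. -/
def baseTrans (EB : Type*) [NormedAddCommGroup EB] [NormedSpace ℝ EB]
  {M : Type*} [TopologicalSpace M] [ChartedSpace EB M] (i j : M) : EB → EB := fun u ↦ chartAt EB i ((chartAt EB j).symm u)

theorem isOpen_inter (i j : M) : IsOpen
    ((chartAt EB j).target ∩ (chartAt EB j).symm ⁻¹' (dom EB F V i ∩ dom EB F V j)) :=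
  (chartAt EB j).symm.isOpen_inter_preimage ((isOpen_dom F V i).inter (isOpen_dom F V j))

theorem contDiffOn_fibTrans (i j : M) : ContDiffOn ℝ ∞ (fibTrans (EB := EB) F V i j)
    ((chartAt EB j).target ∩ (chartAt EB j).symm ⁻¹' (dom EB F V i ∩ dom EB F V j)) := by
  rw [← contMDiffOn_iff_contDiffOn]
  exact (contMDiffOn_coordChangeL (IB := 𝓘(ℝ, EB)) (n := ∞) (trivializationAt F V i)
    (trivializationAt F V j)).comp
    ((contMDiffOn_chart_symm (x := j)).mono inter_subset_left) (fun u hu ↦ ⟨hu.2.1.1, hu.2.2.1⟩)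

theorem contDiffOn_baseTrans (i j : M) : ContDiffOn ℝ ∞ (baseTrans EB i j)
    ((chartAt EB j).target ∩ (chartAt EB j).symm ⁻¹' (dom EB F V i ∩ dom EB F V j)) := by
  rw [← contMDiffOn_iff_contDiffOn]
  exact (contMDiffOn_chart (x := i)).comp
    ((contMDiffOn_chart_symm (x := j)).mono inter_subset_left) (fun u hu ↦ hu.2.1.2)

/-- The change of coordinates on first jets from `i` to `j`. -/
def jetTrans (i j y : M) : F × (EB →L[ℝ] F) →L[ℝ] F × (EB →L[ℝ] F) :=
  ((fibTrans (EB := EB) F V i j (chartAt EB j y)).comp (ContinuousLinearMap.fst ℝ F (EB →L[ℝ] F))).prod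
   ((fderiv ℝ (fibTrans (EB := EB) F V i j) (chartAt EB j y)).flip.comp
      (ContinuousLinearMap.fst ℝ F (EB →L[ℝ] F)) +
    ((ContinuousLinearMap.compL ℝ EB F F (fibTrans (EB := EB) F V i j (chartAt EB j y))).comp
      ((ContinuousLinearMap.compL ℝ EB EB F).flip
        (fderiv ℝ (baseTrans EB i j) (chartAt EB j y)))).comp
      (ContinuousLinearMap.snd ℝ F (EB →L[ℝ] F)))

theorem jetTrans_jetCoord {i j y : M} (hi : y ∈ dom EB F V i) (hj : y ∈ dom EB F V j)
    (s : Cₛ^∞⟮𝓘(ℝ, EB); F, V⟯) :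
    jetTrans F V i j y (jetCoord EB F V i y s) = jetCoord EB F V j y s := by
  have ho := isOpen_inter (EB := EB) F V i j
  have hm : chartAt EB j y ∈ (chartAt EB j).target ∩
      (chartAt EB j).symm ⁻¹' (dom EB F V i ∩ dom EB F V j) :=
    ⟨(chartAt EB j).map_source hj.2, by
      simpa [(chartAt EB j).left_inv hj.2] using And.intro hi hj⟩
  have h : EqOn (localRep (EB := EB) F V j s)
      (fun u ↦ fibTrans F V i j u (localRep F V i s (baseTrans EB i j u)))
      ((chartAt EB j).target ∩ (chartAt EB j).symm ⁻¹' (dom EB F V i ∩ dom EB F V j)) := by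
    intro u hu
    simp only [localRep, fibTrans, baseTrans]
    rw [(chartAt EB i).left_inv hu.2.1.2, ContinuousLinearEquiv.coe_coe,
      Trivialization.coordChangeL_apply _ _ ⟨hu.2.1.1, hu.2.2.1⟩]
    congr 2
    exact (Trivialization.symm_apply_apply_mk _ hu.2.1.1 _).symm ▸ rfl
  have hb : baseTrans EB i j (chartAt EB j y) = chartAt EB i y := by
    simp [baseTrans, (chartAt EB j).left_inv hj.2]
  have d1 : DifferentiableAt ℝ (fibTrans (EB := EB) F V i j) (chartAt EB j y) :=
    ((contDiffOn_fibTrans F V i j).contDiffAt (ho.mem_nhds hm)).differentiableAt (by simp)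
  have d2 : DifferentiableAt ℝ (baseTrans EB i j) (chartAt EB j y) :=
    ((contDiffOn_baseTrans F V i j).contDiffAt (ho.mem_nhds hm)).differentiableAt (by simp)
  have d3 : DifferentiableAt ℝ (localRep (EB := EB) F V i s) (baseTrans EB i j (chartAt EB j y)) := by
    rw [hb]; exact localRep_differentiableAt F V hi s
  refine Prod.ext ?_ ?_
  · simp only [jetCoord]
    rw [h hm]
    simp [jetTrans, hb]
  · simp only [jetCoord]
    rw [(h.eventuallyEq_of_mem (ho.mem_nhds hm)).fderiv_eq,
      show fderiv ℝ (fun u ↦ fibTrans F V i j u (localRep F V i s (baseTrans EB i j u)))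
        (chartAt EB j y) = _ from
        (d1.hasFDerivAt.clm_apply (d3.hasFDerivAt.comp _ d2.hasFDerivAt)).fderiv]
    ext v
    simp [jetTrans, hb, add_comm]

set_option synthInstance.maxHeartbeats 400000 in
set_option maxHeartbeats 800000 in
theorem contMDiffOn_jetTrans (i j : M) :
    ContMDiffOn 𝓘(ℝ, EB) 𝓘(ℝ, F × (EB →L[ℝ] F) →L[ℝ] F × (EB →L[ℝ] F)) ∞
      (jetTrans (EB := EB) F V i j) (dom EB F V i ∩ dom EB F V j) := by
  have ho := isOpen_inter (EB := EB) F V i j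
  have d1 := contDiffOn_fibTrans (EB := EB) F V i j
  have d2 := d1.fderiv_of_isOpen (m := ∞) ho (by simp)
  have d3 := (contDiffOn_baseTrans (EB := EB) F V i j).fderiv_of_isOpen (m := ∞) ho (by simp)
  have hc : ContMDiffOn 𝓘(ℝ, EB) 𝓘(ℝ, EB) ∞ (chartAt EB j) (dom EB F V i ∩ dom EB F V j) :=
    (contMDiffOn_chart (x := j)).mono (fun y hy ↦ hy.2.2)
  have hmap : MapsTo (chartAt EB j) (dom EB F V i ∩ dom EB F V j)
      ((chartAt EB j).target ∩ (chartAt EB j).symm ⁻¹' (dom EB F V i ∩ dom EB F V j)) :=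
    fun y hy ↦ ⟨(chartAt EB j).map_source hy.2.2, by
      simpa [(chartAt EB j).left_inv hy.2.2] using hy⟩
  refine ContMDiffOn.comp (g := fun u ↦
    ((fibTrans (EB := EB) F V i j u).comp (ContinuousLinearMap.fst ℝ F (EB →L[ℝ] F))).prod
     ((fderiv ℝ (fibTrans (EB := EB) F V i j) u).flip.comp
        (ContinuousLinearMap.fst ℝ F (EB →L[ℝ] F)) +
      ((ContinuousLinearMap.compL ℝ EB F F (fibTrans (EB := EB) F V i j u)).comp
        ((ContinuousLinearMap.compL ℝ EB EB F).flip
          (fderiv ℝ (baseTrans EB i j) u))).comp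
        (ContinuousLinearMap.snd ℝ F (EB →L[ℝ] F)))) (ContDiffOn.contMDiffOn ?_) hc hmap
  have hflip : ContDiff ℝ ∞ (fun B : EB →L[ℝ] F →L[ℝ] F ↦ B.flip) :=
    IsBoundedLinearMap.contDiff (IsLinearMap.with_bound ⟨fun _ _ ↦ rfl, fun _ _ ↦ rfl⟩ 1
      (fun B ↦ by rw [one_mul, ContinuousLinearMap.opNorm_flip]))
  have d2' : ContDiffOn ℝ ∞ (fun u ↦ (fderiv ℝ (fibTrans (EB := EB) F V i j) u).flip) _ :=
    hflip.comp_contDiffOn d2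
  have h1 : ContDiff ℝ ∞ (fun A : F →L[ℝ] F ↦ ContinuousLinearMap.compL ℝ EB F F A) :=
    IsBoundedLinearMap.contDiff (IsLinearMap.with_bound
      ⟨fun _ _ ↦ map_add _ _ _, fun _ _ ↦ map_smul _ _ _⟩ 1 (fun A ↦ by
        rw [one_mul]
        exact ContinuousLinearMap.opNorm_le_bound _ (norm_nonneg _)
          (fun B ↦ A.opNorm_comp_le B)))
  have h3 : ContDiff ℝ ∞ (fun A : EB →L[ℝ] EB ↦ (ContinuousLinearMap.compL ℝ EB EB F).flip A) :=
    IsBoundedLinearMap.contDiff (IsLinearMap.with_bound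
      ⟨fun _ _ ↦ map_add _ _ _, fun _ _ ↦ map_smul _ _ _⟩ 1 (fun A ↦ by
        rw [one_mul]
        exact ContinuousLinearMap.opNorm_le_bound _ (norm_nonneg _)
          (fun B ↦ (B.opNorm_comp_le A).trans (mul_comm _ _).le)))
  have d1' : ContDiffOn ℝ ∞ (fun u ↦
      ContinuousLinearMap.compL ℝ EB F F (fibTrans (EB := EB) F V i j u)) _ :=
    h1.comp_contDiffOn d1
  have d3' : ContDiffOn ℝ ∞ (fun u ↦
      (ContinuousLinearMap.compL ℝ EB EB F).flip (fderiv ℝ (baseTrans EB i j) u)) _ :=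
    h3.comp_contDiffOn d3
  have p1 := d1.clm_comp (contDiffOn_const (c := ContinuousLinearMap.fst ℝ F (EB →L[ℝ] F)))
  have p2 := (d2'.clm_comp (contDiffOn_const (c := ContinuousLinearMap.fst ℝ F (EB →L[ℝ] F)))).add
    ((d1'.clm_comp d3').clm_comp (contDiffOn_const (c := ContinuousLinearMap.snd ℝ F (EB →L[ℝ] F))))
  have hp : ContDiff ℝ ∞ (fun p : (F × (EB →L[ℝ] F) →L[ℝ] F) ×
      (F × (EB →L[ℝ] F) →L[ℝ] EB →L[ℝ] F) ↦ p.1.prod p.2) :=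
    IsBoundedLinearMap.contDiff (IsLinearMap.with_bound ⟨fun _ _ ↦ rfl, fun _ _ ↦ rfl⟩ 1
      (fun p ↦ by rw [one_mul, ContinuousLinearMap.opNorm_prod]))
  exact hp.comp_contDiffOn (p1.prodMk p2)

variable [FiniteDimensional ℝ EB] [T2Space M]

theorem jetCoordₗ_surjective {i y : M} (hy : y ∈ dom EB F V i) :
    Function.Surjective (jetCoordₗ F V hy) := by
  rintro ⟨f, A⟩
  obtain ⟨b, hb⟩ := ((SmoothBumpFunction.nhds_basis_tsupport (I := 𝓘(ℝ, EB)) y).mem_iff.1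
    ((isOpen_dom F V i).mem_nhds hy))
  let e := trivializationAt F V i
  let g : M → F := fun z ↦ f + A (chartAt EB i z - chartAt EB i y)
  let t : ∀ z, V z := fun z ↦ e.symm z (g z)
  have hg : ContMDiffOn 𝓘(ℝ, EB) 𝓘(ℝ, F) ∞ g (dom EB F V i) := by
    have h0 : ContDiff ℝ ∞ (fun u : EB ↦ f + A (u - chartAt EB i y)) := by fun_prop
    exact h0.contMDiff.comp_contMDiffOn ((contMDiffOn_chart (x := i)).mono inter_subset_right)
  have ht : ContMDiffOn 𝓘(ℝ, EB) (𝓘(ℝ, EB).prod 𝓘(ℝ, F)) ∞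
      (fun z ↦ TotalSpace.mk' F z (t z)) (dom EB F V i) := by
    intro z hz
    refine ContMDiffAt.contMDiffWithinAt ?_
    rw [Bundle.Trivialization.contMDiffAt_section_iff e hz.1]
    refine (hg.contMDiffAt ((isOpen_dom F V i).mem_nhds hz)).congr_of_eventuallyEq ?_
    filter_upwards [(isOpen_dom F V i).mem_nhds hz] with w hw
    simp [t, e.apply_mk_symm hw.1]
  let s : Cₛ^∞⟮𝓘(ℝ, EB); F, V⟯ := ⟨fun z ↦ b z • t z,
    ContMDiffOn.smul_section_of_tsupport (b.contMDiff.contMDiffOn) (isOpen_dom F V i) hb.2 ht⟩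
  refine ⟨s, ?_⟩
  have hev : localRep (EB := EB) F V i s =ᶠ[𝓝 (chartAt EB i y)]
      fun u ↦ f + A (u - chartAt EB i y) := by
    have hc : Tendsto (chartAt EB i).symm (𝓝 (chartAt EB i y)) (𝓝 y) := by
      have := (chartAt EB i).continuousAt_symm ((chartAt EB i).map_source hy.2)
      rwa [ContinuousAt, (chartAt EB i).left_inv hy.2] at this
    filter_upwards [hc.eventually b.eventuallyEq_one,
      (isOpen_cdom F V i).mem_nhds (mem_cdom F V hy)] with u hu hu'
    have : s ((chartAt EB i).symm u) = t ((chartAt EB i).symm u) := by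
      change b _ • t _ = _
      rw [hu]; simp
    simp only [localRep, this]
    change (e ⟨_, e.symm _ _⟩).2 = _
    rw [e.apply_mk_symm hu'.2.1]
    simp [g, (chartAt EB i).right_inv hu'.1]
  refine Prod.ext ?_ ?_
  · exact hev.eq_of_nhds.trans (by simp)
  · change fderiv ℝ _ _ = _
    rw [hev.fderiv_eq]
    exact ((A.hasFDerivAt.comp (chartAt EB i y)
      ((hasFDerivAt_id _).sub_const (chartAt EB i y))).const_add f).fderiv.trans (by ext; simp)

variable (EB) in
/-- The smooth sections that vanish at `x` to first order. -/
def jetKer (x : M) : Submodule ℝ Cₛ^∞⟮𝓘(ℝ, EB); F, V⟯ where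
  carrier := {s | s x = 0 ∧ fderiv ℝ (localRep F V x s) (chartAt EB x x) = 0}
  zero_mem' := ⟨rfl, congrArg Prod.snd (jetCoordₗ F V (mem_dom (EB := EB) F V x)).map_zero⟩
  add_mem' {s t} hs ht := ⟨by simp [hs.1, ht.1],
    (congrArg Prod.snd (jetCoord_add F V (mem_dom F V x) s t)).trans (by
      simpa [jetCoord, hs.2] using ht.2)⟩
  smul_mem' c s hs := ⟨by simp [hs.1],
    (congrArg Prod.snd (jetCoord_smul F V (mem_dom F V x) c s)).trans (by
      simp [jetCoord, hs.2])⟩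

theorem jetKer_eq_ker {i x : M} (hx : x ∈ dom EB F V i) :
    jetKer EB F V x = LinearMap.ker (jetCoordₗ F V hx) := by
  have h0 : jetKer EB F V x = LinearMap.ker (jetCoordₗ F V (mem_dom (EB := EB) F V x)) := by
    ext s
    have hx' := FiberBundle.mem_baseSet_trivializationAt' (F := F) (E := V) x
    have hz : s x = 0 ↔ localRep (EB := EB) F V x s (chartAt EB x x) = 0 := by
      simp only [localRep]
      rw [(chartAt EB x).left_inv (mem_chart_source EB x)]
      constructor
      · intro h
        rw [h]
        exact (((trivializationAt F V x).linear ℝ hx').mk' _).map_zero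
      · intro h
        have := ((trivializationAt F V x).linearEquivAt ℝ x hx').map_eq_zero_iff (x := s x)
        exact this.1 h
    rw [LinearMap.mem_ker]
    change (s x = 0 ∧ _) ↔ (_, _) = ((0 : F), (0 : EB →L[ℝ] F))
    rw [Prod.mk.injEq, hz]
  rw [h0]
  have key : ∀ {i j : M} (hi : x ∈ dom EB F V i) (hj : x ∈ dom EB F V j),
      LinearMap.ker (jetCoordₗ F V hi) ≤ LinearMap.ker (jetCoordₗ F V hj) := by
    intro i j hi hj s hs
    rw [LinearMap.mem_ker] at hs ⊢
    have := jetTrans_jetCoord F V hi hj s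
    change jetCoord EB F V i x s = 0 at hs
    change jetCoord EB F V j x s = 0
    rw [← this, hs, map_zero]
  exact le_antisymm (key _ _) (key _ _)

variable (EB) in
/-- The fibre over `x` of the first jet prolongation `J E → M` of the vector bundle `E = V`:
smooth sections modulo those that vanish at `x` to first order (as `M` is Hausdorff, every germ of
a local section is the germ of a global one). It is a vector space, by
`j_x s + j_x t = j_x (s + t)`. -/
def Jet (x : M) : Type _ := Cₛ^∞⟮𝓘(ℝ, EB); F, V⟯ ⧸ jetKer EB F V x

instance (x : M) : AddCommGroup (Jet EB F V x) :=
  inferInstanceAs (AddCommGroup (Cₛ^∞⟮𝓘(ℝ, EB); F, V⟯ ⧸ jetKer EB F V x))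

instance (x : M) : Module ℝ (Jet EB F V x) :=
  inferInstanceAs (Module ℝ (Cₛ^∞⟮𝓘(ℝ, EB); F, V⟯ ⧸ jetKer EB F V x))

variable {V} in
/-- The first jet `j_x s` at `x` of a smooth section. -/
def jet (x : M) : Cₛ^∞⟮𝓘(ℝ, EB); F, V⟯ →ₗ[ℝ] Jet EB F V x := (jetKer EB F V x).mkQ

theorem jet_surjective (x : M) : Function.Surjective (jet (EB := EB) (V := V) F x) :=
  (jetKer EB F V x).mkQ_surjective

/-- The linear coordinates `(yⁱ, yⁱₐ)` on `J_x E`. -/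
def jetEquiv {i x : M} (hx : x ∈ dom EB F V i) : Jet EB F V x ≃ₗ[ℝ] F × (EB →L[ℝ] F) :=
  (Submodule.quotEquivOfEq _ _ (jetKer_eq_ker F V hx)).trans
    ((jetCoordₗ F V hx).quotKerEquivOfSurjective (jetCoordₗ_surjective F V hx))

theorem jetEquiv_jet {i x : M} (hx : x ∈ dom EB F V i) (s : Cₛ^∞⟮𝓘(ℝ, EB); F, V⟯) :
    jetEquiv F V hx (jet F x s) = jetCoord EB F V i x s := rfl

instance (x : M) : TopologicalSpace (Jet EB F V x) :=
  TopologicalSpace.induced (jetEquiv F V (mem_dom (EB := EB) F V x)) inferInstance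

instance (x : M) : IsTopologicalAddGroup (Jet EB F V x) :=
  topologicalAddGroup_induced (jetEquiv F V (mem_dom (EB := EB) F V x))

instance (x : M) : ContinuousSMul ℝ (Jet EB F V x) :=
  continuousSMul_induced (jetEquiv F V (mem_dom (EB := EB) F V x))

variable (EB) in
open scoped Classical in
/-- The trivialization of `J E → M` by the coordinates `(yⁱ, yⁱₐ)` around `i`. -/
def jetPretriv (i : M) :
    Pretrivialization (F × (EB →L[ℝ] F)) (π (F × (EB →L[ℝ] F)) (Jet EB F V)) where
  toFun p := (p.1, if h : p.1 ∈ dom EB F V i then jetEquiv F V h p.2 else 0)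
  invFun q := ⟨q.1, if h : q.1 ∈ dom EB F V i then (jetEquiv F V h).symm q.2 else 0⟩
  source := π (F × (EB →L[ℝ] F)) (Jet EB F V) ⁻¹' dom EB F V i
  target := dom EB F V i ×ˢ univ
  map_source' p hp := ⟨hp, mem_univ _⟩
  map_target' q hq := hq.1
  left_inv' := by
    rintro ⟨x, u⟩ (hx : x ∈ dom EB F V i)
    simp [hx]
  right_inv' := by
    rintro ⟨x, u⟩ ⟨hx, -⟩
    simp [show x ∈ dom EB F V i from hx]
  open_target := (isOpen_dom F V i).prod isOpen_univ
  baseSet := dom EB F V i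
  open_baseSet := isOpen_dom F V i
  source_eq := rfl
  target_eq := rfl
  proj_toFun _ _ := rfl

theorem jetPretriv_apply {i x : M} (hx : x ∈ dom EB F V i) (u : Jet EB F V x) :
    (jetPretriv EB F V i ⟨x, u⟩).2 = jetEquiv F V hx u := by
  simp only [jetPretriv]
  exact dif_pos hx

instance jetPretriv_isLinear (i : M) : (jetPretriv EB F V i).IsLinear ℝ where
  linear x hx := by
    have : (fun u : Jet EB F V x ↦ (jetPretriv EB F V i ⟨x, u⟩).2) = jetEquiv F V hx :=
      funext (jetPretriv_apply F V hx)
    rw [this]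
    exact (jetEquiv F V hx).toLinearMap.isLinear

theorem jetTrans_eq {i j x : M} (hi : x ∈ dom EB F V i) (hj : x ∈ dom EB F V j)
    (w : F × (EB →L[ℝ] F)) :
    jetTrans F V i j x w =
      (jetPretriv EB F V j ⟨x, (jetPretriv EB F V i).symm x w⟩).2 := by
  rw [jetPretriv_apply F V hj]
  have : (jetPretriv EB F V i).symm x w = (jetEquiv F V hi).symm w := by
    apply (jetEquiv F V hi).injective
    rw [← jetPretriv_apply F V hi, (jetPretriv EB F V i).apply_mk_symm hi]
    simp
  rw [this]
  obtain ⟨s, rfl⟩ := jetCoordₗ_surjective F V hi w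
  have hs : (jetEquiv F V hi).symm (jetCoordₗ F V hi s) = jet F x s := by
    rw [LinearEquiv.symm_apply_eq]; rfl
  rw [hs, jetEquiv_jet]
  exact jetTrans_jetCoord F V hi hj s

variable (EB) in
/-- The vector bundle structure of `J E → M`. -/
def jetPrebundle : VectorPrebundle ℝ (F × (EB →L[ℝ] F)) (Jet EB F V) where
  pretrivializationAtlas := range (jetPretriv EB F V)
  pretrivialization_linear' := by
    rintro _ ⟨i, rfl⟩; infer_instance
  pretrivializationAt := jetPretriv EB F V
  mem_base_pretrivializationAt := mem_dom F V
  pretrivialization_mem_atlas i := ⟨i, rfl⟩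
  exists_coordChange := by
    rintro _ ⟨i, rfl⟩ _ ⟨j, rfl⟩
    exact ⟨jetTrans F V i j, (contMDiffOn_jetTrans F V i j).continuousOn,
      fun b hb ↦ jetTrans_eq F V hb.1 hb.2⟩
  totalSpaceMk_isInducing x := by
    have h1 : IsInducing (jetEquiv F V (mem_dom (EB := EB) F V x)) := ⟨rfl⟩
    have h2 : (jetPretriv EB F V x ∘ TotalSpace.mk x) =
        fun u ↦ (x, jetEquiv F V (mem_dom (EB := EB) F V x) u) := by
      funext u
      exact Prod.ext rfl (jetPretriv_apply F V (mem_dom F V x) u)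
    rw [h2]
    exact isInducing_const_prod.mpr h1

instance : (jetPrebundle EB F V).IsContMDiff 𝓘(ℝ, EB) ∞ where
  exists_contMDiffCoordChange := by
    rintro _ ⟨i, rfl⟩ _ ⟨j, rfl⟩
    exact ⟨jetTrans F V i j, contMDiffOn_jetTrans F V i j,
      fun b hb ↦ jetTrans_eq F V hb.1 hb.2⟩

instance : TopologicalSpace (TotalSpace (F × (EB →L[ℝ] F)) (Jet EB F V)) :=
  (jetPrebundle EB F V).totalSpaceTopology

instance : FiberBundle (F × (EB →L[ℝ] F)) (Jet EB F V) := (jetPrebundle EB F V).toFiberBundle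

instance : VectorBundle ℝ (F × (EB →L[ℝ] F)) (Jet EB F V) := (jetPrebundle EB F V).toVectorBundle

instance : ContMDiffVectorBundle ∞ (F × (EB →L[ℝ] F)) (Jet EB F V) 𝓘(ℝ, EB) :=
  (jetPrebundle EB F V).contMDiffVectorBundle 𝓘(ℝ, EB)

/-- Evaluation `J_x E → E_x`, `j_x s ↦ s x`. -/
def Jet.proj (x : M) : Jet EB F V x →ₗ[ℝ] V x :=
  (jetKer EB F V x).liftQ
    { toFun := fun s ↦ s x, map_add' := fun _ _ ↦ rfl, map_smul' := fun _ _ ↦ rfl }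
    (fun _ hs ↦ hs.1)

variable {F V} in
/-- A smooth section that represents the given jet. -/
def Jet.rep {x : M} (u : Jet EB F V x) : Cₛ^∞⟮𝓘(ℝ, EB); F, V⟯ :=
  (jet_surjective F V x u).choose

theorem Jet.jet_rep {x : M} (u : Jet EB F V x) : jet F x u.rep = u :=
  (jet_surjective F V x u).choose_spec

/-- The section `x ↦ α x (s x)`, for a smooth section `α` of `Hom(E₁, E₂)` and a smooth section
`s` of `E₁`. -/
def applySection {F₁ : Type*} [NormedAddCommGroup F₁] [NormedSpace ℝ F₁]
    {V₁ : M → Type*} [∀ x, AddCommGroup (V₁ x)] [∀ x, Module ℝ (V₁ x)]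
    [∀ x, TopologicalSpace (V₁ x)] [TopologicalSpace (TotalSpace F₁ V₁)] [FiberBundle F₁ V₁]
    [VectorBundle ℝ F₁ V₁]
    {F₂ : Type*} [NormedAddCommGroup F₂] [NormedSpace ℝ F₂]
    {V₂ : M → Type*} [∀ x, AddCommGroup (V₂ x)] [∀ x, Module ℝ (V₂ x)]
    [∀ x, TopologicalSpace (V₂ x)] [TopologicalSpace (TotalSpace F₂ V₂)] [FiberBundle F₂ V₂]
    [VectorBundle ℝ F₂ V₂] [∀ x, IsTopologicalAddGroup (V₂ x)] [∀ x, ContinuousSMul ℝ (V₂ x)]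
    (α : Cₛ^∞⟮𝓘(ℝ, EB); F₁ →L[ℝ] F₂, fun x ↦ V₁ x →L[ℝ] V₂ x⟯) (s : Cₛ^∞⟮𝓘(ℝ, EB); F₁, V₁⟯) :
    Cₛ^∞⟮𝓘(ℝ, EB); F₂, V₂⟯ :=
  ⟨fun x ↦ α x (s x), ContMDiff.clm_bundle_apply α.contMDiff s.contMDiff⟩

/-- The model fibre of `J E → M`. -/
abbrev JetModel (EB F : Type*) [NormedAddCommGroup EB] [NormedSpace ℝ EB] [NormedAddCommGroup F]
    [NormedSpace ℝ F] := F × (EB →L[ℝ] F)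

variable (EB) in
/-- The fibre over `x` of the vector bundle `J E ⊗ E* = Hom(E, J E)`. -/
abbrev JetEnd (x : M) := V x →L[ℝ] Jet EB F V x

/-- The model fibre of `J E ⊗ E*`. -/
abbrev JetEndModel (EB F : Type*) [NormedAddCommGroup EB] [NormedSpace ℝ EB] [NormedAddCommGroup F]
    [NormedSpace ℝ F] := F →L[ℝ] JetModel EB F

variable (EB) in
/-- A linear connection of the vector bundle `E → M`: a smooth linear morphism `E → J E` over `M`
that is a section of `J E → E`, given as a smooth section of `J E ⊗ E*` that projects onto the
identity of `E`. -/
structure LinearConnection where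
  /-- The connection as a section of `J E ⊗ E*`. -/
  toSection : Cₛ^∞⟮𝓘(ℝ, EB); JetEndModel EB F, JetEnd EB F V⟯
  proj_apply : ∀ (x : M) (v : V x), Jet.proj F V x (toSection x v) = v

variable (EB) in
/-- The fibre over `x` of the bundle `C → M` of linear connections of `E`: the elements of
`J E ⊗ E*` over the identity of `E`. -/
def connFiber (x : M) : Set (JetEnd EB F V x) := {A | ∀ v, Jet.proj F V x (A v) = v}

variable {V} in
/-- For a family of subsets `S x` of the fibres (a subbundle), the fibre over `x` of `J S`, as a
subset of the jets of the ambient bundle: the jets at `x` of smooth sections that lie in `S` near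
`x`. -/
def jetsIn (S : ∀ x, Set (V x)) (x : M) : Set (Jet EB F V x) :=
  {u | ∃ s : Cₛ^∞⟮𝓘(ℝ, EB); F, V⟯, jet F x s = u ∧ ∀ᶠ y in 𝓝 x, s y ∈ S y}

variable {F V} in
/-- The covariant derivative `∇s = j s - κ ∘ s` of a section. Its values are vertical, that is, they
lie in `ker (J E → E) = T*M ⊗ E`. -/
def LinearConnection.covDeriv (κ : LinearConnection EB F V) (s : Cₛ^∞⟮𝓘(ℝ, EB); F, V⟯) (x : M) :
    Jet EB F V x :=
  jet F x s - κ.toSection x (s x)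

variable {F V} in
/-- `K = κ' ⊗ κ*`, the linear connection of `J E ⊗ E* = Hom(E, J E)` induced by linear connections
`κ'` of `J E` and `κ` of `E`: if `α` is parallel at `x` for `K` and `s` is parallel at `x` for `κ`,
then `α s` is parallel at `x` for `κ'`. -/
def IsTensorDual (κ' : LinearConnection EB (JetModel EB F) (Jet EB F V))
    (κ : LinearConnection EB F V)
    (K : LinearConnection EB (JetEndModel EB F) (JetEnd EB F V)) : Prop :=
  ∀ (x : M) (α : Cₛ^∞⟮𝓘(ℝ, EB); JetEndModel EB F, JetEnd EB F V⟯)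
    (s : Cₛ^∞⟮𝓘(ℝ, EB); F, V⟯),
    jet _ x α = K.toSection x (α x) → jet _ x s = κ.toSection x (s x) →
      jet _ x (applySection α s) = κ'.toSection x (α x (s x))

end JetConnection

namespace JetConnection

/-! ### Matrix groups -/

/-- `A` is the velocity at `t = 0` of a smooth curve in the matrix group `G` through the identity. -/
def IsVelocity {n : ℕ} (G : Subgroup (Matrix.GeneralLinearGroup (Fin n) ℝ))
    (A : Matrix (Fin n) (Fin n) ℝ) : Prop :=
  ∃ γ : ℝ → Matrix.GeneralLinearGroup (Fin n) ℝ, (∀ t, γ t ∈ G) ∧ γ 0 = 1 ∧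
    (∀ i j, ContDiff ℝ ∞ fun t ↦ (γ t : Matrix (Fin n) (Fin n) ℝ) i j) ∧
    ∀ i j, deriv (fun t ↦ (γ t : Matrix (Fin n) (Fin n) ℝ) i j) 0 = A i j

variable {n : ℕ} (G : Subgroup (Matrix.GeneralLinearGroup (Fin n) ℝ))

/-- The Lie algebra of the matrix group `G`: its tangent space at the identity. -/
def tangentAtOne : Submodule ℝ (Matrix (Fin n) (Fin n) ℝ) where
  carrier := {A | IsVelocity G A}
  zero_mem' := ⟨fun _ ↦ 1, fun _ ↦ G.one_mem, rfl, fun _ _ ↦ contDiff_const, fun i j ↦ by simp⟩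
  add_mem' := by
    rintro A B ⟨γ, hG, h0, hs, hd⟩ ⟨δ, hG', h0', hs', hd'⟩
    refine ⟨fun t ↦ γ t * δ t, fun t ↦ G.mul_mem (hG t) (hG' t), by simp [h0, h0'],
      fun i j ↦ ?_, fun i j ↦ ?_⟩
    · simp only [Units.val_mul, Matrix.mul_apply]
      exact ContDiff.sum fun k _ ↦ (hs i k).mul (hs' k j)
    · simp only [Units.val_mul, Matrix.mul_apply]
      rw [deriv_fun_sum fun k _ ↦ (((hs i k).mul (hs' k j)).differentiable (by simp)).differentiableAt]
      rw [Finset.sum_congr rfl fun k _ ↦ deriv_fun_mul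
        ((hs i k).differentiable (by simp)).differentiableAt
        ((hs' k j).differentiable (by simp)).differentiableAt]
      simp [hd, hd', h0, h0', Finset.sum_add_distrib, Matrix.one_apply]
  smul_mem' := by
    rintro c A ⟨γ, hG, h0, hs, hd⟩
    refine ⟨fun t ↦ γ (c * t), fun t ↦ hG _, by simp [h0], fun i j ↦ ?_, fun i j ↦ ?_⟩
    · exact (hs i j).comp (contDiff_const.mul contDiff_id)
    · have := deriv_comp_mul_left c (fun t ↦ (γ t : Matrix (Fin n) (Fin n) ℝ) i j) 0
      rw [this, mul_zero, hd]; rfl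

theorem conj_mem {B : Matrix (Fin n) (Fin n) ℝ} (g : Matrix.GeneralLinearGroup (Fin n) ℝ)
    (hg : g ∈ G) (hB : B ∈ tangentAtOne G) :
    (g : Matrix (Fin n) (Fin n) ℝ) * B * (g⁻¹ : Matrix.GeneralLinearGroup (Fin n) ℝ) ∈
      tangentAtOne G := by
  obtain ⟨δ, hG, h0, hs, hd⟩ := hB
  refine ⟨fun t ↦ g * δ t * g⁻¹, fun t ↦ G.mul_mem (G.mul_mem hg (hG t)) (G.inv_mem hg),
    by simp [h0], fun i j ↦ ?_, fun i j ↦ ?_⟩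
  · simp only [Units.val_mul, Matrix.mul_apply]
    exact ContDiff.sum fun k _ ↦ (ContDiff.sum fun l _ ↦ contDiff_const.mul (hs l k)).mul
      contDiff_const
  · simp only [Units.val_mul, Matrix.mul_apply]
    have hdd : ∀ i j, DifferentiableAt ℝ (fun t ↦ (δ t : Matrix (Fin n) (Fin n) ℝ) i j) 0 :=
      fun i j ↦ ((hs i j).differentiable (by simp)).differentiableAt
    rw [deriv_fun_sum fun k _ ↦ (DifferentiableAt.fun_sum fun l _ ↦
      (hdd l k).const_mul _).mul_const _]
    refine Finset.sum_congr rfl fun k _ ↦ ?_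
    rw [deriv_mul_const (DifferentiableAt.fun_sum fun l _ ↦ (hdd l k).const_mul _),
      deriv_fun_sum fun l _ ↦ (hdd l k).const_mul _]
    congr 1
    refine Finset.sum_congr rfl fun l _ ↦ ?_
    rw [deriv_const_mul _ (hdd l k), hd]

theorem bracket_mem {A B : Matrix (Fin n) (Fin n) ℝ} (hA : A ∈ tangentAtOne G)
    (hB : B ∈ tangentAtOne G) : A * B - B * A ∈ tangentAtOne G := by
  have hA' := hA
  obtain ⟨γ, hG, h0, hs, hd⟩ := hA'
  have hcont : Continuous fun t ↦ (γ t : Matrix (Fin n) (Fin n) ℝ) :=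
    continuous_matrix fun i j ↦ (hs i j).continuous
  have hq : Tendsto (fun t : ℝ ↦ t⁻¹ • ((γ t : Matrix (Fin n) (Fin n) ℝ) - 1)) (𝓝[≠] 0) (𝓝 A) := by
    refine tendsto_pi_nhds.2 fun i ↦ tendsto_pi_nhds.2 fun j ↦ ?_
    have := (((hs i j).differentiable (by simp)).differentiableAt (x := 0)).hasDerivAt.tendsto_slope_zero
    rw [hd] at this
    simpa [h0] using this
  have hinv : Tendsto (fun t ↦ (((γ t)⁻¹ : Matrix.GeneralLinearGroup (Fin n) ℝ) :
      Matrix (Fin n) (Fin n) ℝ)) (𝓝[≠] 0) (𝓝 1) := by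
    have : ContinuousAt (fun t ↦ (((γ t)⁻¹ : Matrix.GeneralLinearGroup (Fin n) ℝ) :
      Matrix (Fin n) (Fin n) ℝ)) 0 := by
      simp only [Matrix.coe_units_inv, Matrix.inv_def, Ring.inverse_eq_inv']
      refine ContinuousAt.smul (ContinuousAt.inv₀ hcont.matrix_det.continuousAt ?_)
        hcont.matrix_adjugate.continuousAt
      simp [h0]
    have h2 := this.tendsto
    simp only [h0, inv_one, Units.val_one] at h2
    exact h2.mono_left nhdsWithin_le_nhds
  have hlim := ((hq.mul_const B).sub (hq.const_mul B)).mul hinv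
  rw [mul_one] at hlim
  refine (Submodule.closed_of_finiteDimensional (tangentAtOne G)).mem_of_tendsto hlim
    (Eventually.of_forall fun t ↦ ?_)
  have := (tangentAtOne G).smul_mem t⁻¹ ((tangentAtOne G).sub_mem (conj_mem G (γ t) (hG t) hB) hB)
  have hgi : (γ t : Matrix (Fin n) (Fin n) ℝ) *
      (((γ t)⁻¹ : Matrix.GeneralLinearGroup (Fin n) ℝ) : Matrix (Fin n) (Fin n) ℝ) = 1 := by
    rw [← Units.val_mul, mul_inv_cancel, Units.val_one]
  have heq : (t⁻¹ • ((γ t : Matrix (Fin n) (Fin n) ℝ) - 1) * B -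
      B * t⁻¹ • ((γ t : Matrix (Fin n) (Fin n) ℝ) - 1)) *
      (((γ t)⁻¹ : Matrix.GeneralLinearGroup (Fin n) ℝ) : Matrix (Fin n) (Fin n) ℝ) =
      t⁻¹ • ((γ t : Matrix (Fin n) (Fin n) ℝ) * B *
        (((γ t)⁻¹ : Matrix.GeneralLinearGroup (Fin n) ℝ) : Matrix (Fin n) (Fin n) ℝ) - B) := by
    rw [Matrix.smul_mul, Matrix.mul_smul, ← smul_sub, Matrix.smul_mul]
    congr 1
    rw [sub_mul (γ t : Matrix (Fin n) (Fin n) ℝ), mul_sub B, one_mul, mul_one,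
      sub_sub_sub_cancel_right, sub_mul, mul_assoc B, hgi, mul_one]
  exact heq ▸ this

variable {G} in
/-- The structure constants `c^I_{JH} = ⟨l^I, [l_J, l_H]⟩` of the Lie algebra of `G` in the basis
`l`. -/
def structConst {ι : Type*} (l : Module.Basis ι ℝ (tangentAtOne G)) (I J H : ι) : ℝ :=
  l.repr ⟨(l J : Matrix (Fin n) (Fin n) ℝ) * l H - l H * l J,
    bracket_mem G (l J).2 (l H).2⟩ I

variable {G} in
open scoped Classical in
/-- The components `A^I` of a matrix `A = A^I l_I` of the Lie algebra of `G` in the basis `l`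
(zero for matrices outside of the Lie algebra). -/
def lieComp {ι : Type*} (l : Module.Basis ι ℝ (tangentAtOne G)) (A : Matrix (Fin n) (Fin n) ℝ)
    (I : ι) : ℝ :=
  if h : A ∈ tangentAtOne G then l.repr ⟨A, h⟩ I else 0

end JetConnection

namespace JetConnection

/-! ### Coordinates -/

variable {m n : ℕ} {M : Type*} [TopologicalSpace M] [T2Space M]
  [ChartedSpace (EuclideanSpace ℝ (Fin m)) M] [IsManifold (𝓡 m) ∞ M]
  {F : Type*} [NormedAddCommGroup F] [NormedSpace ℝ F]
  {V : M → Type*} [∀ x, AddCommGroup (V x)] [∀ x, Module ℝ (V x)] [∀ x, TopologicalSpace (V x)]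
  [TopologicalSpace (TotalSpace F V)] [FiberBundle F V] [VectorBundle ℝ F V]
  [ContMDiffVectorBundle ∞ F V (𝓡 m)]

/-- The partial derivative `∂_a f` at `x` of a function in the chart `φ` of `M`. -/
def pderiv (φ : OpenPartialHomeomorph M (EuclideanSpace ℝ (Fin m))) (a : Fin m) (f : M → ℝ)
    (x : M) : ℝ :=
  fderiv ℝ (fun u ↦ f (φ.symm u)) (φ x) (EuclideanSpace.single a 1)

variable (m n F V) in
/-- A linear fibred chart `(x^a, y^i)` of `E → M`: a chart of `M` together with a smooth frame
`(y_i)` of `E` over its domain. -/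
structure FibredChart where
  /-- The chart `(x^a)` of `M`. -/
  chart : OpenPartialHomeomorph M (EuclideanSpace ℝ (Fin m))
  chart_mem : chart ∈ IsManifold.maximalAtlas (𝓡 m) ∞ M
  /-- The frame `(y_i)` of `E`, dual to the fibre coordinates `(y^i)`. -/
  frame : Fin n → ∀ x, V x
  isLocalFrame : IsLocalFrameOn (𝓡 m) F ∞ frame chart.source

namespace FibredChart

variable (χ : FibredChart m n F V)

/-- The fibre coordinate `y^i : E_x → ℝ`. -/
def y (i : Fin n) (x : M) : V x →ₗ[ℝ] ℝ := χ.isLocalFrame.coeff i x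

/-- The coordinate `y^i_a : J_x E → ℝ`. -/
def y₁ (i : Fin n) (a : Fin m) {x : M} (u : Jet (EuclideanSpace ℝ (Fin m)) F V x) : ℝ :=
  pderiv χ.chart a (fun z ↦ χ.y i z (u.rep z)) x

/-- The coordinate `y^i` on `J_x J E`. -/
def yy (i : Fin n) {x : M} (u : Jet (EuclideanSpace ℝ (Fin m))
    (JetModel (EuclideanSpace ℝ (Fin m)) F) (Jet (EuclideanSpace ℝ (Fin m)) F V) x) : ℝ :=
  χ.y i x (Jet.proj F V x (u.rep x))

/-- The coordinate on `J_x J E` usually written as `y^i_a` with an underlined `y`: the coordinate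
`y^i_a` of the base point of the jet in `J E`. -/
def yyBase (i : Fin n) (a : Fin m) {x : M} (u : Jet (EuclideanSpace ℝ (Fin m))
    (JetModel (EuclideanSpace ℝ (Fin m)) F) (Jet (EuclideanSpace ℝ (Fin m)) F V) x) : ℝ :=
  χ.y₁ i a (u.rep x)

/-- The coordinate `y^i_a` on `J_x J E`, the derivative of `y^i` along `x^a`. -/
def yy₁ (i : Fin n) (a : Fin m) {x : M} (u : Jet (EuclideanSpace ℝ (Fin m))
    (JetModel (EuclideanSpace ℝ (Fin m)) F) (Jet (EuclideanSpace ℝ (Fin m)) F V) x) : ℝ :=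
  pderiv χ.chart a (fun z ↦ χ.y i z (Jet.proj F V z (u.rep z))) x

/-- The coordinate `y^i_{ab} = (y^i_a)_b` on `J_x J E`, the derivative of `y^i_a` along `x^b`. -/
def yy₂ (i : Fin n) (a b : Fin m) {x : M} (u : Jet (EuclideanSpace ℝ (Fin m))
    (JetModel (EuclideanSpace ℝ (Fin m)) F) (Jet (EuclideanSpace ℝ (Fin m)) F V) x) : ℝ :=
  pderiv χ.chart b (fun z ↦ χ.y₁ i a (u.rep z)) x

/-- The coordinates `y^i_j` on `J E ⊗ E*`, as a matrix. -/
def c₀ {x : M} (A : JetEnd (EuclideanSpace ℝ (Fin m)) F V x) : Matrix (Fin n) (Fin n) ℝ :=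
  Matrix.of fun i j ↦ χ.y i x (Jet.proj F V x (A (χ.frame j x)))

/-- The coordinates `y^i_{bj}` on `J E ⊗ E*`, as a matrix with indices `i, j`. -/
def c₁ (b : Fin m) {x : M} (A : JetEnd (EuclideanSpace ℝ (Fin m)) F V x) :
    Matrix (Fin n) (Fin n) ℝ :=
  Matrix.of fun i j ↦ χ.y₁ i b (A (χ.frame j x))

/-- The derivatives along `x^a` of the coordinates `y^i_j`, for a jet of sections of `J E ⊗ E*`. -/
def dc₀ (a : Fin m) {x : M} (u : Jet (EuclideanSpace ℝ (Fin m))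
    (JetEndModel (EuclideanSpace ℝ (Fin m)) F) (JetEnd (EuclideanSpace ℝ (Fin m)) F V) x) :
    Matrix (Fin n) (Fin n) ℝ :=
  Matrix.of fun i j ↦ pderiv χ.chart a (fun z ↦ χ.c₀ (u.rep z) i j) x

/-- The derivatives along `x^a` of the coordinates `y^i_{bj}`, for a jet of sections of
`J E ⊗ E*`. -/
def dc₁ (a b : Fin m) {x : M} (u : Jet (EuclideanSpace ℝ (Fin m))
    (JetEndModel (EuclideanSpace ℝ (Fin m)) F) (JetEnd (EuclideanSpace ℝ (Fin m)) F V) x) :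
    Matrix (Fin n) (Fin n) ℝ :=
  Matrix.of fun i j ↦ pderiv χ.chart a (fun z ↦ χ.c₁ b (u.rep z) i j) x

/-- The coordinate vector field `∂_a` of the chart, over its domain. -/
def coordField (a : Fin m) (x : M) : TangentSpace (𝓡 m) x :=
  VectorField.mpullback (𝓡 m) (𝓡 m) χ.chart (fun _ ↦ EuclideanSpace.single a (1 : ℝ)) x

/-- The components `Γ_a^c_b` of a linear connection of `T M`, in the convention in which
`∇_a v^c = ∂_a v^c - Γ_a^c_b v^b`. -/
def christoffel (Γ : CovariantDerivative (𝓡 m) (EuclideanSpace ℝ (Fin m))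
    (TangentSpace (𝓡 m) : M → Type _)) (a c b : Fin m) (x : M) : ℝ :=
  -(show EuclideanSpace ℝ (Fin m) from
    mfderiv (𝓡 m) (𝓡 m) χ.chart x (Γ (χ.coordField b) x (χ.coordField a x))) c

/-- The components `κ_a^i_j` of a linear connection of `E`, as a matrix. -/
def comp (κ : LinearConnection (EuclideanSpace ℝ (Fin m)) F V) (a : Fin m) (x : M) :
    Matrix (Fin n) (Fin n) ℝ :=
  χ.c₁ a (κ.toSection x)

/-- The components `ρ_{ab}^i_j` of the curvature tensor of a linear connection of `E`, that is
`κ_{a,b} - κ_{b,a} + κ_a κ_b - κ_b κ_a`, where `κ_{a,b} = ∂_b κ_a`. In terms of the covariant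
derivative `∇_a = ∂_a - κ_a` this is `[∇_a, ∇_b]`. -/
def curvature (κ : LinearConnection (EuclideanSpace ℝ (Fin m)) F V) (a b : Fin m) (x : M) :
    Matrix (Fin n) (Fin n) ℝ :=
  (Matrix.of fun i j ↦ pderiv χ.chart b (fun z ↦ χ.comp κ a z i j) x -
    pderiv χ.chart a (fun z ↦ χ.comp κ b z i j) x) +
    (χ.comp κ a x * χ.comp κ b x - χ.comp κ b x * χ.comp κ a x)

end FibredChart

/-! ### The overconnection -/

/-- `s` is the involution `s_Γ : J J E → J J E` determined by a torsion-free linear connection `Γ`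
of `T M`, given by its coordinate expression in every linear fibred chart. -/
def IsExchange (n : ℕ) (Γ : CovariantDerivative (𝓡 m) (EuclideanSpace ℝ (Fin m))
      (TangentSpace (𝓡 m) : M → Type _))
    (s : ∀ x : M, Jet (EuclideanSpace ℝ (Fin m)) (JetModel (EuclideanSpace ℝ (Fin m)) F)
        (Jet (EuclideanSpace ℝ (Fin m)) F V) x →
      Jet (EuclideanSpace ℝ (Fin m)) (JetModel (EuclideanSpace ℝ (Fin m)) F)
        (Jet (EuclideanSpace ℝ (Fin m)) F V) x) : Prop :=
  ∀ χ : FibredChart m n F V, ∀ x ∈ χ.chart.source, ∀ u i,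
    χ.yy i (s x u) = χ.yy i u ∧
    (∀ a, χ.yyBase i a (s x u) = χ.yy₁ i a u) ∧
    (∀ a, χ.yy₁ i a (s x u) = χ.yyBase i a u) ∧
    ∀ a b, χ.yy₂ i a b (s x u) = χ.yy₂ i b a u +
      ∑ c, χ.christoffel Γ b c a x * (χ.yyBase i c u - χ.yy₁ i c u)

/-- `K` is the linear connection `κ↑ = κ' ⊗ κ*` of `J E ⊗ E*`, where `κ' = s_Γ ∘ J κ` is a linear
connection of `J E`. Here `J κ : J E → J J E` is the jet prolongation of the morphism `κ`, that is,
`(J κ) (j_x φ) = j_x (κ ∘ φ)`. -/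
def IsOverconnection (n : ℕ) (Γ : CovariantDerivative (𝓡 m) (EuclideanSpace ℝ (Fin m))
      (TangentSpace (𝓡 m) : M → Type _))
    (κ : LinearConnection (EuclideanSpace ℝ (Fin m)) F V)
    (K : LinearConnection (EuclideanSpace ℝ (Fin m)) (JetEndModel (EuclideanSpace ℝ (Fin m)) F)
      (JetEnd (EuclideanSpace ℝ (Fin m)) F V)) : Prop :=
  ∃ s, IsExchange n Γ s ∧
    ∃ κ' : LinearConnection (EuclideanSpace ℝ (Fin m)) (JetModel (EuclideanSpace ℝ (Fin m)) F)
        (Jet (EuclideanSpace ℝ (Fin m)) F V),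
      (∀ (x : M) (φ : Cₛ^∞⟮𝓡 m; F, V⟯),
        κ'.toSection x (jet F x φ) = s x (jet _ x (applySection κ.toSection φ))) ∧
      IsTensorDual κ' κ K

/-! ### Fibre structures and gauge fields -/

variable (m F V) in
/-- A structure with group `G ⊆ GL(n, ℝ)` on the fibres of `E`, given by its special frames: at each
point they form an orbit of the right action of `G`, and there are smooth local special frames. The
automorphisms of `E_x` that preserve the special frames at `x` form a group conjugate to `G`. -/
structure FibreStructure (G : Subgroup (Matrix.GeneralLinearGroup (Fin n) ℝ)) where
  /-- The special frames at a point. -/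
  special : ∀ x, Set (Module.Basis (Fin n) ℝ (V x))
  special_iff : ∀ x, ∀ b ∈ special x, ∀ b', b' ∈ special x ↔
    ∃ g ∈ G, ∀ j, b' j = ∑ i, (g : Matrix (Fin n) (Fin n) ℝ) i j • b i
  exists_local : ∀ x, ∃ U, IsOpen U ∧ x ∈ U ∧ ∃ (s : Fin n → ∀ y, V y)
    (h : IsLocalFrameOn (𝓡 m) F ∞ s U), ∀ y (hy : y ∈ U), h.toBasisAt hy ∈ special y

variable {G : Subgroup (Matrix.GeneralLinearGroup (Fin n) ℝ)}

/-- The fibre over `x` of the bundle `C_G → M` of gauge fields: the elements `A` of `C_x` that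
preserve the fibre structure, that is, for which there is a smooth special frame `(β_j)` near `x`
which is parallel at `x`, `j_x β_j = A (β_j x)`. -/
def gaugeFiber (P : FibreStructure m F V G) (x : M) :
    Set (JetEnd (EuclideanSpace ℝ (Fin m)) F V x) :=
  {A | ∃ β : Fin n → Cₛ^∞⟮𝓡 m; F, V⟯, (∀ᶠ z in 𝓝 x, ∃ b ∈ P.special z, ∀ j, b j = β j z) ∧
    ∀ j, jet F x (β j) = A (β j x)}

/-- A gauge field: a linear connection of `E` that is a section of `C_G`. -/
def IsGaugeField (P : FibreStructure m F V G)
    (κ : LinearConnection (EuclideanSpace ℝ (Fin m)) F V) : Prop :=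
  ∀ x, κ.toSection x ∈ gaugeFiber P x

/-- The fibred chart has a special frame. -/
def FibredChart.IsSpecial (χ : FibredChart m n F V) (P : FibreStructure m F V G) : Prop :=
  ∀ x (hx : x ∈ χ.chart.source), χ.isLocalFrame.toBasisAt hx ∈ P.special x

/-- The components `κ_a^I` of a gauge field, in a special frame and a basis `l` of the Lie algebra
of `G`. -/
def FibredChart.gaugeComp {ι : Type*} (χ : FibredChart m n F V)
    (l : Module.Basis ι ℝ (tangentAtOne G))
    (κ : LinearConnection (EuclideanSpace ℝ (Fin m)) F V) (a : Fin m) (I : ι) (x : M) : ℝ :=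
  lieComp l (χ.comp κ a x) I

end JetConnection
end

open JetConnection

noncomputable section

namespace JetConnection

/-! ### Partial derivatives in charts -/

section Pderiv

variable {m : ℕ} {M : Type*} [TopologicalSpace M]
  [ChartedSpace (EuclideanSpace ℝ (Fin m)) M] [IsManifold (𝓡 m) ∞ M]
  {φ ψ : OpenPartialHomeomorph M (EuclideanSpace ℝ (Fin m))} {x : M} {f g : M → ℝ}

theorem contDiffAt_comp_symm (hφ : φ ∈ IsManifold.maximalAtlas (𝓡 m) ∞ M) (hx : x ∈ φ.source)
    (hf : ContMDiffAt (𝓡 m) 𝓘(ℝ) ∞ f x) : ContDiffAt ℝ ∞ (fun u ↦ f (φ.symm u)) (φ x) := by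
  rw [← contMDiffAt_iff_contDiffAt]
  refine ContMDiffAt.comp (φ x) (g := f) ?_
    ((contMDiffOn_symm_of_mem_maximalAtlas hφ).contMDiffAt
      (φ.open_target.mem_nhds (φ.map_source hx)))
  rwa [φ.left_inv hx]

theorem differentiableAt_comp_symm (hφ : φ ∈ IsManifold.maximalAtlas (𝓡 m) ∞ M)
    (hx : x ∈ φ.source) (hf : ContMDiffAt (𝓡 m) 𝓘(ℝ) ∞ f x) :
    DifferentiableAt ℝ (fun u ↦ f (φ.symm u)) (φ x) :=
  (contDiffAt_comp_symm hφ hx hf).differentiableAt (by simp)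

theorem pderiv_congr {a : Fin m} (hx : x ∈ φ.source) (h : f =ᶠ[𝓝 x] g) :
    pderiv φ a f x = pderiv φ a g x := by
  have hc : Tendsto φ.symm (𝓝 (φ x)) (𝓝 x) := by
    have := φ.continuousAt_symm (φ.map_source hx)
    rwa [ContinuousAt, φ.left_inv hx] at this
  have : (fun u ↦ f (φ.symm u)) =ᶠ[𝓝 (φ x)] fun u ↦ g (φ.symm u) := hc.eventually h
  rw [pderiv, this.fderiv_eq, pderiv]

theorem pderiv_const (a : Fin m) (c : ℝ) : pderiv φ a (fun _ ↦ c) x = 0 := by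
  simp [pderiv]

theorem pderiv_add (hφ : φ ∈ IsManifold.maximalAtlas (𝓡 m) ∞ M) (hx : x ∈ φ.source) (a : Fin m)
    (hf : ContMDiffAt (𝓡 m) 𝓘(ℝ) ∞ f x) (hg : ContMDiffAt (𝓡 m) 𝓘(ℝ) ∞ g x) :
    pderiv φ a (fun z ↦ f z + g z) x = pderiv φ a f x + pderiv φ a g x := by
  simp only [pderiv]
  rw [fderiv_fun_add (differentiableAt_comp_symm hφ hx hf) (differentiableAt_comp_symm hφ hx hg)]
  rfl

theorem pderiv_sub (hφ : φ ∈ IsManifold.maximalAtlas (𝓡 m) ∞ M) (hx : x ∈ φ.source) (a : Fin m)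
    (hf : ContMDiffAt (𝓡 m) 𝓘(ℝ) ∞ f x) (hg : ContMDiffAt (𝓡 m) 𝓘(ℝ) ∞ g x) :
    pderiv φ a (fun z ↦ f z - g z) x = pderiv φ a f x - pderiv φ a g x := by
  simp only [pderiv]
  rw [fderiv_fun_sub (differentiableAt_comp_symm hφ hx hf) (differentiableAt_comp_symm hφ hx hg)]
  rfl

theorem pderiv_mul (hφ : φ ∈ IsManifold.maximalAtlas (𝓡 m) ∞ M) (hx : x ∈ φ.source) (a : Fin m)
    (hf : ContMDiffAt (𝓡 m) 𝓘(ℝ) ∞ f x) (hg : ContMDiffAt (𝓡 m) 𝓘(ℝ) ∞ g x) :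
    pderiv φ a (fun z ↦ f z * g z) x = pderiv φ a f x * g x + f x * pderiv φ a g x := by
  simp only [pderiv]
  rw [fderiv_fun_mul (differentiableAt_comp_symm hφ hx hf) (differentiableAt_comp_symm hφ hx hg)]
  simp [φ.left_inv hx]
  ring

theorem pderiv_const_mul (hφ : φ ∈ IsManifold.maximalAtlas (𝓡 m) ∞ M) (hx : x ∈ φ.source)
    (a : Fin m) (c : ℝ) (hf : ContMDiffAt (𝓡 m) 𝓘(ℝ) ∞ f x) :
    pderiv φ a (fun z ↦ c * f z) x = c * pderiv φ a f x := by
  rw [pderiv_mul hφ hx a contMDiffAt_const hf, pderiv_const]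
  ring

theorem pderiv_sum {ι : Type*} (s : Finset ι) (hφ : φ ∈ IsManifold.maximalAtlas (𝓡 m) ∞ M)
    (hx : x ∈ φ.source) (a : Fin m) {f : ι → M → ℝ}
    (hf : ∀ i, ContMDiffAt (𝓡 m) 𝓘(ℝ) ∞ (f i) x) :
    pderiv φ a (fun z ↦ ∑ i ∈ s, f i z) x = ∑ i ∈ s, pderiv φ a (f i) x := by
  simp only [pderiv]
  rw [fderiv_fun_sum fun i _ ↦ differentiableAt_comp_symm hφ hx (hf i)]
  simp

theorem contMDiffAt_coord (hψ : ψ ∈ IsManifold.maximalAtlas (𝓡 m) ∞ M) (hx : x ∈ ψ.source)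
    (c : Fin m) : ContMDiffAt (𝓡 m) 𝓘(ℝ) ∞ (fun z ↦ ψ z c) x :=
  (EuclideanSpace.proj c : EuclideanSpace ℝ (Fin m) →L[ℝ] ℝ).contMDiff.contMDiffAt.comp x
    (contMDiffAt_of_mem_maximalAtlas hψ hx)

theorem fderiv_eq_sum_single {m : ℕ} (L : EuclideanSpace ℝ (Fin m) →L[ℝ] ℝ)
    (v : EuclideanSpace ℝ (Fin m)) : L v = ∑ c, v c * L (EuclideanSpace.single c 1) := by
  conv_lhs => rw [← (EuclideanSpace.basisFun (Fin m) ℝ).sum_repr v]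
  simp

theorem pderiv_coord (hx : x ∈ φ.source) (a c : Fin m) :
    pderiv φ a (fun z ↦ φ z c) x = if c = a then 1 else 0 := by
  have h : (fun u ↦ φ (φ.symm u) c) =ᶠ[𝓝 (φ x)] fun u ↦ u c := by
    filter_upwards [φ.open_target.mem_nhds (φ.map_source hx)] with u hu
    rw [φ.right_inv hu]
  rw [pderiv, h.fderiv_eq]
  change fderiv ℝ (EuclideanSpace.proj c : EuclideanSpace ℝ (Fin m) →L[ℝ] ℝ) (φ x) _ = _
  rw [ContinuousLinearMap.fderiv]
  simp [PiLp.single_apply]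

/-- The chain rule for partial derivatives in two charts. -/
theorem pderiv_chart_change (hφ : φ ∈ IsManifold.maximalAtlas (𝓡 m) ∞ M)
    (hψ : ψ ∈ IsManifold.maximalAtlas (𝓡 m) ∞ M) (hx : x ∈ φ.source) (hx' : x ∈ ψ.source)
    (a : Fin m) (hf : ContMDiffAt (𝓡 m) 𝓘(ℝ) ∞ f x) :
    pderiv ψ a f x = ∑ c, pderiv ψ a (fun z ↦ φ z c) x * pderiv φ c f x := by
  have hT : DifferentiableAt ℝ (fun u ↦ φ (ψ.symm u)) (ψ x) := by
    have : ContMDiffAt 𝓘(ℝ, EuclideanSpace ℝ (Fin m)) 𝓘(ℝ, EuclideanSpace ℝ (Fin m)) ∞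
        (fun u ↦ φ (ψ.symm u)) (ψ x) := by
      refine ContMDiffAt.comp (ψ x) (g := φ) ?_
        ((contMDiffOn_symm_of_mem_maximalAtlas hψ).contMDiffAt
          (ψ.open_target.mem_nhds (ψ.map_source hx')))
      rw [ψ.left_inv hx']
      exact contMDiffAt_of_mem_maximalAtlas hφ hx
    exact (contMDiffAt_iff_contDiffAt.1 this).differentiableAt (by simp)
  have hc : Tendsto ψ.symm (𝓝 (ψ x)) (𝓝 x) := by
    have := ψ.continuousAt_symm (ψ.map_source hx')
    rwa [ContinuousAt, ψ.left_inv hx'] at this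
  have he : (fun u ↦ f (ψ.symm u)) =ᶠ[𝓝 (ψ x)] (fun u ↦ f (φ.symm u)) ∘ fun u ↦ φ (ψ.symm u) := by
    filter_upwards [hc.eventually (φ.open_source.mem_nhds hx)] with u hu
    simp [φ.left_inv hu]
  have hd : DifferentiableAt ℝ (fun u ↦ f (φ.symm u)) (φ (ψ.symm (ψ x))) := by
    rw [ψ.left_inv hx']
    exact differentiableAt_comp_symm hφ hx hf
  rw [pderiv, he.fderiv_eq, fderiv_comp (g := fun u ↦ f (φ.symm u)) (f := fun u ↦ φ (ψ.symm u)) (ψ x) hd hT, ψ.left_inv hx', ContinuousLinearMap.comp_apply,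
    fderiv_eq_sum_single]
  refine Finset.sum_congr rfl fun c _ ↦ ?_
  congr 1
  have := ((EuclideanSpace.proj c : EuclideanSpace ℝ (Fin m) →L[ℝ] ℝ).hasFDerivAt.comp (ψ x)
    hT.hasFDerivAt).fderiv
  rw [pderiv]
  exact (congrArg (fun L : EuclideanSpace ℝ (Fin m) →L[ℝ] ℝ ↦ L (EuclideanSpace.single a 1))
    this).symm

theorem contMDiffAt_pderiv (hφ : φ ∈ IsManifold.maximalAtlas (𝓡 m) ∞ M) (hx : x ∈ φ.source)
    (a : Fin m) (hf : ContMDiffAt (𝓡 m) 𝓘(ℝ) ∞ f x) :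
    ContMDiffAt (𝓡 m) 𝓘(ℝ) ∞ (pderiv φ a f) x := by
  have h1 : ContDiffAt ℝ ∞ (fun u ↦ fderiv ℝ (fun u ↦ f (φ.symm u)) u (EuclideanSpace.single a 1))
      (φ x) := ((contDiffAt_comp_symm hφ hx hf).fderiv_right (m := ∞) (by simp)).clm_apply
        contDiffAt_const
  exact (contMDiffAt_iff_contDiffAt.2 h1).comp x (contMDiffAt_of_mem_maximalAtlas hφ hx)

theorem pderiv_comm (hφ : φ ∈ IsManifold.maximalAtlas (𝓡 m) ∞ M) (hx : x ∈ φ.source)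
    (a b : Fin m) (hf : ContMDiffAt (𝓡 m) 𝓘(ℝ) ∞ f x) :
    pderiv φ a (pderiv φ b f) x = pderiv φ b (pderiv φ a f) x := by
  have hs := contDiffAt_comp_symm hφ hx hf
  have hsym : IsSymmSndFDerivAt ℝ (fun u ↦ f (φ.symm u)) (φ x) :=
    hs.isSymmSndFDerivAt (by
      simpa using! WithTop.coe_le_coe.2 (le_top : (2 : ℕ∞) ≤ ⊤))
  have hd : DifferentiableAt ℝ (fderiv ℝ fun u ↦ f (φ.symm u)) (φ x) :=
    (hs.fderiv_right (m := ∞) (by simp)).differentiableAt (by simp)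
  have key : ∀ a b, pderiv φ a (pderiv φ b f) x =
      fderiv ℝ (fderiv ℝ fun u ↦ f (φ.symm u)) (φ x) (EuclideanSpace.single a 1)
        (EuclideanSpace.single b 1) := by
    intro a b
    have he : (fun u ↦ pderiv φ b f (φ.symm u)) =ᶠ[𝓝 (φ x)]
        fun u ↦ fderiv ℝ (fun u ↦ f (φ.symm u)) u (EuclideanSpace.single b 1) := by
      filter_upwards [φ.open_target.mem_nhds (φ.map_source hx)] with u hu
      rw [pderiv, φ.right_inv hu]
    rw [pderiv, he.fderiv_eq, fderiv_clm_apply hd (differentiableAt_const _)]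
    simp
  rw [key, key]
  exact hsym _ _

/-- A map into continuous linear maps on a finite-dimensional space is smooth if its values at all
vectors are. -/
theorem contMDiffAt_clm_of_apply {D E' : Type*} [NormedAddCommGroup D] [NormedSpace ℝ D]
    [FiniteDimensional ℝ D] [NormedAddCommGroup E'] [NormedSpace ℝ E'] {f : M → D →L[ℝ] E'} {x : M}
    (h : ∀ v, ContMDiffAt (𝓡 m) 𝓘(ℝ, E') ∞ (fun z ↦ f z v) x) :
    ContMDiffAt (𝓡 m) 𝓘(ℝ, D →L[ℝ] E') ∞ f x := by
  -- A basis of `D` identifies linear maps on `D` with finite families of vectors, whose smoothness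
  -- is checked member by member.
  let d := Module.finrank ℝ D
  let e₁ : D ≃L[ℝ] (Fin d → ℝ) := ContinuousLinearEquiv.ofFinrankEq (by simp [d])
  let e₂ : (D →L[ℝ] E') ≃L[ℝ] (Fin d → E') :=
    (e₁.arrowCongr (.refl ℝ E')).trans (ContinuousLinearEquiv.piRing (Fin d))
  have h2 : ContMDiffAt (𝓡 m) 𝓘(ℝ, Fin d → E') ∞ (fun z ↦ e₂ (f z)) x :=
    contMDiffAt_pi_space.2 fun i ↦ h _
  have := e₂.symm.contDiff.contMDiff.contMDiffAt.comp x h2 (n := ∞)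
  simpa [Function.comp_def] using this

end Pderiv

/-! ### Sections -/

section Sections

variable {m : ℕ} {M : Type*} [TopologicalSpace M] [T2Space M]
  [ChartedSpace (EuclideanSpace ℝ (Fin m)) M] [IsManifold (𝓡 m) ∞ M]
  {F : Type*} [NormedAddCommGroup F] [NormedSpace ℝ F]
  {V : M → Type*} [∀ x, AddCommGroup (V x)] [∀ x, Module ℝ (V x)] [∀ x, TopologicalSpace (V x)]
  [TopologicalSpace (TotalSpace F V)] [FiberBundle F V] [VectorBundle ℝ F V]

/-- Every local smooth section agrees near a given point with a global one. -/
theorem exists_global_section [ContMDiffVectorBundle ∞ F V (𝓡 m)] {U : Set M} (hU : IsOpen U)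
    {x : M} (hx : x ∈ U) {t : ∀ z, V z}
    (ht : ContMDiffOn (𝓡 m) ((𝓡 m).prod 𝓘(ℝ, F)) ∞ (fun z ↦ TotalSpace.mk' F z (t z)) U) :
    ∃ s : Cₛ^∞⟮𝓡 m; F, V⟯, ∀ᶠ z in 𝓝 x, s z = t z := by
  -- A bump function equal to 1 near `x` and with support in `U` cuts `t` off to a global section.
  obtain ⟨b, -, hb⟩ := ((SmoothBumpFunction.nhds_basis_tsupport (I := 𝓡 m) x).mem_iff.1
    (hU.mem_nhds hx))
  refine ⟨⟨fun z ↦ b z • t z,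
    ContMDiffOn.smul_section_of_tsupport (b.contMDiff.contMDiffOn) hU hb ht⟩, ?_⟩
  filter_upwards [b.eventuallyEq_one] with z hz
  change b z • t z = t z
  rw [hz]; simp

end Sections

/-! ### Local frames -/

section Frames

variable {m : ℕ} {M : Type*} [TopologicalSpace M]
  [ChartedSpace (EuclideanSpace ℝ (Fin m)) M] [IsManifold (𝓡 m) ∞ M]
  {F : Type*} [NormedAddCommGroup F] [NormedSpace ℝ F] [FiniteDimensional ℝ F]
  {V : M → Type*} [∀ x, AddCommGroup (V x)] [∀ x, Module ℝ (V x)] [∀ x, TopologicalSpace (V x)]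
  [TopologicalSpace (TotalSpace F V)] [FiberBundle F V] [VectorBundle ℝ F V]
  [ContMDiffVectorBundle ∞ F V (𝓡 m)]
  {ι : Type*} [Fintype ι] {e : ι → ∀ x, V x} {U : Set M} {x : M}

theorem coeff_frame [DecidableEq ι] (h : IsLocalFrameOn (𝓡 m) F ∞ e U) (hx : x ∈ U) (i j : ι) :
    h.coeff i x (e j x) = if j = i then 1 else 0 := by
  rw [h.coeff_apply_of_mem hx (e j), ← h.toBasisAt_coe hx j, Module.Basis.repr_self,
    Finsupp.single_apply]

theorem coeff_sum_smul (h : IsLocalFrameOn (𝓡 m) F ∞ e U) (hx : x ∈ U) (c : ι → ℝ) (i : ι) :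
    h.coeff i x (∑ j, c j • e j x) = c i := by
  classical
  simp [map_sum, coeff_frame h hx]

theorem eq_sum_coeff (h : IsLocalFrameOn (𝓡 m) F ∞ e U) (hx : x ∈ U) (v : V x) :
    v = ∑ i, h.coeff i x v • e i x := by
  classical
  -- The expansion is known for sections, so `v` is extended by zero away from `x`; no regularity is
  -- involved.
  have := h.coeff_sum_eq (Function.update (fun z ↦ (0 : V z)) x v) hx
  simpa using this

theorem eq_of_coeff (h : IsLocalFrameOn (𝓡 m) F ∞ e U) (hx : x ∈ U) {v w : V x}
    (hvw : ∀ i, h.coeff i x v = h.coeff i x w) : v = w := by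
  rw [eq_sum_coeff h hx v, eq_sum_coeff h hx w]
  simp [hvw]

/-- The coefficients of a smooth section in a smooth local frame are smooth. -/
theorem contMDiffAt_coeff (h : IsLocalFrameOn (𝓡 m) F ∞ e U) (hU : IsOpen U) (hx : x ∈ U)
    {t : ∀ z, V z}
    (ht : ContMDiffAt (𝓡 m) ((𝓡 m).prod 𝓘(ℝ, F)) ∞ (fun z ↦ TotalSpace.mk' F z (t z)) x) (i : ι) :
    ContMDiffAt (𝓡 m) 𝓘(ℝ) ∞ (fun z ↦ h.coeff i z (t z)) x := by
  let T := trivializationAt F V x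
  have hxT : x ∈ T.baseSet := FiberBundle.mem_baseSet_trivializationAt' x
  -- In the trivialization the frame is a smooth family of linear maps `ℝ^ι → F`, invertible near
  -- `x`. The coefficients of `t` are the inverse maps applied to `t`, and inversion is smooth at an
  -- invertible map.
  let A : M → (ι → ℝ) →L[ℝ] F := fun z ↦
    ∑ i, (ContinuousLinearMap.proj (R := ℝ) (φ := fun _ : ι ↦ ℝ) i).smulRight (T ⟨z, e i z⟩).2
  have hA : ContMDiffAt (𝓡 m) 𝓘(ℝ, (ι → ℝ) →L[ℝ] F) ∞ A x := by
    refine contMDiffAt_clm_of_apply fun v ↦ ?_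
    simp only [A, sum_apply, ContinuousLinearMap.smulRight_apply,
      ContinuousLinearMap.proj_apply]
    refine ContMDiffAt.sum fun j _ ↦ ?_
    have h1 := (T.contMDiffAt_section_iff hxT).1 (h.contMDiffAt hU hx j)
    exact (contMDiffAt_const (I := 𝓡 m) (I' := 𝓘(ℝ)) (c := v j)).smul h1
  let E : ∀ z, z ∈ U → z ∈ T.baseSet → (ι → ℝ) ≃L[ℝ] F := fun z hz hz' ↦
    ((h.toBasisAt hz).equivFun.symm ≪≫ₗ T.linearEquivAt ℝ z hz').toContinuousLinearEquiv
  have hE : ∀ z hz hz', A z = E z hz hz' := by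
    intro z hz hz'
    ext v
    simp [A, E, Module.Basis.equivFun_symm_apply, map_sum]
  have hinv : ContMDiffAt (𝓡 m) 𝓘(ℝ, F →L[ℝ] (ι → ℝ)) ∞
      (fun z ↦ ContinuousLinearMap.inverse (A z)) x := by
    have : ContDiffAt ℝ ∞ ContinuousLinearMap.inverse (A x) := by
      rw [hE x hx hxT]
      exact contDiffAt_map_inverse _
    exact this.contMDiffAt.comp x hA
  have h1 : ContMDiffAt (𝓡 m) 𝓘(ℝ, ι → ℝ) ∞
      (fun z ↦ ContinuousLinearMap.inverse (A z) (T ⟨z, t z⟩).2) x :=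
    hinv.clm_apply ((T.contMDiffAt_section_iff hxT).1 ht)
  refine (contMDiffAt_pi_space.1 h1 i).congr_of_eventuallyEq ?_
  filter_upwards [hU.mem_nhds hx, T.open_baseSet.mem_nhds hxT] with z hz hz'
  rw [hE z hz hz', ContinuousLinearMap.inverse_equiv, h.coeff_apply_of_mem hz t]
  have : (T ⟨z, t z⟩).2 = E z hz hz' ((h.toBasisAt hz).equivFun (t z)) := by
    change _ = T.linearEquivAt ℝ z hz' ((h.toBasisAt hz).equivFun.symm _)
    rw [LinearEquiv.symm_apply_apply]
    rfl
  rw [this]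
  simp

theorem contMDiffAt_section_iff_coeff (h : IsLocalFrameOn (𝓡 m) F ∞ e U) (hU : IsOpen U)
    (hx : x ∈ U) {t : ∀ z, V z} :
    ContMDiffAt (𝓡 m) ((𝓡 m).prod 𝓘(ℝ, F)) ∞ (fun z ↦ TotalSpace.mk' F z (t z)) x ↔
      ∀ i, ContMDiffAt (𝓡 m) 𝓘(ℝ) ∞ (fun z ↦ h.coeff i z (t z)) x :=
  ⟨fun ht i ↦ contMDiffAt_coeff h hU hx ht i,
    fun hi ↦ h.contMDiffAt_of_coeff_aux hi hU hx⟩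

end Frames

/-! ### Coordinates of jets -/

section Jets

variable {m : ℕ} {M : Type*} [TopologicalSpace M] [T2Space M]
  [ChartedSpace (EuclideanSpace ℝ (Fin m)) M] [IsManifold (𝓡 m) ∞ M]
  {F : Type*} [NormedAddCommGroup F] [NormedSpace ℝ F] [FiniteDimensional ℝ F]
  {V : M → Type*} [∀ x, AddCommGroup (V x)] [∀ x, Module ℝ (V x)] [∀ x, TopologicalSpace (V x)]
  [TopologicalSpace (TotalSpace F V)] [FiberBundle F V] [VectorBundle ℝ F V]
  [ContMDiffVectorBundle ∞ F V (𝓡 m)]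
  {φ ψ : OpenPartialHomeomorph M (EuclideanSpace ℝ (Fin m))}
  {ι κ : Type*} [Fintype ι] [Fintype κ] {e : ι → ∀ x, V x} {f : κ → ∀ x, V x} {U U' : Set M} {x : M}

/-- By the product rule, every term in the derivative of a new coefficient contains an old
coefficient or its derivative at `x`, and the chain rule expresses derivatives in one chart through
those in the other. -/
theorem vanishes_first_order_change (hφ : φ ∈ IsManifold.maximalAtlas (𝓡 m) ∞ M)
    (hψ : ψ ∈ IsManifold.maximalAtlas (𝓡 m) ∞ M) (hxφ : x ∈ φ.source) (hxψ : x ∈ ψ.source)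
    (h : IsLocalFrameOn (𝓡 m) F ∞ e U) (h' : IsLocalFrameOn (𝓡 m) F ∞ f U')
    (hU : IsOpen U) (hU' : IsOpen U') (hx : x ∈ U) (hx' : x ∈ U') {s : ∀ z, V z}
    (hs : ContMDiffAt (𝓡 m) ((𝓡 m).prod 𝓘(ℝ, F)) ∞ (fun z ↦ TotalSpace.mk' F z (s z)) x)
    (h0 : ∀ i, h.coeff i x (s x) = 0)
    (h1 : ∀ i a, pderiv φ a (fun z ↦ h.coeff i z (s z)) x = 0) (k : κ) :
    h'.coeff k x (s x) = 0 ∧ ∀ a, pderiv ψ a (fun z ↦ h'.coeff k z (s z)) x = 0 := by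
  have hsx : s x = 0 := by
    rw [eq_sum_coeff h hx (s x)]
    simp [h0]
  refine ⟨by rw [hsx, map_zero], fun a ↦ ?_⟩
  have hev : (fun z ↦ h'.coeff k z (s z)) =ᶠ[𝓝 x]
      fun z ↦ ∑ i, h.coeff i z (s z) * h'.coeff k z (e i z) := by
    filter_upwards [hU.mem_nhds hx] with z hz
    conv_lhs => rw [eq_sum_coeff h hz (s z)]
    simp [map_sum]
  have hc := fun i ↦ contMDiffAt_coeff h hU hx hs i
  have hc' := fun i ↦ contMDiffAt_coeff h' hU' hx' (h.contMDiffAt hU hx i) k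
  rw [pderiv_congr hxψ hev, pderiv_sum _ hψ hxψ a
    (f := fun i z ↦ h.coeff i z (s z) * h'.coeff k z (e i z)) fun i ↦ (hc i).mul (hc' i)]
  refine Finset.sum_eq_zero fun i _ ↦ ?_
  rw [pderiv_mul hψ hxψ a (hc i) (hc' i), h0, pderiv_chart_change hφ hψ hxφ hxψ a (hc i)]
  simp [h1]

/-- Links the definition of jets, made in the preferred chart and trivialization at `x`, to an
arbitrary chart and frame. A basis of `F` turns the trivialization into a local frame, in which the
definition says that coefficients and their derivatives vanish; `vanishes_first_order_change`, used
in both directions, does the rest. -/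
theorem vanishes_first_order_iff (hφ : φ ∈ IsManifold.maximalAtlas (𝓡 m) ∞ M) (hxφ : x ∈ φ.source)
    (h : IsLocalFrameOn (𝓡 m) F ∞ e U) (hU : IsOpen U) (hx : x ∈ U) (s : Cₛ^∞⟮𝓡 m; F, V⟯) :
    jet F x s = 0 ↔ (∀ i, h.coeff i x (s x) = 0) ∧
      ∀ i a, pderiv φ a (fun z ↦ h.coeff i z (s z)) x = 0 := by
  let T := trivializationAt F V x
  have hxT : x ∈ T.baseSet := FiberBundle.mem_baseSet_trivializationAt' x
  let b := Module.finBasis ℝ F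
  let h' := T.isLocalFrameOn_localFrame_baseSet (𝓡 m) ∞ b
  let ψ := chartAt (EuclideanSpace ℝ (Fin m)) x
  have hψ : ψ ∈ IsManifold.maximalAtlas (𝓡 m) ∞ M := IsManifold.chart_mem_maximalAtlas x
  have hxψ : x ∈ ψ.source := mem_chart_source _ x
  have hcoeff : ∀ k, ∀ z ∈ T.baseSet, h'.coeff k z (s z) = b.repr (T ⟨z, s z⟩).2 k := by
    intro k z hz
    have hb : h'.toBasisAt hz = T.basisAt b hz := by
      ext j
      simp [hz]
    rw [h'.coeff_apply_of_mem hz s, hb]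
    simp [Bundle.Trivialization.basisAt]
  have hd : DifferentiableAt ℝ (localRep (EB := EuclideanSpace ℝ (Fin m)) F V x s) (ψ x) :=
    localRep_differentiableAt F V (mem_dom F V x) s
  have hp : ∀ k a, pderiv ψ a (fun z ↦ h'.coeff k z (s z)) x =
      b.repr (fderiv ℝ (localRep (EB := EuclideanSpace ℝ (Fin m)) F V x s) (ψ x)
        (EuclideanSpace.single a 1)) k := by
    intro k a
    have hev : (fun z ↦ h'.coeff k z (s z)) =ᶠ[𝓝 x] fun z ↦ b.repr (T ⟨z, s z⟩).2 k := by
      filter_upwards [T.open_baseSet.mem_nhds hxT] with z hz using hcoeff k z hz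
    rw [pderiv_congr hxψ hev]
    have := ((b.coord k).toContinuousLinearMap.hasFDerivAt.comp _ hd.hasFDerivAt).fderiv
    exact congrArg (fun L : EuclideanSpace ℝ (Fin m) →L[ℝ] ℝ ↦ L (EuclideanSpace.single a 1)) this
  have key : jet F x s = 0 ↔ (∀ k, h'.coeff k x (s x) = 0) ∧
      ∀ k a, pderiv ψ a (fun z ↦ h'.coeff k z (s z)) x = 0 := by
    have : jet F x s = 0 ↔ s ∈ jetKer (EuclideanSpace ℝ (Fin m)) F V x :=
      Submodule.Quotient.mk_eq_zero _
    rw [this]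
    refine and_congr ⟨fun h0 k ↦ by rw [h0, map_zero],
      fun h0 ↦ eq_of_coeff h' hxT fun k ↦ by rw [h0, map_zero]⟩ ?_
    simp only [hp]
    constructor
    · intro h0 k a
      change fderiv ℝ (localRep F V x s) (ψ x) = 0 at h0
      rw [h0]
      simp
    · intro h0
      change fderiv ℝ (localRep F V x s) (ψ x) = 0
      ext v
      apply b.repr.injective
      ext k
      have := fderiv_eq_sum_single ((b.coord k).toContinuousLinearMap.comp
        (fderiv ℝ (localRep (EB := EuclideanSpace ℝ (Fin m)) F V x s) (ψ x))) v
      simpa [h0] using this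
  rw [key]
  constructor
  · rintro ⟨h0, h1⟩
    have := fun i ↦ vanishes_first_order_change hψ hφ hxψ hxφ h' h T.open_baseSet hU hxT hx
      s.contMDiff.contMDiffAt h0 h1 i
    exact ⟨fun i ↦ (this i).1, fun i ↦ (this i).2⟩
  · rintro ⟨h0, h1⟩
    have := fun i ↦ vanishes_first_order_change hφ hψ hxφ hxψ h h' hU T.open_baseSet hx hxT
      s.contMDiff.contMDiffAt h0 h1 i
    exact ⟨fun i ↦ (this i).1, fun i ↦ (this i).2⟩

@[simp]
theorem proj_jet (s : Cₛ^∞⟮𝓡 m; F, V⟯) : Jet.proj F V x (jet F x s) = s x := rfl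

theorem rep_apply (u : Jet (EuclideanSpace ℝ (Fin m)) F V x) : u.rep x = Jet.proj F V x u := by
  conv_rhs => rw [← u.jet_rep]
  rfl

/-- The coordinate `yⁱₐ` of a jet in a chart and a local frame. -/
def jetDeriv (φ : OpenPartialHomeomorph M (EuclideanSpace ℝ (Fin m)))
    (h : IsLocalFrameOn (𝓡 m) F ∞ e U) (i : ι) (a : Fin m) {x : M}
    (u : Jet (EuclideanSpace ℝ (Fin m)) F V x) : ℝ :=
  pderiv φ a (fun z ↦ h.coeff i z (u.rep z)) x

theorem jet_eq_jet_iff (hφ : φ ∈ IsManifold.maximalAtlas (𝓡 m) ∞ M) (hxφ : x ∈ φ.source)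
    (h : IsLocalFrameOn (𝓡 m) F ∞ e U) (hU : IsOpen U) (hx : x ∈ U) (s t : Cₛ^∞⟮𝓡 m; F, V⟯) :
    jet F x s = jet F x t ↔ (∀ i, h.coeff i x (s x) = h.coeff i x (t x)) ∧
      ∀ i a, pderiv φ a (fun z ↦ h.coeff i z (s z)) x =
        pderiv φ a (fun z ↦ h.coeff i z (t z)) x := by
  rw [← sub_eq_zero, ← map_sub, vanishes_first_order_iff hφ hxφ h hU hx]
  have hc := fun (r : Cₛ^∞⟮𝓡 m; F, V⟯) i ↦ contMDiffAt_coeff h hU hx r.contMDiff.contMDiffAt i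
  simp only [ContMDiffSection.coe_sub, Pi.sub_apply, map_sub, sub_eq_zero]
  refine and_congr Iff.rfl (forall₂_congr fun i a ↦ ?_)
  rw [pderiv_sub hφ hxφ a (hc s i) (hc t i), sub_eq_zero]

/-- A coordinate of a jet is computed from a chosen representative; any other representative has the
same coordinate, because the two differ by a section that vanishes to first order. -/
theorem jetDeriv_jet (hφ : φ ∈ IsManifold.maximalAtlas (𝓡 m) ∞ M) (hxφ : x ∈ φ.source)
    (h : IsLocalFrameOn (𝓡 m) F ∞ e U) (hU : IsOpen U) (hx : x ∈ U) (s : Cₛ^∞⟮𝓡 m; F, V⟯)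
    (i : ι) (a : Fin m) :
    jetDeriv φ h i a (jet F x s) = pderiv φ a (fun z ↦ h.coeff i z (s z)) x :=
  ((jet_eq_jet_iff hφ hxφ h hU hx _ _).1 (Jet.jet_rep F V (jet F x s))).2 i a

theorem jetDeriv_add (hφ : φ ∈ IsManifold.maximalAtlas (𝓡 m) ∞ M) (hxφ : x ∈ φ.source)
    (h : IsLocalFrameOn (𝓡 m) F ∞ e U) (hU : IsOpen U) (hx : x ∈ U)
    (u v : Jet (EuclideanSpace ℝ (Fin m)) F V x) (i : ι) (a : Fin m) :
    jetDeriv φ h i a (u + v) = jetDeriv φ h i a u + jetDeriv φ h i a v := by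
  obtain ⟨s, rfl⟩ := jet_surjective F V x u
  obtain ⟨t, rfl⟩ := jet_surjective F V x v
  have hc := fun (r : Cₛ^∞⟮𝓡 m; F, V⟯) i ↦ contMDiffAt_coeff h hU hx r.contMDiff.contMDiffAt i
  rw [← map_add]
  simp only [jetDeriv_jet hφ hxφ h hU hx]
  rw [← pderiv_add hφ hxφ a (hc s i) (hc t i)]
  simp

theorem jetDeriv_smul (hφ : φ ∈ IsManifold.maximalAtlas (𝓡 m) ∞ M) (hxφ : x ∈ φ.source)
    (h : IsLocalFrameOn (𝓡 m) F ∞ e U) (hU : IsOpen U) (hx : x ∈ U)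
    (c : ℝ) (u : Jet (EuclideanSpace ℝ (Fin m)) F V x) (i : ι) (a : Fin m) :
    jetDeriv φ h i a (c • u) = c * jetDeriv φ h i a u := by
  obtain ⟨s, rfl⟩ := jet_surjective F V x u
  have hc := fun (r : Cₛ^∞⟮𝓡 m; F, V⟯) i ↦ contMDiffAt_coeff h hU hx r.contMDiff.contMDiffAt i
  rw [← map_smul]
  simp only [jetDeriv_jet hφ hxφ h hU hx]
  rw [← pderiv_const_mul hφ hxφ a c (hc s i)]
  simp

theorem jet_ext (hφ : φ ∈ IsManifold.maximalAtlas (𝓡 m) ∞ M) (hxφ : x ∈ φ.source)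
    (h : IsLocalFrameOn (𝓡 m) F ∞ e U) (hU : IsOpen U) (hx : x ∈ U)
    {u v : Jet (EuclideanSpace ℝ (Fin m)) F V x}
    (h0 : ∀ i, h.coeff i x (Jet.proj F V x u) = h.coeff i x (Jet.proj F V x v))
    (h1 : ∀ i a, jetDeriv φ h i a u = jetDeriv φ h i a v) : u = v := by
  rw [← u.jet_rep, ← v.jet_rep, jet_eq_jet_iff hφ hxφ h hU hx]
  exact ⟨fun i ↦ by rw [rep_apply, rep_apply, h0], h1⟩

/-- There is a section with prescribed local values in a frame. -/
theorem exists_section_coeff (h : IsLocalFrameOn (𝓡 m) F ∞ e U) (hU : IsOpen U) (hx : x ∈ U)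
    {c : ι → M → ℝ} (hc : ∀ i, ContMDiffOn (𝓡 m) 𝓘(ℝ) ∞ (c i) U) :
    ∃ s : Cₛ^∞⟮𝓡 m; F, V⟯, ∀ᶠ z in 𝓝 x, s z = ∑ i, c i z • e i z :=
  exists_global_section hU hx
    (ContMDiffOn.sum_section fun i _ ↦ (hc i).smul_section (h.contMDiffOn i))

theorem contMDiffOn_coord (hφ : φ ∈ IsManifold.maximalAtlas (𝓡 m) ∞ M) (c : Fin m) :
    ContMDiffOn (𝓡 m) 𝓘(ℝ) ∞ (fun z ↦ φ z c) φ.source :=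
  fun _ hz ↦ (contMDiffAt_coord hφ hz c).contMDiffWithinAt

/-- A jet is an affine function of the coordinates near a point, in a frame. -/
theorem exists_section_affine (hφ : φ ∈ IsManifold.maximalAtlas (𝓡 m) ∞ M) (hx : x ∈ φ.source)
    (h : IsLocalFrameOn (𝓡 m) F ∞ e φ.source) (c : ι → ℝ) (d : ι → Fin m → ℝ) :
    ∃ s : Cₛ^∞⟮𝓡 m; F, V⟯, (∀ᶠ z in 𝓝 x, ∀ i, h.coeff i z (s z) =
        c i + ∑ a, d i a * (φ z a - φ x a)) ∧
      (∀ i, h.coeff i x (s x) = c i) ∧ ∀ i a, jetDeriv φ h i a (jet F x s) = d i a := by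
  have hs : ∀ i, ∀ z ∈ φ.source, ContMDiffAt (𝓡 m) 𝓘(ℝ) ∞
      (fun z ↦ ∑ a, d i a * (φ z a - φ x a)) z := fun i z hz ↦
    ContMDiffAt.sum fun a _ ↦ contMDiffAt_const.mul ((contMDiffAt_coord hφ hz a).sub contMDiffAt_const)
  obtain ⟨s, hs'⟩ := exists_section_coeff h φ.open_source hx
    (c := fun i z ↦ c i + ∑ a, d i a * (φ z a - φ x a))
    (fun i z hz ↦ (contMDiffAt_const.add (hs i z hz)).contMDiffWithinAt)
  have hev : ∀ᶠ z in 𝓝 x, ∀ i, h.coeff i z (s z) = c i + ∑ a, d i a * (φ z a - φ x a) := by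
    filter_upwards [hs', φ.open_source.mem_nhds hx] with z hz hz' i
    rw [hz, coeff_sum_smul h hz']
  refine ⟨s, hev, fun i ↦ by simpa using hev.self_of_nhds i, fun i a ↦ ?_⟩
  rw [jetDeriv_jet hφ hx h φ.open_source hx, pderiv_congr hx (hev.mono fun z hz ↦ hz i),
    pderiv_add hφ hx a contMDiffAt_const (hs i x hx), pderiv_const, zero_add,
    pderiv_sum _ hφ hx a (f := fun b z ↦ d i b * (φ z b - φ x b)) fun b ↦
      contMDiffAt_const.mul ((contMDiffAt_coord hφ hx b).sub contMDiffAt_const)]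
  simp_rw [pderiv_const_mul hφ hx a _ ((contMDiffAt_coord hφ hx _).sub contMDiffAt_const),
    pderiv_sub hφ hx a (contMDiffAt_coord hφ hx _) contMDiffAt_const, pderiv_const,
    pderiv_coord hx]
  simp

/-- The coordinates on `J_x E` as a linear equivalence. -/
def jetCoordEquiv (hφ : φ ∈ IsManifold.maximalAtlas (𝓡 m) ∞ M)
    (h : IsLocalFrameOn (𝓡 m) F ∞ e φ.source) (hx : x ∈ φ.source) :
    Jet (EuclideanSpace ℝ (Fin m)) F V x ≃ₗ[ℝ] (ι ⊕ ι × Fin m → ℝ) :=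
  LinearEquiv.ofBijective
    { toFun := fun u ↦ Sum.elim (fun i ↦ h.coeff i x (Jet.proj F V x u))
        (fun p ↦ jetDeriv φ h p.1 p.2 u)
      map_add' := fun u v ↦ by
        ext (i | p)
        · simp
        · exact jetDeriv_add hφ hx h φ.open_source hx u v _ _
      map_smul' := fun c u ↦ by
        ext (i | p)
        · simp
        · exact jetDeriv_smul hφ hx h φ.open_source hx c u _ _ }
    ⟨fun u v huv ↦ jet_ext hφ hx h φ.open_source hx (fun i ↦ congrFun huv (Sum.inl i))
        (fun i a ↦ by have := congrFun huv (Sum.inr (i, a)); exact this),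
      fun w ↦ by
        obtain ⟨s, -, h0, h1⟩ := exists_section_affine hφ hx h (fun i ↦ w (Sum.inl i))
          (fun i a ↦ w (Sum.inr (i, a)))
        refine ⟨jet F x s, ?_⟩
        ext (i | p)
        · exact h0 i
        · exact h1 p.1 p.2⟩

/-- The jet prolongation of a smooth section is a smooth section. -/
theorem contMDiffAt_jet (s : Cₛ^∞⟮𝓡 m; F, V⟯) (x : M) :
    ContMDiffAt (𝓡 m) ((𝓡 m).prod 𝓘(ℝ, JetModel (EuclideanSpace ℝ (Fin m)) F)) ∞
      (fun z ↦ TotalSpace.mk' (JetModel (EuclideanSpace ℝ (Fin m)) F) z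
        (jet (EB := EuclideanSpace ℝ (Fin m)) F z s)) x := by
  let T := trivializationAt (JetModel (EuclideanSpace ℝ (Fin m)) F)
    (Jet (EuclideanSpace ℝ (Fin m)) F V) x
  have hxT : x ∈ T.baseSet := FiberBundle.mem_baseSet_trivializationAt' x
  rw [T.contMDiffAt_section_iff hxT]
  -- The trivialization of `J E` reads `j_z s` as the value and derivative of the local
  -- representative of `s`, and both are smooth.
  have hev : (fun z ↦ (T ⟨z, jet F z s⟩).2) =ᶠ[𝓝 x]
      fun z ↦ jetCoord (EuclideanSpace ℝ (Fin m)) F V x z s := by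
    filter_upwards [(isOpen_dom F V x).mem_nhds (mem_dom (EB := EuclideanSpace ℝ (Fin m)) F V x)]
      with z hz
    rw [← jetEquiv_jet F V hz, ← jetPretriv_apply F V hz]
    rfl
  refine ContMDiffAt.congr_of_eventuallyEq ?_ hev
  have h1 := (contDiffOn_localRep (EB := EuclideanSpace ℝ (Fin m)) F V x s).contDiffAt
    ((isOpen_cdom F V x).mem_nhds (mem_cdom F V (mem_dom F V x)))
  have h2 := h1.prodMk (h1.fderiv_right (m := ∞) (by simp))
  exact h2.contMDiffAt.comp x (contMDiffAt_of_mem_maximalAtlas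
    (IsManifold.chart_mem_maximalAtlas x) (mem_chart_source _ x))

open scoped Classical in
/-- The frame of `J E` induced by a chart and a frame of `E`, dual to the coordinates `yⁱ, yⁱₐ`. -/
def jetFrame (hφ : φ ∈ IsManifold.maximalAtlas (𝓡 m) ∞ M)
    (h : IsLocalFrameOn (𝓡 m) F ∞ e φ.source) (k : ι ⊕ ι × Fin m) (x : M) :
    Jet (EuclideanSpace ℝ (Fin m)) F V x :=
  if hx : x ∈ φ.source then (jetCoordEquiv hφ h hx).symm (Pi.single k 1) else 0

/-- In each fibre the basis property is transported by `jetCoordEquiv`; smoothness is the point.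
Near `x` let `s = e_i` and `t = (x^c - x^c(x)) e_i`. The components of `s` are constant, so `j_z s`
is the vector dual to `y^i`. The combination `j_z t - (x^c(z) - x^c(x)) j_z s` has value zero and a
single nonzero derivative coordinate, so it is dual to `y^i_c`. Jets of smooth sections are smooth.
-/
theorem isLocalFrameOn_jetFrame (hφ : φ ∈ IsManifold.maximalAtlas (𝓡 m) ∞ M)
    (h : IsLocalFrameOn (𝓡 m) F ∞ e φ.source) :
    IsLocalFrameOn (𝓡 m) (JetModel (EuclideanSpace ℝ (Fin m)) F) ∞ (jetFrame hφ h) φ.source := by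
  classical
  have hb : ∀ {x} (hx : x ∈ φ.source),
      (jetFrame hφ h · x) = Module.Basis.ofEquivFun (jetCoordEquiv hφ h hx) := by
    intro x hx
    funext k
    simp only [jetFrame, dif_pos hx, Module.Basis.coe_ofEquivFun]
  refine ⟨fun hx ↦ ?_, fun hx ↦ ?_, fun k x hx ↦ ContMDiffAt.contMDiffWithinAt ?_⟩
  · rw [hb hx]
    exact Module.Basis.linearIndependent _
  · rw [hb hx]
    exact (Module.Basis.span_eq _).ge
  obtain ⟨i, hi⟩ : ∃ i, k = Sum.inl i ∨ ∃ c, k = Sum.inr (i, c) := by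
    rcases k with i | ⟨i, c⟩
    · exact ⟨i, Or.inl rfl⟩
    · exact ⟨i, Or.inr ⟨c, rfl⟩⟩
  obtain ⟨s, hs⟩ := exists_global_section φ.open_source hx (h.contMDiffOn i)
  have hsc : ∀ᶠ z in 𝓝 x, ∀ j, h.coeff j z (s z) = if i = j then 1 else 0 := by
    filter_upwards [hs, φ.open_source.mem_nhds hx] with z hz hz' j
    rw [hz, coeff_frame h hz']
  rcases hi with rfl | ⟨c, rfl⟩
  · refine (contMDiffAt_jet s x).congr_of_eventuallyEq ?_
    filter_upwards [hsc.eventually_nhds, φ.open_source.mem_nhds hx] with z hz hz'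
    congr 1
    rw [jetFrame, dif_pos hz', LinearEquiv.symm_apply_eq]
    ext (j | ⟨j, d⟩)
    · change _ = h.coeff j z (s z)
      rw [hz.self_of_nhds]
      simp [Pi.single_apply, eq_comm]
    · change _ = jetDeriv φ h j d (jet F z s)
      rw [jetDeriv_jet hφ hz' h φ.open_source hz', pderiv_congr hz' (hz.mono fun w hw ↦ hw j),
        pderiv_const]
      simp
  · obtain ⟨t, ht⟩ := exists_global_section φ.open_source hx
      (((contMDiffOn_coord hφ c).sub (contMDiffOn_const (c := φ x c))).smul_section
        (h.contMDiffOn i))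
    have htc : ∀ᶠ z in 𝓝 x, ∀ j, h.coeff j z (t z) = (φ z c - φ x c) * if i = j then 1 else 0 := by
      filter_upwards [ht, φ.open_source.mem_nhds hx] with z hz hz' j
      rw [hz]
      change h.coeff j z ((φ z c - φ x c) • e i z) = _
      rw [map_smul, coeff_frame h hz', smul_eq_mul]
    have hsm := (contMDiffAt_jet t x).sub_section
      (((contMDiffAt_coord hφ hx c).sub (contMDiffAt_const (c := φ x c))).smul_section
        (contMDiffAt_jet s x))
    refine hsm.congr_of_eventuallyEq ?_
    filter_upwards [hsc.eventually_nhds, htc.eventually_nhds, φ.open_source.mem_nhds hx]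
      with z hz hz₁ hz'
    congr 1
    rw [jetFrame, dif_pos hz', LinearEquiv.symm_apply_eq]
    change _ = jetCoordEquiv hφ h hz' (jet F z t - (φ z c - φ x c) • jet F z s)
    rw [map_sub, map_smul]
    ext (j | ⟨j, d⟩)
    · change _ = h.coeff j z (t z) - (φ z c - φ x c) * h.coeff j z (s z)
      rw [hz.self_of_nhds, hz₁.self_of_nhds]
      simp
    · change _ = jetDeriv φ h j d (jet F z t) - (φ z c - φ x c) * jetDeriv φ h j d (jet F z s)
      rw [jetDeriv_jet hφ hz' h φ.open_source hz', jetDeriv_jet hφ hz' h φ.open_source hz',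
        pderiv_congr hz' (hz.mono fun w hw ↦ hw j), pderiv_const,
        pderiv_congr hz' (hz₁.mono fun w hw ↦ hw j),
        pderiv_mul hφ hz' d ((contMDiffAt_coord hφ hz' c).sub contMDiffAt_const) contMDiffAt_const,
        pderiv_const, pderiv_sub hφ hz' d (contMDiffAt_coord hφ hz' c) contMDiffAt_const,
        pderiv_const, pderiv_coord hz']
      by_cases h1 : i = j <;> by_cases h2 : c = d <;>
        simp [h1, h2, eq_comm]

theorem jetFrame_coeff (hφ : φ ∈ IsManifold.maximalAtlas (𝓡 m) ∞ M)
    (h : IsLocalFrameOn (𝓡 m) F ∞ e φ.source) (hx : x ∈ φ.source) (k : ι ⊕ ι × Fin m)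
    (u : Jet (EuclideanSpace ℝ (Fin m)) F V x) :
    (isLocalFrameOn_jetFrame hφ h).coeff k x u = jetCoordEquiv hφ h hx u k := by
  classical
  have : u = ∑ l, jetCoordEquiv hφ h hx u l • jetFrame hφ h l x := by
    apply (jetCoordEquiv hφ h hx).injective
    rw [map_sum]
    simp only [map_smul, jetFrame, dif_pos hx, LinearEquiv.apply_symm_apply]
    ext l
    simp [Pi.single_apply]
  conv_lhs => rw [this]
  exact coeff_sum_smul _ hx _ k

theorem jetFrame_coeff_inl (hφ : φ ∈ IsManifold.maximalAtlas (𝓡 m) ∞ M)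
    (h : IsLocalFrameOn (𝓡 m) F ∞ e φ.source) (hx : x ∈ φ.source) (i : ι)
    (u : Jet (EuclideanSpace ℝ (Fin m)) F V x) :
    (isLocalFrameOn_jetFrame hφ h).coeff (Sum.inl i) x u = h.coeff i x (Jet.proj F V x u) :=
  jetFrame_coeff hφ h hx _ u

theorem jetFrame_coeff_inr (hφ : φ ∈ IsManifold.maximalAtlas (𝓡 m) ∞ M)
    (h : IsLocalFrameOn (𝓡 m) F ∞ e φ.source) (hx : x ∈ φ.source) (i : ι) (a : Fin m)
    (u : Jet (EuclideanSpace ℝ (Fin m)) F V x) :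
    (isLocalFrameOn_jetFrame hφ h).coeff (Sum.inr (i, a)) x u = jetDeriv φ h i a u :=
  jetFrame_coeff hφ h hx _ u

/-- A section of `J E` is smooth if and only if its coordinates are. -/
theorem contMDiffAt_jet_section_iff (hφ : φ ∈ IsManifold.maximalAtlas (𝓡 m) ∞ M)
    (h : IsLocalFrameOn (𝓡 m) F ∞ e φ.source) (hx : x ∈ φ.source)
    {W : ∀ z, Jet (EuclideanSpace ℝ (Fin m)) F V z} :
    ContMDiffAt (𝓡 m) ((𝓡 m).prod 𝓘(ℝ, JetModel (EuclideanSpace ℝ (Fin m)) F)) ∞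
      (fun z ↦ TotalSpace.mk' (JetModel (EuclideanSpace ℝ (Fin m)) F) z (W z)) x ↔
    (∀ i, ContMDiffAt (𝓡 m) 𝓘(ℝ) ∞ (fun z ↦ h.coeff i z (Jet.proj F V z (W z))) x) ∧
    ∀ i a, ContMDiffAt (𝓡 m) 𝓘(ℝ) ∞ (fun z ↦ jetDeriv φ h i a (W z)) x := by
  rw [contMDiffAt_section_iff_coeff (isLocalFrameOn_jetFrame hφ h) φ.open_source hx, Sum.forall,
    Prod.forall]
  refine and_congr (forall_congr' fun i ↦ ?_) (forall₂_congr fun i a ↦ ?_)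
  · apply Filter.EventuallyEq.contMDiffAt_iff
    filter_upwards [φ.open_source.mem_nhds hx] with z hz using jetFrame_coeff_inl hφ h hz i _
  · apply Filter.EventuallyEq.contMDiffAt_iff
    filter_upwards [φ.open_source.mem_nhds hx] with z hz using jetFrame_coeff_inr hφ h hz i a _

end Jets

/-! ### Frames of homomorphism bundles -/

section HomFrame

variable {m : ℕ} {M : Type*} [TopologicalSpace M] [T2Space M]
  [ChartedSpace (EuclideanSpace ℝ (Fin m)) M] [IsManifold (𝓡 m) ∞ M]
  {F₁ : Type*} [NormedAddCommGroup F₁] [NormedSpace ℝ F₁] [FiniteDimensional ℝ F₁]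
  {V₁ : M → Type*} [∀ x, AddCommGroup (V₁ x)] [∀ x, Module ℝ (V₁ x)]
  [∀ x, TopologicalSpace (V₁ x)] [TopologicalSpace (TotalSpace F₁ V₁)] [FiberBundle F₁ V₁]
  [VectorBundle ℝ F₁ V₁]
  {F₂ : Type*} [NormedAddCommGroup F₂] [NormedSpace ℝ F₂]
  {V₂ : M → Type*} [∀ x, AddCommGroup (V₂ x)] [∀ x, Module ℝ (V₂ x)]
  [∀ x, TopologicalSpace (V₂ x)] [TopologicalSpace (TotalSpace F₂ V₂)] [FiberBundle F₂ V₂]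
  [VectorBundle ℝ F₂ V₂] [∀ x, IsTopologicalAddGroup (V₂ x)] [∀ x, ContinuousSMul ℝ (V₂ x)]

variable (F₁) in
/-- Linear maps on a fibre of finite dimension are continuous. -/
def fibreCLM {W : Type*} [AddCommGroup W] [Module ℝ W] [TopologicalSpace W]
    [IsTopologicalAddGroup W] [ContinuousSMul ℝ W] {x : M} (L : V₁ x →ₗ[ℝ] W) : V₁ x →L[ℝ] W :=
  ⟨L, by
    have hx := FiberBundle.mem_baseSet_trivializationAt' (F := F₁) (E := V₁) x
    let E := (trivializationAt F₁ V₁ x).continuousLinearEquivAt ℝ x hx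
    have h : Continuous (L ∘ₗ (E.symm : F₁ →ₗ[ℝ] V₁ x)) :=
      LinearMap.continuous_of_finiteDimensional _
    have h2 := h.comp E.continuous
    convert! h2 using 1
    funext v
    simp⟩

@[simp]
theorem fibreCLM_apply {W : Type*} [AddCommGroup W] [Module ℝ W] [TopologicalSpace W]
    [IsTopologicalAddGroup W] [ContinuousSMul ℝ W] {x : M} (L : V₁ x →ₗ[ℝ] W) (v : V₁ x) :
    fibreCLM F₁ L v = L v := rfl

variable [ContMDiffVectorBundle ∞ F₁ V₁ (𝓡 m)] [ContMDiffVectorBundle ∞ F₂ V₂ (𝓡 m)]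

/-- A section of `Hom(E₁, E₂)` is smooth if it maps smooth sections to smooth sections. -/
theorem contMDiffAt_hom_of_apply {x : M} {α : ∀ z, V₁ z →L[ℝ] V₂ z}
    (h : ∀ s : Cₛ^∞⟮𝓡 m; F₁, V₁⟯, ContMDiffAt (𝓡 m) ((𝓡 m).prod 𝓘(ℝ, F₂)) ∞
      (fun z ↦ TotalSpace.mk' F₂ z (α z (s z))) x) :
    ContMDiffAt (𝓡 m) ((𝓡 m).prod 𝓘(ℝ, F₁ →L[ℝ] F₂)) ∞
      (fun z ↦ TotalSpace.mk' (F₁ →L[ℝ] F₂) (E := fun z ↦ V₁ z →L[ℝ] V₂ z) z (α z)) x := by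
  rw [contMDiffAt_hom_bundle]
  refine ⟨contMDiffAt_id, contMDiffAt_clm_of_apply fun v ↦ ?_⟩
  let T₁ := trivializationAt F₁ V₁ x
  let T₂ := trivializationAt F₂ V₂ x
  have hx₁ : x ∈ T₁.baseSet := FiberBundle.mem_baseSet_trivializationAt' x
  have hx₂ : x ∈ T₂.baseSet := FiberBundle.mem_baseSet_trivializationAt' x
  -- The test sections are those that are constant in the trivialization, replaced by global
  -- sections with the same germ at `x`.
  have hv : ContMDiffOn (𝓡 m) ((𝓡 m).prod 𝓘(ℝ, F₁)) ∞
      (fun z ↦ TotalSpace.mk' F₁ z (T₁.symm z v)) T₁.baseSet := by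
    rw [T₁.contMDiffOn_section_baseSet_iff]
    refine (contMDiffOn_const (c := v)).congr fun z hz ↦ ?_
    rw [T₁.apply_mk_symm hz]
  obtain ⟨s, hs⟩ := exists_global_section T₁.open_baseSet hx₁ hv
  refine ((T₂.contMDiffAt_section_iff hx₂).1 (h s)).congr_of_eventuallyEq ?_
  filter_upwards [hs, T₁.open_baseSet.mem_nhds hx₁, T₂.open_baseSet.mem_nhds hx₂]
    with z hz hz₁ hz₂
  rw [hz]
  change ContinuousLinearMap.inCoordinates F₁ V₁ F₂ V₂ x z x z (α z) v = _
  rw [ContinuousLinearMap.inCoordinates_eq hz₁ hz₂]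
  rfl

theorem contMDiffAt_applySection {x : M} {α : ∀ z, V₁ z →L[ℝ] V₂ z} {s : ∀ z, V₁ z}
    (hα : ContMDiffAt (𝓡 m) ((𝓡 m).prod 𝓘(ℝ, F₁ →L[ℝ] F₂)) ∞
      (fun z ↦ TotalSpace.mk' (F₁ →L[ℝ] F₂) (E := fun z ↦ V₁ z →L[ℝ] V₂ z) z (α z)) x)
    (hs : ContMDiffAt (𝓡 m) ((𝓡 m).prod 𝓘(ℝ, F₁)) ∞ (fun z ↦ TotalSpace.mk' F₁ z (s z)) x) :
    ContMDiffAt (𝓡 m) ((𝓡 m).prod 𝓘(ℝ, F₂)) ∞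
      (fun z ↦ TotalSpace.mk' F₂ z (α z (s z))) x :=
  ContMDiffAt.clm_bundle_apply hα hs

variable [FiniteDimensional ℝ F₂]
  {ι κ : Type*} [Fintype ι] [Fintype κ] {e : ι → ∀ x, V₁ x} {f : κ → ∀ x, V₂ x} {U : Set M} {x : M}

/-- The frame of `Hom(E₁, E₂)` induced by frames of `E₁` and `E₂`. -/
def homFrame (h : IsLocalFrameOn (𝓡 m) F₁ ∞ e U) (f : κ → ∀ x, V₂ x) (p : κ × ι) (x : M) :
    V₁ x →L[ℝ] V₂ x :=
  fibreCLM F₁ ((h.coeff p.2 x).smulRight (f p.1 x))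

theorem isLocalFrameOn_homFrame (h : IsLocalFrameOn (𝓡 m) F₁ ∞ e U)
    (h' : IsLocalFrameOn (𝓡 m) F₂ ∞ f U) (hU : IsOpen U) :
    IsLocalFrameOn (𝓡 m) (F₁ →L[ℝ] F₂) ∞ (homFrame h f) U := by
  classical
  -- The coefficients of a combination are recovered by applying it to the frame of `E₁` and taking
  -- coordinates in that of `E₂`. This gives linear independence, and also identifies any `A` with
  -- its expansion.
  have key : ∀ {x} (_ : x ∈ U) (c : κ × ι → ℝ) (p : κ × ι),
      h'.coeff p.1 x ((∑ q, c q • homFrame h f q x) (e p.2 x)) = c p := by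
    intro x hx c p
    simp only [sum_apply, smul_apply, homFrame, fibreCLM_apply,
      LinearMap.smulRight_apply, map_sum, map_smul, coeff_frame h hx, coeff_frame h' hx,
      Fintype.sum_prod_type, smul_eq_mul]
    simp
  refine ⟨fun {x} hx ↦ ?_, fun {x} hx A _ ↦ ?_, fun p x hx ↦ ContMDiffAt.contMDiffWithinAt ?_⟩
  · rw [Fintype.linearIndependent_iff]
    intro c hc p
    rw [← key hx c p, hc]
    simp
  · have : A = ∑ q : κ × ι, h'.coeff q.1 x (A (e q.2 x)) • homFrame h f q x := by
      ext v
      refine eq_of_coeff h' hx fun k ↦ ?_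
      rw [eq_sum_coeff h hx v]
      simp only [map_sum, map_smul]
      refine Finset.sum_congr rfl fun j _ ↦ ?_
      rw [key hx (fun q ↦ h'.coeff q.1 x (A (e q.2 x))) (k, j)]
    rw [this]
    exact Submodule.sum_mem _ fun q _ ↦ Submodule.smul_mem _ _ (Submodule.subset_span ⟨q, rfl⟩)
  · refine contMDiffAt_hom_of_apply fun s ↦ ?_
    exact (contMDiffAt_coeff h hU hx s.contMDiff.contMDiffAt p.2).smul_section
      (h'.contMDiffAt hU hx p.1)

theorem homFrame_coeff (h : IsLocalFrameOn (𝓡 m) F₁ ∞ e U)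
    (h' : IsLocalFrameOn (𝓡 m) F₂ ∞ f U) (hU : IsOpen U) (hx : x ∈ U) (k : κ) (j : ι)
    (A : V₁ x →L[ℝ] V₂ x) :
    (isLocalFrameOn_homFrame h h' hU).coeff (k, j) x A = h'.coeff k x (A (e j x)) := by
  classical
  conv_rhs => rw [eq_sum_coeff (isLocalFrameOn_homFrame h h' hU) hx A]
  simp only [sum_apply, smul_apply, homFrame, fibreCLM_apply,
      LinearMap.smulRight_apply, map_sum, map_smul, coeff_frame h hx, coeff_frame h' hx,
      Fintype.sum_prod_type, smul_eq_mul]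
  simp

end HomFrame

/-! ### Coordinate vector fields and Christoffel symbols -/

section Christoffel

variable {m : ℕ} {M : Type*} [TopologicalSpace M]
  [ChartedSpace (EuclideanSpace ℝ (Fin m)) M] [IsManifold (𝓡 m) ∞ M]
  {φ ψ : OpenPartialHomeomorph M (EuclideanSpace ℝ (Fin m))} {x : M} {f g : M → ℝ}

/-- The derivative of a chart, with values in the model space. -/
def dchart (φ : OpenPartialHomeomorph M (EuclideanSpace ℝ (Fin m))) (x : M) :
    TangentSpace (𝓡 m) x →L[ℝ] EuclideanSpace ℝ (Fin m) :=
  mfderiv (𝓡 m) (𝓡 m) φ x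

/-- The coordinate vector field `∂_a` of a chart. -/
def chartField (φ : OpenPartialHomeomorph M (EuclideanSpace ℝ (Fin m))) (a : Fin m) (x : M) :
    TangentSpace (𝓡 m) x :=
  VectorField.mpullback (𝓡 m) (𝓡 m) φ (fun _ ↦ EuclideanSpace.single a (1 : ℝ)) x

theorem mdifferentiableAt_chart (hφ : φ ∈ IsManifold.maximalAtlas (𝓡 m) ∞ M) (hx : x ∈ φ.source) :
    MDifferentiableAt (𝓡 m) (𝓡 m) φ x :=
  (contMDiffAt_of_mem_maximalAtlas hφ hx).mdifferentiableAt (by simp)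

theorem mdifferentiable_chart (hφ : φ ∈ IsManifold.maximalAtlas (𝓡 m) ∞ M) :
    φ.MDifferentiable (𝓡 m) (𝓡 m) :=
  ⟨(contMDiffOn_of_mem_maximalAtlas hφ).mdifferentiableOn (by simp),
    (contMDiffOn_symm_of_mem_maximalAtlas hφ).mdifferentiableOn (by simp)⟩

theorem isInvertible_mfderiv_chart (hφ : φ ∈ IsManifold.maximalAtlas (𝓡 m) ∞ M)
    (hx : x ∈ φ.source) : (mfderiv (𝓡 m) (𝓡 m) φ x).IsInvertible :=
  ⟨(mdifferentiable_chart hφ).mfderiv hx, rfl⟩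

theorem dchart_injective (hφ : φ ∈ IsManifold.maximalAtlas (𝓡 m) ∞ M) (hx : x ∈ φ.source) :
    Function.Injective (dchart φ x) :=
  ((mdifferentiable_chart hφ).mfderiv hx).injective

theorem dchart_chartField (hφ : φ ∈ IsManifold.maximalAtlas (𝓡 m) ∞ M) (hx : x ∈ φ.source)
    (a : Fin m) : dchart φ x (chartField φ a x) = EuclideanSpace.single a 1 := by
  have h : (mfderiv (𝓡 m) (𝓡 m) φ x).inverse = _ :=
    ContinuousLinearMap.inverse_equiv ((mdifferentiable_chart hφ).mfderiv hx)
  have h' : chartField φ a x =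
      ((mdifferentiable_chart hφ).mfderiv hx).symm (EuclideanSpace.single a (1 : ℝ)) :=
    congrArg (fun L ↦ L (EuclideanSpace.single a (1 : ℝ))) h
  rw [h']
  exact ((mdifferentiable_chart hφ).mfderiv hx).apply_symm_apply _

theorem mdifferentiableAt_chartField (hφ : φ ∈ IsManifold.maximalAtlas (𝓡 m) ∞ M)
    (hx : x ∈ φ.source) (a : Fin m) :
    MDifferentiableAt (𝓡 m) ((𝓡 m).prod 𝓘(ℝ, EuclideanSpace ℝ (Fin m)))
      (fun z ↦ TotalSpace.mk' (EuclideanSpace ℝ (Fin m)) z (chartField φ a z)) x := by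
  refine MDifferentiableAt.mpullback_vectorField (n := ∞) ?_
    (contMDiffAt_of_mem_maximalAtlas hφ hx) (isInvertible_mfderiv_chart hφ hx)
    (by simpa using! WithTop.coe_le_coe.2 (le_top : (2 : ℕ∞) ≤ ⊤))
  exact ((contMDiff_vectorSpace_iff_contDiff (V := fun _ ↦ EuclideanSpace.single a (1 : ℝ))).2
    (contDiff_const (n := 1))).mdifferentiable (by simp) _

/-- The derivative of a function in coordinates. -/
theorem mfderiv_eq_sum_pderiv (hφ : φ ∈ IsManifold.maximalAtlas (𝓡 m) ∞ M) (hx : x ∈ φ.source)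
    (hf : ContMDiffAt (𝓡 m) 𝓘(ℝ) ∞ f x) (w : TangentSpace (𝓡 m) x) :
    mvfderiv (𝓡 m) f x w = ∑ a, dchart φ x w a * pderiv φ a f x := by
  have hev : f =ᶠ[𝓝 x] (fun u ↦ f (φ.symm u)) ∘ φ := by
    filter_upwards [φ.open_source.mem_nhds hx] with z hz
    simp [φ.left_inv hz]
  have h1 : mvfderiv (𝓡 m) f x w =
      fderiv ℝ (fun u ↦ f (φ.symm u)) (φ x) (dchart φ x w) := by
    have hd := (differentiableAt_comp_symm hφ hx hf).mdifferentiableAt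
    have h2 : mfderiv (𝓡 m) 𝓘(ℝ) f x = _ :=
      hev.mfderiv_eq.trans (mfderiv_comp x hd (mdifferentiableAt_chart hφ hx))
    have h3 := congrArg (fun L : TangentSpace (𝓡 m) x →L[ℝ] ℝ ↦ L w) h2
    rw [mfderiv_eq_fderiv] at h3
    exact h3
  rw [h1, fderiv_eq_sum_single]
  rfl

theorem dchart_change (hφ : φ ∈ IsManifold.maximalAtlas (𝓡 m) ∞ M)
    (hψ : ψ ∈ IsManifold.maximalAtlas (𝓡 m) ∞ M) (hx : x ∈ φ.source) (hx' : x ∈ ψ.source)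
    (w : TangentSpace (𝓡 m) x) (c : Fin m) :
    dchart φ x w c = ∑ a, dchart ψ x w a * pderiv ψ a (fun z ↦ φ z c) x := by
  rw [← mfderiv_eq_sum_pderiv hψ hx' (contMDiffAt_coord hφ hx c),
    mfderiv_eq_sum_pderiv hφ hx (contMDiffAt_coord hφ hx c)]
  simp [pderiv_coord hx]

theorem chartField_change (hφ : φ ∈ IsManifold.maximalAtlas (𝓡 m) ∞ M)
    (hψ : ψ ∈ IsManifold.maximalAtlas (𝓡 m) ∞ M) (hx : x ∈ φ.source) (hx' : x ∈ ψ.source)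
    (a : Fin m) :
    chartField ψ a x = ∑ c, pderiv ψ a (fun z ↦ φ z c) x • chartField φ c x := by
  apply dchart_injective hφ hx
  ext c
  rw [dchart_change hφ hψ hx hx', dchart_chartField hψ hx', map_sum]
  simp [map_smul, dchart_chartField hφ hx, Pi.single_apply]

variable (Γ : CovariantDerivative (𝓡 m) (EuclideanSpace ℝ (Fin m))
    (TangentSpace (𝓡 m) : M → Type _))

/-- The components `Γ_a^c_b` of a linear connection of `T M` in a chart. -/
def chartChristoffel (φ : OpenPartialHomeomorph M (EuclideanSpace ℝ (Fin m)))
    (a c b : Fin m) (x : M) : ℝ :=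
  -dchart φ x (Γ (chartField φ b) x (chartField φ a x)) c

theorem mdifferentiableAt_section_sum {V : M → Type*} {F : Type*} [NormedAddCommGroup F]
    [NormedSpace ℝ F] [∀ x, AddCommGroup (V x)] [∀ x, Module ℝ (V x)] [∀ x, TopologicalSpace (V x)]
    [TopologicalSpace (TotalSpace F V)] [FiberBundle F V] [VectorBundle ℝ F V]
    {ι : Type*} (s : Finset ι) {σ : ι → ∀ z, V z} {x : M}
    (h : ∀ i, MDifferentiableAt (𝓡 m) ((𝓡 m).prod 𝓘(ℝ, F)) (fun z ↦ TotalSpace.mk' F z (σ i z)) x) :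
    MDifferentiableAt (𝓡 m) ((𝓡 m).prod 𝓘(ℝ, F))
      (fun z ↦ TotalSpace.mk' F z ((∑ i ∈ s, σ i) z)) x := by
  simpa only [Finset.sum_apply] using MDifferentiableAt.sum_section (s := s) fun i _ ↦ h i

theorem covariantDerivative_sum {ι : Type*} (s : Finset ι)
    {σ : ι → ∀ z : M, TangentSpace (𝓡 m) z} {x : M}
    (h : ∀ i, MDifferentiableAt (𝓡 m) ((𝓡 m).prod 𝓘(ℝ, EuclideanSpace ℝ (Fin m)))
      (fun z ↦ TotalSpace.mk' (EuclideanSpace ℝ (Fin m)) z (σ i z)) x) :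
    Γ (∑ i ∈ s, σ i) x = ∑ i ∈ s, Γ (σ i) x := by
  classical
  induction s using Finset.induction_on with
  | empty => simp
  | insert i s hi ih =>
    rw [Finset.sum_insert hi, Finset.sum_insert hi, ← ih]
    exact Γ.isCovariantDerivativeOnUniv.add (h i) (mdifferentiableAt_section_sum s h)

theorem mdifferentiableAt_of_contMDiffAt (hf : ContMDiffAt (𝓡 m) 𝓘(ℝ) ∞ f x) :
    MDifferentiableAt (𝓡 m) 𝓘(ℝ) f x :=
  hf.mdifferentiableAt (by simp)

/-- The transformation law of the Christoffel symbols. -/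
theorem christoffel_change (hφ : φ ∈ IsManifold.maximalAtlas (𝓡 m) ∞ M)
    (hψ : ψ ∈ IsManifold.maximalAtlas (𝓡 m) ∞ M) (hx : x ∈ φ.source) (hx' : x ∈ ψ.source)
    (a b f : Fin m) :
    ∑ e, chartChristoffel Γ ψ b e a x * pderiv ψ e (fun z ↦ φ z f) x =
      ∑ c, (pderiv ψ a (fun z ↦ φ z c) x *
        ∑ d, pderiv ψ b (fun z ↦ φ z d) x * chartChristoffel Γ φ d f c x) -
      pderiv ψ b (pderiv ψ a (fun z ↦ φ z f)) x := by
  have hJ : ∀ c, ContMDiffAt (𝓡 m) 𝓘(ℝ) ∞ (pderiv ψ a fun z ↦ φ z c) x := fun c ↦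
    contMDiffAt_pderiv hψ hx' a (contMDiffAt_coord hφ hx c)
  have hd := fun c ↦ mdifferentiableAt_chartField hφ hx c
  -- Near `x` the field `∂_a` of `ψ` is the combination of the fields of `φ` with coefficients `∂_a
  -- φ^c`. The Leibniz rule of `Γ` differentiates these coefficients and so produces the second
  -- derivatives, with a minus sign because of the sign convention for the components.
  have h1 : Γ (chartField ψ a) x =
      Γ (∑ c, (pderiv ψ a fun z ↦ φ z c) • chartField φ c) x := by
    refine Γ.isCovariantDerivativeOnUniv.congr_of_eventuallyEq
      (mdifferentiableAt_chartField hψ hx' a) (mdifferentiableAt_section_sum _ fun c ↦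
        (mdifferentiableAt_of_contMDiffAt (hJ c)).smul_section (hd c)) univ_mem ?_
    filter_upwards [φ.open_source.mem_nhds hx, ψ.open_source.mem_nhds hx'] with z hz hz'
    rw [chartField_change hφ hψ hz hz', Finset.sum_apply]
    rfl
  rw [covariantDerivative_sum Γ _ fun c ↦
        (mdifferentiableAt_of_contMDiffAt (hJ c)).smul_section (hd c)] at h1
  have h2 : ∀ c, Γ ((pderiv ψ a fun z ↦ φ z c) • chartField φ c) x = _ := fun c ↦
    Γ.isCovariantDerivativeOnUniv.leibniz (hd c) (mdifferentiableAt_of_contMDiffAt (hJ c))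
  simp only [h2] at h1
  simp only [chartChristoffel, neg_mul, Finset.sum_neg_distrib]
  rw [← dchart_change hφ hψ hx hx', h1]
  simp only [sum_apply, add_apply, smul_apply, ContinuousLinearMap.smulRight_apply, map_sum,
    map_add, map_smul, dchart_chartField hφ hx, mfderiv_eq_sum_pderiv hψ hx' (hJ _),
    dchart_chartField hψ hx']
  simp only [chartField_change hφ hψ hx hx' b, map_sum, map_smul]
  simp [Pi.single_apply, Finset.sum_add_distrib, Finset.mul_sum]
  ring_nf

end Christoffel

/-! ### Second jets -/

section SecondJets

variable {m : ℕ} {M : Type*} [TopologicalSpace M] [T2Space M]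
  [ChartedSpace (EuclideanSpace ℝ (Fin m)) M] [IsManifold (𝓡 m) ∞ M]
  {F : Type*} [NormedAddCommGroup F] [NormedSpace ℝ F] [FiniteDimensional ℝ F]
  {V : M → Type*} [∀ x, AddCommGroup (V x)] [∀ x, Module ℝ (V x)] [∀ x, TopologicalSpace (V x)]
  [TopologicalSpace (TotalSpace F V)] [FiberBundle F V] [VectorBundle ℝ F V]
  [ContMDiffVectorBundle ∞ F V (𝓡 m)]
  {φ ψ : OpenPartialHomeomorph M (EuclideanSpace ℝ (Fin m))}
  {ι κ : Type*} [Fintype ι] [Fintype κ] {e : ι → ∀ x, V x} {f : κ → ∀ x, V x} {U U' : Set M} {x : M}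

variable (m F V) in
/-- The fibre of `J J E`. -/
abbrev JetJet (x : M) := Jet (EuclideanSpace ℝ (Fin m))
  (JetModel (EuclideanSpace ℝ (Fin m)) F) (Jet (EuclideanSpace ℝ (Fin m)) F V) x

/-- The derivative of `yⁱ` along `x^a` on `J J E`. -/
def jjDeriv (φ : OpenPartialHomeomorph M (EuclideanSpace ℝ (Fin m)))
    (h : IsLocalFrameOn (𝓡 m) F ∞ e U) (i : ι) (a : Fin m) {x : M} (u : JetJet m F V x) : ℝ :=
  pderiv φ a (fun z ↦ h.coeff i z (Jet.proj F V z (u.rep z))) x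

/-- The derivative of `yⁱₐ` along `x^b` on `J J E`. -/
def jjDeriv₂ (φ : OpenPartialHomeomorph M (EuclideanSpace ℝ (Fin m)))
    (h : IsLocalFrameOn (𝓡 m) F ∞ e U) (i : ι) (a b : Fin m) {x : M} (u : JetJet m F V x) : ℝ :=
  pderiv φ b (fun z ↦ jetDeriv φ h i a (u.rep z)) x

theorem coeff_change (h : IsLocalFrameOn (𝓡 m) F ∞ e U) (h' : IsLocalFrameOn (𝓡 m) F ∞ f U')
    (hx : x ∈ U) (k : κ) (v : V x) :
    h'.coeff k x v = ∑ i, h'.coeff k x (e i x) * h.coeff i x v := by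
  conv_lhs => rw [eq_sum_coeff h hx v]
  simp [map_sum, mul_comm]

theorem contMDiffAt_coeff_frame (h : IsLocalFrameOn (𝓡 m) F ∞ e U)
    (h' : IsLocalFrameOn (𝓡 m) F ∞ f U') (hU : IsOpen U) (hU' : IsOpen U') (hx : x ∈ U)
    (hx' : x ∈ U') (k : κ) (i : ι) :
    ContMDiffAt (𝓡 m) 𝓘(ℝ) ∞ (fun z ↦ h'.coeff k z (e i z)) x :=
  contMDiffAt_coeff h' hU' hx' (h.contMDiffAt hU hx i) k

theorem pderiv_coeff_change (hφ : φ ∈ IsManifold.maximalAtlas (𝓡 m) ∞ M) (hxφ : x ∈ φ.source)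
    (h : IsLocalFrameOn (𝓡 m) F ∞ e U) (h' : IsLocalFrameOn (𝓡 m) F ∞ f U') (hU : IsOpen U)
    (hU' : IsOpen U') (hx : x ∈ U) (hx' : x ∈ U') {s : ∀ z, V z}
    (hs : ContMDiffAt (𝓡 m) ((𝓡 m).prod 𝓘(ℝ, F)) ∞ (fun z ↦ TotalSpace.mk' F z (s z)) x)
    (k : κ) (a : Fin m) :
    pderiv φ a (fun z ↦ h'.coeff k z (s z)) x =
      ∑ i, (h'.coeff k x (e i x) * pderiv φ a (fun z ↦ h.coeff i z (s z)) x +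
        pderiv φ a (fun z ↦ h'.coeff k z (e i z)) x * h.coeff i x (s x)) := by
  have hc := fun i ↦ contMDiffAt_coeff h hU hx hs i
  have hg := contMDiffAt_coeff_frame h h' hU hU' hx hx' k
  have hev : (fun z ↦ h'.coeff k z (s z)) =ᶠ[𝓝 x]
      fun z ↦ ∑ i, h'.coeff k z (e i z) * h.coeff i z (s z) := by
    filter_upwards [hU.mem_nhds hx] with z hz using coeff_change h h' hz k _
  rw [pderiv_congr hxφ hev, pderiv_sum _ hφ hxφ a
    (f := fun i z ↦ h'.coeff k z (e i z) * h.coeff i z (s z)) fun i ↦ (hg i).mul (hc i)]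
  refine Finset.sum_congr rfl fun i _ ↦ ?_
  rw [pderiv_mul hφ hxφ a (hg i) (hc i)]
  ring

theorem jetDeriv_change_frame (hφ : φ ∈ IsManifold.maximalAtlas (𝓡 m) ∞ M) (hxφ : x ∈ φ.source)
    (h : IsLocalFrameOn (𝓡 m) F ∞ e U) (h' : IsLocalFrameOn (𝓡 m) F ∞ f U') (hU : IsOpen U)
    (hU' : IsOpen U') (hx : x ∈ U) (hx' : x ∈ U') (k : κ) (a : Fin m)
    (u : Jet (EuclideanSpace ℝ (Fin m)) F V x) :
    jetDeriv φ h' k a u = ∑ i, (h'.coeff k x (e i x) * jetDeriv φ h i a u +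
        pderiv φ a (fun z ↦ h'.coeff k z (e i z)) x * h.coeff i x (Jet.proj F V x u)) := by
  rw [← rep_apply]
  exact pderiv_coeff_change hφ hxφ h h' hU hU' hx hx' u.rep.contMDiff.contMDiffAt k a

section

variable (σ : Cₛ^∞⟮𝓡 m; JetModel (EuclideanSpace ℝ (Fin m)) F, Jet (EuclideanSpace ℝ (Fin m)) F V⟯)

theorem contMDiffAt_proj (hφ : φ ∈ IsManifold.maximalAtlas (𝓡 m) ∞ M)
    (h : IsLocalFrameOn (𝓡 m) F ∞ e φ.source) (hx : x ∈ φ.source) :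
    ContMDiffAt (𝓡 m) ((𝓡 m).prod 𝓘(ℝ, F)) ∞
      (fun z ↦ TotalSpace.mk' F z (Jet.proj F V z (σ z))) x :=
  (contMDiffAt_section_iff_coeff h φ.open_source hx).2
    ((contMDiffAt_jet_section_iff hφ h hx).1 σ.contMDiff.contMDiffAt).1

theorem contMDiffAt_jetDeriv (hφ : φ ∈ IsManifold.maximalAtlas (𝓡 m) ∞ M)
    (h : IsLocalFrameOn (𝓡 m) F ∞ e φ.source) (hx : x ∈ φ.source) (i : ι) (a : Fin m) :
    ContMDiffAt (𝓡 m) 𝓘(ℝ) ∞ (fun z ↦ jetDeriv φ h i a (σ z)) x :=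
  ((contMDiffAt_jet_section_iff hφ h hx).1 σ.contMDiff.contMDiffAt).2 i a

theorem eventually_jetDeriv_change_frame (hφ : φ ∈ IsManifold.maximalAtlas (𝓡 m) ∞ M)
    (h : IsLocalFrameOn (𝓡 m) F ∞ e φ.source) (h' : IsLocalFrameOn (𝓡 m) F ∞ f U')
    (hU' : IsOpen U') (hx : x ∈ φ.source) (hx' : x ∈ U') (k : κ) (a : Fin m) :
    (fun z ↦ jetDeriv φ h' k a (σ z)) =ᶠ[𝓝 x] fun z ↦ ∑ i,
      (h'.coeff k z (e i z) * jetDeriv φ h i a (σ z) +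
        pderiv φ a (fun z ↦ h'.coeff k z (e i z)) z * h.coeff i z (Jet.proj F V z (σ z))) := by
  filter_upwards [φ.open_source.mem_nhds hx, hU'.mem_nhds hx'] with z hz hz'
  exact jetDeriv_change_frame hφ hz h h' φ.open_source hU' hz hz' k a (σ z)

/-- Here the chart `φ` and the frame `f` have different domains, whereas the induced frame of `J E`
is built from a frame over the whole domain of the chart. Smoothness is transferred from such a
frame `e` by the transformation law. -/
theorem contMDiffAt_jetDeriv' (hφ : φ ∈ IsManifold.maximalAtlas (𝓡 m) ∞ M)
    (h : IsLocalFrameOn (𝓡 m) F ∞ e φ.source) (h' : IsLocalFrameOn (𝓡 m) F ∞ f U')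
    (hU' : IsOpen U') (hx : x ∈ φ.source) (hx' : x ∈ U') (k : κ) (a : Fin m) :
    ContMDiffAt (𝓡 m) 𝓘(ℝ) ∞ (fun z ↦ jetDeriv φ h' k a (σ z)) x := by
  have hg := contMDiffAt_coeff_frame h h' φ.open_source hU' hx hx' k
  refine ContMDiffAt.congr_of_eventuallyEq (ContMDiffAt.sum fun i _ ↦ ?_)
    (eventually_jetDeriv_change_frame σ hφ h h' hU' hx hx' k a)
  exact ((hg i).mul (contMDiffAt_jetDeriv σ hφ h hx i a)).add
    ((contMDiffAt_pderiv hφ hx a (hg i)).mul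
      (contMDiffAt_coeff h φ.open_source hx (contMDiffAt_proj σ hφ h hx) i))

end

theorem jjDeriv_change_frame (hφ : φ ∈ IsManifold.maximalAtlas (𝓡 m) ∞ M)
    (h : IsLocalFrameOn (𝓡 m) F ∞ e φ.source) (h' : IsLocalFrameOn (𝓡 m) F ∞ f U')
    (hU' : IsOpen U') (hx : x ∈ φ.source) (hx' : x ∈ U') (k : κ) (a : Fin m) (u : JetJet m F V x) :
    jjDeriv φ h' k a u = ∑ i, (h'.coeff k x (e i x) * jjDeriv φ h i a u +
        pderiv φ a (fun z ↦ h'.coeff k z (e i z)) x *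
          h.coeff i x (Jet.proj F V x (Jet.proj _ _ x u))) := by
  rw [← rep_apply u]
  exact pderiv_coeff_change hφ hx h h' φ.open_source hU' hx hx' (contMDiffAt_proj u.rep hφ h hx) k a

/-- Differentiates the law `y'_a = g y_a + (∂_a g) y` along `x^b`. Of the two cross terms, the one
with `∂_b g` contains the coordinate `y_a` of the base point, and the one with `∂_a g` contains the
derivative of `y` along `x^b`; on `J J E` these are unrelated coordinates. -/
theorem jjDeriv₂_change_frame (hφ : φ ∈ IsManifold.maximalAtlas (𝓡 m) ∞ M)
    (h : IsLocalFrameOn (𝓡 m) F ∞ e φ.source) (h' : IsLocalFrameOn (𝓡 m) F ∞ f U')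
    (hU' : IsOpen U') (hx : x ∈ φ.source) (hx' : x ∈ U') (k : κ) (a b : Fin m)
    (u : JetJet m F V x) :
    jjDeriv₂ φ h' k a b u = ∑ i,
      (pderiv φ b (fun z ↦ h'.coeff k z (e i z)) x * jetDeriv φ h i a (Jet.proj _ _ x u) +
        h'.coeff k x (e i x) * jjDeriv₂ φ h i a b u +
        (pderiv φ b (pderiv φ a (fun z ↦ h'.coeff k z (e i z))) x *
          h.coeff i x (Jet.proj F V x (Jet.proj _ _ x u)) +
        pderiv φ a (fun z ↦ h'.coeff k z (e i z)) x * jjDeriv φ h i b u)) := by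
  have hg := contMDiffAt_coeff_frame h h' φ.open_source hU' hx hx' k
  have hJ := fun i ↦ contMDiffAt_jetDeriv u.rep hφ h hx i a
  have hc := contMDiffAt_coeff h φ.open_source hx (contMDiffAt_proj u.rep hφ h hx)
  have hdg := fun i ↦ contMDiffAt_pderiv hφ hx a (hg i)
  rw [jjDeriv₂, pderiv_congr hx (eventually_jetDeriv_change_frame u.rep hφ h h' hU' hx hx' k a),
    pderiv_sum _ hφ hx b (f := fun i z ↦ h'.coeff k z (e i z) * jetDeriv φ h i a (u.rep z) +
        pderiv φ a (fun z ↦ h'.coeff k z (e i z)) z * h.coeff i z (Jet.proj F V z (u.rep z)))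
      fun i ↦ ((hg i).mul (hJ i)).add ((hdg i).mul (hc i)), ← rep_apply u]
  refine Finset.sum_congr rfl fun i _ ↦ ?_
  rw [pderiv_add hφ hx b (f := fun z ↦ h'.coeff k z (e i z) * jetDeriv φ h i a (u.rep z))
    (g := fun z ↦ pderiv φ a (fun z ↦ h'.coeff k z (e i z)) z *
      h.coeff i z (Jet.proj F V z (u.rep z)))
    ((hg i).mul (hJ i)) ((hdg i).mul (hc i)), pderiv_mul hφ hx b (hg i) (hJ i),
    pderiv_mul hφ hx b (hdg i) (hc i)]
  rfl

theorem jetDeriv_change_chart (hφ : φ ∈ IsManifold.maximalAtlas (𝓡 m) ∞ M)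
    (hψ : ψ ∈ IsManifold.maximalAtlas (𝓡 m) ∞ M) (hxφ : x ∈ φ.source) (hxψ : x ∈ ψ.source)
    (h : IsLocalFrameOn (𝓡 m) F ∞ e U) (hU : IsOpen U) (hx : x ∈ U) (i : ι) (a : Fin m)
    (u : Jet (EuclideanSpace ℝ (Fin m)) F V x) :
    jetDeriv ψ h i a u = ∑ c, pderiv ψ a (fun z ↦ φ z c) x * jetDeriv φ h i c u :=
  pderiv_chart_change hφ hψ hxφ hxψ a (contMDiffAt_coeff h hU hx u.rep.contMDiff.contMDiffAt i)

theorem jjDeriv_change_chart (hφ : φ ∈ IsManifold.maximalAtlas (𝓡 m) ∞ M)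
    (hψ : ψ ∈ IsManifold.maximalAtlas (𝓡 m) ∞ M) (hxφ : x ∈ φ.source)
    (h : IsLocalFrameOn (𝓡 m) F ∞ e ψ.source) (hx : x ∈ ψ.source) (i : ι) (a : Fin m)
    (u : JetJet m F V x) :
    jjDeriv ψ h i a u = ∑ c, pderiv ψ a (fun z ↦ φ z c) x * jjDeriv φ h i c u :=
  pderiv_chart_change hφ hψ hxφ hx a
    (contMDiffAt_coeff h ψ.open_source hx (contMDiffAt_proj u.rep hψ h hx) i)

/-- The frame `f` is kept fixed. The auxiliary frame `e` over the domain of `φ` serves only to make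
the coordinates in `φ` smooth before they are differentiated. -/
theorem jjDeriv₂_change_chart (hφ : φ ∈ IsManifold.maximalAtlas (𝓡 m) ∞ M)
    (hψ : ψ ∈ IsManifold.maximalAtlas (𝓡 m) ∞ M) (hxφ : x ∈ φ.source)
    (h : IsLocalFrameOn (𝓡 m) F ∞ e φ.source) (h' : IsLocalFrameOn (𝓡 m) F ∞ f ψ.source)
    (hx : x ∈ ψ.source) (k : κ) (a b : Fin m) (u : JetJet m F V x) :
    jjDeriv₂ ψ h' k a b u = ∑ c,
      (pderiv ψ b (pderiv ψ a (fun z ↦ φ z c)) x * jetDeriv φ h' k c (Jet.proj _ _ x u) +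
        pderiv ψ a (fun z ↦ φ z c) x *
          ∑ d, pderiv ψ b (fun z ↦ φ z d) x * jjDeriv₂ φ h' k c d u) := by
  have hJ := fun c ↦ contMDiffAt_pderiv hψ hx a (contMDiffAt_coord hφ hxφ c)
  have hp := fun c ↦ contMDiffAt_jetDeriv' u.rep hφ h h' ψ.open_source hxφ hx k c
  have hev : (fun z ↦ jetDeriv ψ h' k a (u.rep z)) =ᶠ[𝓝 x] fun z ↦
      ∑ c, pderiv ψ a (fun z ↦ φ z c) z * jetDeriv φ h' k c (u.rep z) := by
    filter_upwards [φ.open_source.mem_nhds hxφ, ψ.open_source.mem_nhds hx] with z hz hz'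
    exact jetDeriv_change_chart hφ hψ hz hz' h' ψ.open_source hz' k a _
  rw [jjDeriv₂, pderiv_congr hx hev, pderiv_sum _ hψ hx b
    (f := fun c z ↦ pderiv ψ a (fun z ↦ φ z c) z * jetDeriv φ h' k c (u.rep z))
    fun c ↦ (hJ c).mul (hp c), ← rep_apply u]
  refine Finset.sum_congr rfl fun c _ ↦ ?_
  rw [pderiv_mul hψ hx b (hJ c) (hp c), pderiv_chart_change hφ hψ hxφ hx b (hp c)]
  rfl

/-! ### The exchange of second jets -/

variable (Γ : CovariantDerivative (𝓡 m) (EuclideanSpace ℝ (Fin m))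
    (TangentSpace (𝓡 m) : M → Type _))

/-- `w = s_Γ(u)` in the coordinates given by a chart and a frame. -/
def IsExchanged (φ : OpenPartialHomeomorph M (EuclideanSpace ℝ (Fin m)))
    (h : IsLocalFrameOn (𝓡 m) F ∞ e U) {x : M} (u w : JetJet m F V x) : Prop :=
  (∀ i, h.coeff i x (Jet.proj F V x (Jet.proj _ _ x w)) =
      h.coeff i x (Jet.proj F V x (Jet.proj _ _ x u))) ∧
  (∀ i a, jetDeriv φ h i a (Jet.proj _ _ x w) = jjDeriv φ h i a u) ∧
  (∀ i a, jjDeriv φ h i a w = jetDeriv φ h i a (Jet.proj _ _ x u)) ∧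
  (∀ i a b, jjDeriv₂ φ h i a b w = jjDeriv₂ φ h i b a u +
      ∑ c, chartChristoffel Γ φ b c a x *
        (jetDeriv φ h i c (Jet.proj _ _ x u) - jjDeriv φ h i c u))

variable {Γ} {h : IsLocalFrameOn (𝓡 m) F ∞ e U} {u w : JetJet m F V x}

theorem IsExchanged.mk (h0 : ∀ i, h.coeff i x (Jet.proj F V x (Jet.proj _ _ x w)) =
        h.coeff i x (Jet.proj F V x (Jet.proj _ _ x u)))
    (h1 : ∀ i a, jetDeriv φ h i a (Jet.proj _ _ x w) = jjDeriv φ h i a u)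
    (h2 : ∀ i a, jjDeriv φ h i a w = jetDeriv φ h i a (Jet.proj _ _ x u))
    (h3 : ∀ i a b, jjDeriv₂ φ h i a b w = jjDeriv₂ φ h i b a u +
        ∑ c, chartChristoffel Γ φ b c a x *
          (jetDeriv φ h i c (Jet.proj _ _ x u) - jjDeriv φ h i c u)) :
    IsExchanged Γ φ h u w :=
  ⟨h0, h1, h2, h3⟩

theorem IsExchanged.val (H : IsExchanged Γ φ h u w) :
    ∀ i, h.coeff i x (Jet.proj F V x (Jet.proj _ _ x w)) =
        h.coeff i x (Jet.proj F V x (Jet.proj _ _ x u)) :=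
  H.1

theorem IsExchanged.base (H : IsExchanged Γ φ h u w) :
    ∀ i a, jetDeriv φ h i a (Jet.proj _ _ x w) = jjDeriv φ h i a u :=
  H.2.1

theorem IsExchanged.deriv (H : IsExchanged Γ φ h u w) :
    ∀ i a, jjDeriv φ h i a w = jetDeriv φ h i a (Jet.proj _ _ x u) :=
  H.2.2.1

theorem IsExchanged.deriv₂ (H : IsExchanged Γ φ h u w) :
    ∀ i a b, jjDeriv₂ φ h i a b w = jjDeriv₂ φ h i b a u +
        ∑ c, chartChristoffel Γ φ b c a x *
          (jetDeriv φ h i c (Jet.proj _ _ x u) - jjDeriv φ h i c u) :=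
  H.2.2.2

/-- The two cross terms of `jjDeriv₂_change_frame` are swapped when base coordinates and derivative
coordinates are exchanged along with `a` and `b`, and the second derivatives of the transition
matrix are symmetric. In the term with `Γ` the derivatives of the transition matrix cancel in the
difference, because both kinds of first derivatives lie over the same value `y`. -/
theorem IsExchanged.change_frame (hφ : φ ∈ IsManifold.maximalAtlas (𝓡 m) ∞ M)
    {h : IsLocalFrameOn (𝓡 m) F ∞ e φ.source} (H : IsExchanged Γ φ h u w)
    (h' : IsLocalFrameOn (𝓡 m) F ∞ f U')
    (hU' : IsOpen U') (hx : x ∈ φ.source) (hx' : x ∈ U') :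
    IsExchanged Γ φ h' u w := by
  refine .mk ?_ ?_ ?_ ?_
  · intro k
    rw [coeff_change h h' hx, coeff_change h h' hx]
    simp only [H.val]
  · intro k a
    rw [jetDeriv_change_frame hφ hx h h' φ.open_source hU' hx hx',
      jjDeriv_change_frame hφ h h' hU' hx hx']
    simp only [H.val, H.base]
  · intro k a
    rw [jetDeriv_change_frame hφ hx h h' φ.open_source hU' hx hx',
      jjDeriv_change_frame hφ h h' hU' hx hx']
    simp only [H.val, H.deriv]
  · intro k a b
    simp only [jetDeriv_change_frame hφ hx h h' φ.open_source hU' hx hx',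
      jjDeriv_change_frame hφ h h' hU' hx hx', jjDeriv₂_change_frame hφ h h' hU' hx hx',
      H.val, H.base, H.deriv, H.deriv₂, ← Finset.sum_sub_distrib]
    simp only [Finset.mul_sum]
    rw [Finset.sum_comm (s := (Finset.univ : Finset (Fin m))), ← Finset.sum_add_distrib]
    refine Finset.sum_congr rfl fun i _ ↦ ?_
    rw [pderiv_comm hφ hx a b (contMDiffAt_coeff_frame h h' φ.open_source hU' hx hx' k i)]
    have : ∑ c, chartChristoffel Γ φ b c a x *
          (h'.coeff k x (e i x) * jetDeriv φ h i c (Jet.proj _ _ x u) +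
            pderiv φ c (fun z ↦ h'.coeff k z (e i z)) x *
              h.coeff i x (Jet.proj F V x (Jet.proj _ _ x u)) -
          (h'.coeff k x (e i x) * jjDeriv φ h i c u +
            pderiv φ c (fun z ↦ h'.coeff k z (e i z)) x *
              h.coeff i x (Jet.proj F V x (Jet.proj _ _ x u)))) =
        h'.coeff k x (e i x) * ∑ c, chartChristoffel Γ φ b c a x *
          (jetDeriv φ h i c (Jet.proj _ _ x u) - jjDeriv φ h i c u) := by
      rw [Finset.mul_sum]
      exact Finset.sum_congr rfl fun c _ ↦ by ring
    rw [this]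
    ring

/-- This is where the correction by `Γ` is needed. The second derivatives of the chart transition
multiply the base coordinates of a point of `J J E`; for `w` these are the derivative coordinates of
`u`. The resulting mismatch, a multiple of the difference of the two, is exactly the inhomogeneous
term in `christoffel_change`. -/
theorem IsExchanged.change_chart (hφ : φ ∈ IsManifold.maximalAtlas (𝓡 m) ∞ M)
    (hψ : ψ ∈ IsManifold.maximalAtlas (𝓡 m) ∞ M) (hxφ : x ∈ φ.source) (hx : x ∈ ψ.source)
    (h : IsLocalFrameOn (𝓡 m) F ∞ e φ.source) {h' : IsLocalFrameOn (𝓡 m) F ∞ f ψ.source}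
    (H : IsExchanged Γ φ h' u w) : IsExchanged Γ ψ h' u w := by
  refine .mk ?_ ?_ ?_ ?_
  · exact H.val
  · intro k a
    rw [jetDeriv_change_chart hφ hψ hxφ hx h' ψ.open_source hx,
      jjDeriv_change_chart hφ hψ hxφ h' hx]
    simp only [H.base]
  · intro k a
    rw [jetDeriv_change_chart hφ hψ hxφ hx h' ψ.open_source hx,
      jjDeriv_change_chart hφ hψ hxφ h' hx]
    simp only [H.deriv]
  · intro k a b
    simp only [jetDeriv_change_chart hφ hψ hxφ hx h' ψ.open_source hx,
      jjDeriv_change_chart hφ hψ hxφ h' hx, jjDeriv₂_change_chart hφ hψ hxφ h h' hx,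
      H.base, H.deriv₂, ← Finset.sum_sub_distrib, ← mul_sub]
    set p := fun c ↦ jetDeriv φ h' k c (Jet.proj _ _ x u)
    set q := fun c ↦ jjDeriv φ h' k c u
    -- The transformation law of `Γ`, contracted with the difference of base and derivative
    -- coordinates.
    have hΓ : ∑ e, chartChristoffel Γ ψ b e a x * ∑ c, pderiv ψ e (fun z ↦ φ z c) x * (p c - q c) =
        ∑ f, (∑ c, (pderiv ψ a (fun z ↦ φ z c) x *
        ∑ d, pderiv ψ b (fun z ↦ φ z d) x * chartChristoffel Γ φ d f c x) -
      pderiv ψ b (pderiv ψ a (fun z ↦ φ z f)) x) * (p f - q f) := by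
      simp only [Finset.mul_sum]
      rw [Finset.sum_comm]
      refine Finset.sum_congr rfl fun f _ ↦ ?_
      simp only [← Finset.mul_sum]
      rw [← christoffel_change Γ hφ hψ hxφ hx, Finset.sum_mul]
      exact Finset.sum_congr rfl fun e _ ↦ by ring
    rw [hΓ]
    have hsym : ∀ c, pderiv ψ a (pderiv ψ b fun z ↦ φ z c) x =
        pderiv ψ b (pderiv ψ a fun z ↦ φ z c) x := fun c ↦
      pderiv_comm hψ hx a b (contMDiffAt_coord hφ hxφ c)
    simp only [hsym, sub_mul, Finset.sum_sub_distrib, Finset.sum_add_distrib, mul_add]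
    have h1 : ∑ c, pderiv ψ a (fun z ↦ φ z c) x *
          ∑ d, pderiv ψ b (fun z ↦ φ z d) x * jjDeriv₂ φ h' k d c u =
        ∑ c, pderiv ψ b (fun z ↦ φ z c) x *
          ∑ d, pderiv ψ a (fun z ↦ φ z d) x * jjDeriv₂ φ h' k c d u := by
      simp only [Finset.mul_sum]
      rw [Finset.sum_comm]
      exact Finset.sum_congr rfl fun f _ ↦ Finset.sum_congr rfl fun e _ ↦ by ring
    have h2 : ∑ c, pderiv ψ a (fun z ↦ φ z c) x * ∑ d, pderiv ψ b (fun z ↦ φ z d) x *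
          ∑ f, chartChristoffel Γ φ d f c x * (p f - q f) =
        ∑ f, (∑ c, pderiv ψ a (fun z ↦ φ z c) x *
          ∑ d, pderiv ψ b (fun z ↦ φ z d) x * chartChristoffel Γ φ d f c x) * (p f - q f) := by
      simp only [Finset.mul_sum, Finset.sum_mul]
      rw [Finset.sum_comm_cycle]
      exact Finset.sum_congr rfl fun f _ ↦ Finset.sum_congr rfl fun e _ ↦
        Finset.sum_congr rfl fun c _ ↦ by ring
    change ∑ c, pderiv ψ b (pderiv ψ a fun z ↦ φ z c) x * q c + _ =
      ∑ c, pderiv ψ b (pderiv ψ a fun z ↦ φ z c) x * p c + _ + _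
    rw [h1, h2]
    simp only [mul_sub, Finset.sum_sub_distrib]
    ring

/-- The four families of coordinates on `J J E` are the first-jet coordinates of the bundle `J E` in
its induced frame. -/
theorem jetJet_ext (hφ : φ ∈ IsManifold.maximalAtlas (𝓡 m) ∞ M)
    (h : IsLocalFrameOn (𝓡 m) F ∞ e φ.source) (hx : x ∈ φ.source)
    (h0 : ∀ i, h.coeff i x (Jet.proj F V x (Jet.proj _ _ x u)) =
      h.coeff i x (Jet.proj F V x (Jet.proj _ _ x w)))
    (h1 : ∀ i a, jetDeriv φ h i a (Jet.proj _ _ x u) = jetDeriv φ h i a (Jet.proj _ _ x w))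
    (h2 : ∀ i a, jjDeriv φ h i a u = jjDeriv φ h i a w)
    (h3 : ∀ i a b, jjDeriv₂ φ h i a b u = jjDeriv₂ φ h i a b w) : u = w := by
  refine jet_ext hφ hx (isLocalFrameOn_jetFrame hφ h) φ.open_source hx ?_ ?_
  · rintro (i | ⟨i, a⟩)
    · rw [jetFrame_coeff_inl _ _ hx, jetFrame_coeff_inl _ _ hx, h0]
    · rw [jetFrame_coeff_inr _ _ hx, jetFrame_coeff_inr _ _ hx, h1]
  · rintro (i | ⟨i, a⟩) b
    · have := h2 i b
      have key : ∀ u : JetJet m F V x, jetDeriv φ (isLocalFrameOn_jetFrame hφ h) (Sum.inl i) b u =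
          jjDeriv φ h i b u := fun u ↦ pderiv_congr hx (by
        filter_upwards [φ.open_source.mem_nhds hx] with z hz using jetFrame_coeff_inl hφ h hz i _)
      rw [key, key, this]
    · have := h3 i a b
      have key : ∀ u : JetJet m F V x, jetDeriv φ (isLocalFrameOn_jetFrame hφ h) (Sum.inr (i, a)) b u =
          jjDeriv₂ φ h i a b u := fun u ↦ pderiv_congr hx (by
        filter_upwards [φ.open_source.mem_nhds hx] with z hz using jetFrame_coeff_inr hφ h hz i a _)
      rw [key, key, this]

end SecondJets

/-! ### Smoothness of the Christoffel symbols -/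

section ChristoffelSmooth

variable {m : ℕ} {M : Type*} [TopologicalSpace M]
  [ChartedSpace (EuclideanSpace ℝ (Fin m)) M] [IsManifold (𝓡 m) ∞ M]
  {φ : OpenPartialHomeomorph M (EuclideanSpace ℝ (Fin m))} {x : M}

instance : ContMDiffVectorBundle ∞ (EuclideanSpace ℝ (Fin m)) (TangentSpace (𝓡 m) : M → Type _)
    (𝓡 m) :=
  -- For a tangent bundle of class `∞` the manifold has to be of class `∞ + 1`, which is `∞`.
  haveI : IsManifold (𝓡 m) (∞ + 1) M := inferInstanceAs (IsManifold (𝓡 m) ∞ M)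
  inferInstance

theorem isLocalFrameOn_chartField (hφ : φ ∈ IsManifold.maximalAtlas (𝓡 m) ∞ M) :
    IsLocalFrameOn (𝓡 m) (EuclideanSpace ℝ (Fin m)) ∞ (chartField φ) φ.source := by
  have hb : ∀ {x} (hx : x ∈ φ.source), (chartField φ · x) =
      (EuclideanSpace.basisFun (Fin m) ℝ).toBasis.map
        (LinearEquiv.ofBijective (dchart φ x : _ →ₗ[ℝ] EuclideanSpace ℝ (Fin m))
          ((mdifferentiable_chart hφ).mfderiv hx).bijective).symm := by
    intro x hx
    funext a
    rw [Module.Basis.map_apply, LinearEquiv.eq_symm_apply]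
    simpa using! dchart_chartField hφ hx a
  refine ⟨fun {x} hx ↦ ?_, fun {x} hx ↦ ?_, fun a x hx ↦ ContMDiffAt.contMDiffWithinAt ?_⟩
  · rw [hb hx]
    exact Module.Basis.linearIndependent _
  · rw [hb hx]
    exact (Module.Basis.span_eq _).ge
  · refine ContMDiffAt.mpullback_vectorField_preimage (n := ∞) ?_
      (contMDiffAt_of_mem_maximalAtlas hφ hx) (isInvertible_mfderiv_chart hφ hx) (by simp)
    exact (contMDiff_vectorSpace_iff_contDiff (V := fun _ ↦ EuclideanSpace.single a (1 : ℝ))).2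
      (contDiff_const (n := ∞)) _

theorem chartField_coeff (hφ : φ ∈ IsManifold.maximalAtlas (𝓡 m) ∞ M) (hx : x ∈ φ.source)
    (w : TangentSpace (𝓡 m) x) (c : Fin m) :
    (isLocalFrameOn_chartField hφ).coeff c x w = dchart φ x w c := by
  conv_rhs => rw [eq_sum_coeff (isLocalFrameOn_chartField hφ) hx w]
  simp [map_sum, dchart_chartField hφ hx, Pi.single_apply]

/-- Smoothness of `Γ` is invoked for globally smooth fields, while `∂_b` is only local. It is
replaced by a global field with the same germ at `x`, and `Γ` depends only on germs. -/
theorem contMDiffAt_chartChristoffel [T2Space M]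
    (Γ : CovariantDerivative (𝓡 m) (EuclideanSpace ℝ (Fin m)) (TangentSpace (𝓡 m) : M → Type _))
    (hΓ : CovariantDerivative.ContMDiffCovariantDerivative Γ ∞)
    (hφ : φ ∈ IsManifold.maximalAtlas (𝓡 m) ∞ M) (hx : x ∈ φ.source) (a c b : Fin m) :
    ContMDiffAt (𝓡 m) 𝓘(ℝ) ∞ (chartChristoffel Γ φ a c b) x := by
  have hfr := isLocalFrameOn_chartField hφ
  obtain ⟨σ, hσ⟩ := exists_global_section φ.open_source hx (hfr.contMDiffOn b)
  have h1 : ContMDiffAt (𝓡 m) ((𝓡 m).prod 𝓘(ℝ, EuclideanSpace ℝ (Fin m) →L[ℝ]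
      EuclideanSpace ℝ (Fin m))) ∞ (fun z ↦ TotalSpace.mk' (EuclideanSpace ℝ (Fin m) →L[ℝ]
      EuclideanSpace ℝ (Fin m)) (E := fun z ↦ TangentSpace (𝓡 m) z →L[ℝ] TangentSpace (𝓡 m) z) z
        (Γ σ z)) x :=
    (hΓ.contMDiff.contMDiff (σ := σ) (by simpa using! σ.contMDiff.contMDiffOn)).contMDiffAt univ_mem
  have h2 := contMDiffAt_applySection h1 (hfr.contMDiffAt φ.open_source hx a)
  refine (contMDiffAt_coeff hfr φ.open_source hx h2 c).neg.congr_of_eventuallyEq ?_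
  filter_upwards [hσ.eventually_nhds, φ.open_source.mem_nhds hx] with z hz hz'
  change _ = -(hfr.coeff c z (Γ σ z (chartField φ a z)))
  rw [chartField_coeff hφ hz', chartChristoffel]
  have : Γ σ z = Γ (chartField φ b) z :=
    Γ.isCovariantDerivativeOnUniv.congr_of_eventuallyEq
      (σ.contMDiff.contMDiffAt.mdifferentiableAt (by simp)) (mdifferentiableAt_chartField hφ hz' b)
      univ_mem hz
  rw [this]

end ChristoffelSmooth

/-! ### Coordinates in fibred charts -/

section

variable {m n : ℕ} {M : Type*} [TopologicalSpace M] [T2Space M]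
  [ChartedSpace (EuclideanSpace ℝ (Fin m)) M] [IsManifold (𝓡 m) ∞ M]
  {F : Type*} [NormedAddCommGroup F] [NormedSpace ℝ F] [FiniteDimensional ℝ F]
  {V : M → Type*} [∀ x, AddCommGroup (V x)] [∀ x, Module ℝ (V x)] [∀ x, TopologicalSpace (V x)]
  [TopologicalSpace (TotalSpace F V)] [FiberBundle F V] [VectorBundle ℝ F V]
  [ContMDiffVectorBundle ∞ F V (𝓡 m)]

namespace FibredChart

open Matrix

variable (χ : FibredChart m n F V) {x : M}

/-- The frame of `J E` induced by a fibred chart. -/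
theorem isLocalFrame_jet : IsLocalFrameOn (𝓡 m) (JetModel (EuclideanSpace ℝ (Fin m)) F) ∞
    (jetFrame χ.chart_mem χ.isLocalFrame) χ.chart.source :=
  isLocalFrameOn_jetFrame χ.chart_mem χ.isLocalFrame

variable {χ}

theorem jetDeriv_inl (hx : x ∈ χ.chart.source) (i : Fin n) (a : Fin m) (u : JetJet m F V x) :
    jetDeriv χ.chart χ.isLocalFrame_jet (Sum.inl i) a u = χ.yy₁ i a u :=
  pderiv_congr hx (by
    filter_upwards [χ.chart.open_source.mem_nhds hx] with z hz
      using jetFrame_coeff_inl χ.chart_mem χ.isLocalFrame hz i _)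

theorem jetDeriv_inr (hx : x ∈ χ.chart.source) (i : Fin n) (a b : Fin m) (u : JetJet m F V x) :
    jetDeriv χ.chart χ.isLocalFrame_jet (Sum.inr (i, a)) b u = χ.yy₂ i a b u :=
  pderiv_congr hx (by
    filter_upwards [χ.chart.open_source.mem_nhds hx] with z hz
      using jetFrame_coeff_inr χ.chart_mem χ.isLocalFrame hz i a _)

theorem exists_jetJet (hx : x ∈ χ.chart.source) (c₀ : Fin n → ℝ) (c₁ d₀ : Fin n → Fin m → ℝ)
    (d₁ : Fin n → Fin m → Fin m → ℝ) : ∃ u : JetJet m F V x, (∀ i, χ.yy i u = c₀ i) ∧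
      (∀ i a, χ.yyBase i a u = c₁ i a) ∧ (∀ i a, χ.yy₁ i a u = d₀ i a) ∧
      ∀ i a b, χ.yy₂ i a b u = d₁ i a b := by
  obtain ⟨σ, -, h0, h1⟩ := exists_section_affine χ.chart_mem hx χ.isLocalFrame_jet
    (Sum.elim c₀ fun p ↦ c₁ p.1 p.2) (Sum.elim d₀ fun p ↦ d₁ p.1 p.2)
  refine ⟨jet _ x σ, fun i ↦ ?_, fun i a ↦ ?_, fun i a ↦ ?_, fun i a b ↦ ?_⟩
  · have := h0 (Sum.inl i)
    rw [jetFrame_coeff_inl _ _ hx] at this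
    rw [yy, rep_apply]
    exact this
  · have := h0 (Sum.inr (i, a))
    rw [jetFrame_coeff_inr _ _ hx] at this
    rw [yyBase, rep_apply]
    exact this
  · rw [← jetDeriv_inl hx]
    exact h1 (Sum.inl i) a
  · rw [← jetDeriv_inr hx]
    exact h1 (Sum.inr (i, a)) b

theorem jetJet_ext (hx : x ∈ χ.chart.source) {u w : JetJet m F V x}
    (h0 : ∀ i, χ.yy i u = χ.yy i w) (h1 : ∀ i a, χ.yyBase i a u = χ.yyBase i a w)
    (h2 : ∀ i a, χ.yy₁ i a u = χ.yy₁ i a w) (h3 : ∀ i a b, χ.yy₂ i a b u = χ.yy₂ i a b w) :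
    u = w := by
  simp only [yy, yyBase, rep_apply] at h0 h1
  exact JetConnection.jetJet_ext χ.chart_mem χ.isLocalFrame hx h0 h1 h2 h3

theorem ext_jet (hx : x ∈ χ.chart.source) {u w : Jet (EuclideanSpace ℝ (Fin m)) F V x}
    (h0 : ∀ i, χ.y i x (Jet.proj F V x u) = χ.y i x (Jet.proj F V x w))
    (h1 : ∀ i a, χ.y₁ i a u = χ.y₁ i a w) : u = w :=
  jet_ext χ.chart_mem hx χ.isLocalFrame χ.chart.open_source hx h0 h1

end FibredChart

/-! ### The exchange map -/

theorem isExchanged_iff {Γ : CovariantDerivative (𝓡 m) (EuclideanSpace ℝ (Fin m))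
      (TangentSpace (𝓡 m) : M → Type _)} {χ : FibredChart m n F V} {x : M} {u w : JetJet m F V x} :
    IsExchanged Γ χ.chart χ.isLocalFrame u w ↔ ∀ i, χ.yy i w = χ.yy i u ∧
      (∀ a, χ.yyBase i a w = χ.yy₁ i a u) ∧ (∀ a, χ.yy₁ i a w = χ.yyBase i a u) ∧
      ∀ a b, χ.yy₂ i a b w = χ.yy₂ i b a u +
        ∑ c, χ.christoffel Γ b c a x * (χ.yyBase i c u - χ.yy₁ i c u) := by
  simp only [FibredChart.yy, FibredChart.yyBase, rep_apply]
  exact ⟨fun H i ↦ ⟨H.val i, H.base i, H.deriv i, H.deriv₂ i⟩,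
    fun H ↦ .mk (fun i ↦ (H i).1) (fun i ↦ (H i).2.1) (fun i ↦ (H i).2.2.1) fun i ↦ (H i).2.2.2⟩

/-- The involution `s_Γ` exists. -/
theorem exists_isExchange (hcov : ∀ x : M, ∃ χ : FibredChart m n F V, x ∈ χ.chart.source)
    (Γ : CovariantDerivative (𝓡 m) (EuclideanSpace ℝ (Fin m))
      (TangentSpace (𝓡 m) : M → Type _)) :
    ∃ s : ∀ x : M, JetJet m F V x → JetJet m F V x, IsExchange n Γ s := by
  choose χ hχ using hcov
  have hex : ∀ x (u : JetJet m F V x), ∃ w,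
      IsExchanged Γ (χ x).chart (χ x).isLocalFrame u w := by
    intro x u
    obtain ⟨w, h0, h1, h2, h3⟩ := FibredChart.exists_jetJet (hχ x) (fun i ↦ (χ x).yy i u)
      (fun i a ↦ (χ x).yy₁ i a u) (fun i a ↦ (χ x).yyBase i a u)
      (fun i a b ↦ (χ x).yy₂ i b a u + ∑ c, (χ x).christoffel Γ b c a x *
        ((χ x).yyBase i c u - (χ x).yy₁ i c u))
    exact ⟨w, isExchanged_iff.2 fun i ↦ ⟨h0 i, h1 i, h2 i, h3 i⟩⟩
  choose s hs using hex
  refine ⟨s, fun χ' x hx u ↦ isExchanged_iff.1 ?_⟩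
  -- The value at `x` is fixed in one chart. First the frame is changed with the chart kept, then
  -- the chart with the new frame kept.
  exact ((hs x u).change_frame (χ x).chart_mem χ'.isLocalFrame χ'.chart.open_source (hχ x)
    hx).change_chart (χ x).chart_mem χ'.chart_mem (hχ x) hx (χ x).isLocalFrame

end

/-! ### Shortcut instances for `J E ⊗ E*` -/

section ShortcutInstances

variable {EB : Type*} [NormedAddCommGroup EB] [NormedSpace ℝ EB]
  {M : Type*} [TopologicalSpace M] [T2Space M] [FiniteDimensional ℝ EB]
  [ChartedSpace EB M] [IsManifold 𝓘(ℝ, EB) ∞ M]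
  {F : Type*} [NormedAddCommGroup F] [NormedSpace ℝ F]
  {V : M → Type*} [∀ x, AddCommGroup (V x)] [∀ x, Module ℝ (V x)] [∀ x, TopologicalSpace (V x)]
  [TopologicalSpace (TotalSpace F V)] [FiberBundle F V] [VectorBundle ℝ F V]
  [ContMDiffVectorBundle ∞ F V 𝓘(ℝ, EB)]

abbrev jetEndModelNormedAddCommGroup : NormedAddCommGroup (F →L[ℝ] F × (EB →L[ℝ] F)) :=
  ContinuousLinearMap.toNormedAddCommGroup

abbrev jetEndModelNormedSpace : NormedSpace ℝ (F →L[ℝ] F × (EB →L[ℝ] F)) :=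
  ContinuousLinearMap.toNormedSpace

theorem jetEndModelFiniteDimensional [FiniteDimensional ℝ F] :
    FiniteDimensional ℝ (F →L[ℝ] F × (EB →L[ℝ] F)) :=
  inferInstance

abbrev jetEndTopologicalSpace (x : M) : TopologicalSpace (V x →L[ℝ] Jet EB F V x) :=
  ContinuousLinearMap.topologicalSpace

abbrev jetEndAddCommGroup (x : M) : AddCommGroup (V x →L[ℝ] Jet EB F V x) :=
  ContinuousLinearMap.addCommGroup

abbrev jetEndModule (x : M) : Module ℝ (V x →L[ℝ] Jet EB F V x) :=
  ContinuousLinearMap.module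

abbrev jetEndTotalSpaceTopology : TopologicalSpace
    (TotalSpace (F →L[ℝ] F × (EB →L[ℝ] F)) (fun x : M ↦ V x →L[ℝ] Jet EB F V x)) :=
  Bundle.ContinuousLinearMap.topologicalSpaceTotalSpace _ _ _ _ _

abbrev jetEndFiberBundle :
    FiberBundle (F →L[ℝ] F × (EB →L[ℝ] F)) (fun x : M ↦ V x →L[ℝ] Jet EB F V x) :=
  Bundle.ContinuousLinearMap.fiberBundle _ _ _ _ _

theorem jetEndVectorBundle : VectorBundle ℝ (F →L[ℝ] F × (EB →L[ℝ] F))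
    (fun x : M ↦ V x →L[ℝ] Jet EB F V x) :=
  Bundle.ContinuousLinearMap.vectorBundle _ _ _ _ _

theorem jetEndContMDiffVectorBundle : ContMDiffVectorBundle ∞ (F →L[ℝ] F × (EB →L[ℝ] F))
    (fun x : M ↦ V x →L[ℝ] Jet EB F V x) 𝓘(ℝ, EB) :=
  ContMDiffVectorBundle.continuousLinearMap

abbrev tangentTotalSpaceTopology :
    TopologicalSpace (TotalSpace EB (TangentSpace 𝓘(ℝ, EB) : M → Type _)) :=
  inferInstanceAs (TopologicalSpace (TangentBundle 𝓘(ℝ, EB) M))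

end ShortcutInstances

attribute [local instance] jetEndModelNormedAddCommGroup jetEndModelNormedSpace
  jetEndModelFiniteDimensional
  jetEndTopologicalSpace jetEndAddCommGroup jetEndModule jetEndTotalSpaceTopology
  jetEndFiberBundle jetEndVectorBundle jetEndContMDiffVectorBundle tangentTotalSpaceTopology

/-! ### Coordinates in matrix form, the product rule for `α(s)`, and the coordinate expression of
`κ'` -/

section

variable {m n : ℕ} {M : Type*} [TopologicalSpace M] [T2Space M]
  [ChartedSpace (EuclideanSpace ℝ (Fin m)) M] [IsManifold (𝓡 m) ∞ M]
  {F : Type*} [NormedAddCommGroup F] [NormedSpace ℝ F] [FiniteDimensional ℝ F]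
  {V : M → Type*} [∀ x, AddCommGroup (V x)] [∀ x, Module ℝ (V x)] [∀ x, TopologicalSpace (V x)]
  [TopologicalSpace (TotalSpace F V)] [FiberBundle F V] [VectorBundle ℝ F V]
  [ContMDiffVectorBundle ∞ F V (𝓡 m)]

theorem contMDiffAt_mulVec {B : M → Matrix (Fin n) (Fin n) ℝ} {w : M → Fin n → ℝ} {x : M}
    (hB : ∀ i j, ContMDiffAt (𝓡 m) 𝓘(ℝ) ∞ (fun z ↦ B z i j) x)
    (hw : ∀ j, ContMDiffAt (𝓡 m) 𝓘(ℝ) ∞ (fun z ↦ w z j) x) (i : Fin n) :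
    ContMDiffAt (𝓡 m) 𝓘(ℝ) ∞ (fun z ↦ (B z).mulVec (w z) i) x := by
  simp only [Matrix.mulVec, dotProduct]
  exact ContMDiffAt.sum fun j _ ↦ (hB i j).mul (hw j)

open Matrix in
theorem pderiv_mulVec {φ : OpenPartialHomeomorph M (EuclideanSpace ℝ (Fin m))}
    (hφ : φ ∈ IsManifold.maximalAtlas (𝓡 m) ∞ M) {x : M} (hx : x ∈ φ.source) (a : Fin m)
    {B : M → Matrix (Fin n) (Fin n) ℝ} {w : M → Fin n → ℝ}
    (hB : ∀ i j, ContMDiffAt (𝓡 m) 𝓘(ℝ) ∞ (fun z ↦ B z i j) x)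
    (hw : ∀ j, ContMDiffAt (𝓡 m) 𝓘(ℝ) ∞ (fun z ↦ w z j) x) (i : Fin n) :
    pderiv φ a (fun z ↦ (B z *ᵥ w z) i) x =
      ((Matrix.of fun i j ↦ pderiv φ a (fun z ↦ B z i j) x) *ᵥ w x +
        B x *ᵥ fun j ↦ pderiv φ a (fun z ↦ w z j) x) i := by
  simp only [Matrix.mulVec, dotProduct, Pi.add_apply, Matrix.of_apply]
  rw [pderiv_sum _ hφ hx a (f := fun j z ↦ B z i j * w z j) fun j ↦ (hB i j).mul (hw j),
    ← Finset.sum_add_distrib]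
  exact Finset.sum_congr rfl fun j _ ↦ pderiv_mul hφ hx a (hB i j) (hw j)

namespace FibredChart

open Matrix

variable (χ : FibredChart m n F V) {x : M}

/-- The components `yⁱ` of a vector. -/
def yVec {x : M} (v : V x) : Fin n → ℝ := fun i ↦ χ.y i x v

/-- The components `yⁱₐ` of a jet. -/
def y₁Vec (a : Fin m) {x : M} (u : Jet (EuclideanSpace ℝ (Fin m)) F V x) : Fin n → ℝ :=
  fun i ↦ χ.y₁ i a u

/-- The frame of `J E ⊗ E*` induced by a fibred chart. -/
theorem isLocalFrame_end : IsLocalFrameOn (𝓡 m) (JetEndModel (EuclideanSpace ℝ (Fin m)) F) ∞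
    (homFrame (V₂ := Jet (EuclideanSpace ℝ (Fin m)) F V) χ.isLocalFrame
      (jetFrame χ.chart_mem χ.isLocalFrame)) χ.chart.source :=
  isLocalFrameOn_homFrame χ.isLocalFrame χ.isLocalFrame_jet χ.chart.open_source

variable {χ}

theorem yVec_injective (hx : x ∈ χ.chart.source) : Function.Injective (χ.yVec (x := x)) :=
  fun _ _ h ↦ eq_of_coeff χ.isLocalFrame hx (congrFun h)

theorem yVec_add (v w : V x) : χ.yVec (v + w) = χ.yVec v + χ.yVec w :=
  funext fun i ↦ map_add (χ.y i x) v w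

theorem yVec_smul (c : ℝ) (v : V x) : χ.yVec (c • v) = c • χ.yVec v :=
  funext fun i ↦ map_smul (χ.y i x) c v

theorem yVec_frame (hx : x ∈ χ.chart.source) (j : Fin n) : χ.yVec (χ.frame j x) = Pi.single j 1 := by
  ext i
  rw [yVec, y, coeff_frame χ.isLocalFrame hx, Pi.single_apply]
  simp [eq_comm]

theorem y₁Vec_add (hx : x ∈ χ.chart.source) (a : Fin m)
    (u w : Jet (EuclideanSpace ℝ (Fin m)) F V x) :
    χ.y₁Vec a (u + w) = χ.y₁Vec a u + χ.y₁Vec a w :=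
  funext fun i ↦ jetDeriv_add χ.chart_mem hx χ.isLocalFrame χ.chart.open_source hx u w i a

theorem y₁Vec_smul (hx : x ∈ χ.chart.source) (a : Fin m) (c : ℝ)
    (u : Jet (EuclideanSpace ℝ (Fin m)) F V x) : χ.y₁Vec a (c • u) = c • χ.y₁Vec a u :=
  funext fun i ↦ jetDeriv_smul χ.chart_mem hx χ.isLocalFrame χ.chart.open_source hx c u i a

theorem ext_jet_vec (hx : x ∈ χ.chart.source) {u w : Jet (EuclideanSpace ℝ (Fin m)) F V x}
    (h0 : χ.yVec (Jet.proj F V x u) = χ.yVec (Jet.proj F V x w))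
    (h1 : ∀ a, χ.y₁Vec a u = χ.y₁Vec a w) : u = w :=
  ext_jet hx (congrFun h0) fun i a ↦ congrFun (h1 a) i

theorem c₀_apply (hx : x ∈ χ.chart.source) (A : JetEnd (EuclideanSpace ℝ (Fin m)) F V x) (v : V x) :
    χ.yVec (Jet.proj F V x (A v)) = χ.c₀ A *ᵥ χ.yVec v := by
  ext i
  conv_lhs => rw [eq_sum_coeff χ.isLocalFrame hx v]
  simp only [map_sum, map_smul, yVec, mulVec, dotProduct, c₀, Matrix.of_apply,
    smul_eq_mul]
  exact Finset.sum_congr rfl fun j _ ↦ mul_comm _ _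

theorem c₁_apply (hx : x ∈ χ.chart.source) (a : Fin m)
    (A : JetEnd (EuclideanSpace ℝ (Fin m)) F V x) (v : V x) :
    χ.y₁Vec a (A v) = χ.c₁ a A *ᵥ χ.yVec v := by
  ext i
  have h : ∀ u : Jet (EuclideanSpace ℝ (Fin m)) F V x,
      χ.y₁ i a u = χ.isLocalFrame_jet.coeff (Sum.inr (i, a)) x u := fun u ↦
    (jetFrame_coeff_inr χ.chart_mem χ.isLocalFrame hx i a u).symm
  conv_lhs => rw [eq_sum_coeff χ.isLocalFrame hx v]
  simp only [y₁Vec, h, map_sum, map_smul, mulVec, dotProduct, c₁, Matrix.of_apply,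
    smul_eq_mul]
  exact Finset.sum_congr rfl fun j _ ↦ mul_comm _ _

theorem c₀_eq_one (hx : x ∈ χ.chart.source) {A : JetEnd (EuclideanSpace ℝ (Fin m)) F V x} :
    χ.c₀ A = 1 ↔ A ∈ connFiber (EuclideanSpace ℝ (Fin m)) F V x := by
  constructor
  · intro h v
    apply yVec_injective hx
    rw [c₀_apply hx, h, one_mulVec]
  · intro h
    ext i j
    rw [c₀, Matrix.of_apply, h]
    have := congrFun (yVec_frame hx j) i
    rw [yVec] at this
    rw [this, Pi.single_apply, Matrix.one_apply]

theorem ext_end (hx : x ∈ χ.chart.source) {A B : JetEnd (EuclideanSpace ℝ (Fin m)) F V x}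
    (h0 : χ.c₀ A = χ.c₀ B) (h1 : ∀ a, χ.c₁ a A = χ.c₁ a B) : A = B := by
  ext v
  refine ext_jet_vec hx ?_ fun a ↦ ?_
  · rw [c₀_apply hx, c₀_apply hx, h0]
  · rw [c₁_apply hx, c₁_apply hx, h1]

theorem yy₁_jet (hx : x ∈ χ.chart.source) (i : Fin n) (a : Fin m)
    (σ : Cₛ^∞⟮𝓡 m; JetModel (EuclideanSpace ℝ (Fin m)) F, Jet (EuclideanSpace ℝ (Fin m)) F V⟯) :
    χ.yy₁ i a (jet _ x σ) = pderiv χ.chart a (fun z ↦ χ.y i z (Jet.proj F V z (σ z))) x := by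
  rw [← jetDeriv_inl hx,
    jetDeriv_jet χ.chart_mem hx χ.isLocalFrame_jet χ.chart.open_source hx]
  refine pderiv_congr hx ?_
  filter_upwards [χ.chart.open_source.mem_nhds hx] with z hz
    using jetFrame_coeff_inl χ.chart_mem χ.isLocalFrame hz i _

theorem yy₂_jet (hx : x ∈ χ.chart.source) (i : Fin n) (a b : Fin m)
    (σ : Cₛ^∞⟮𝓡 m; JetModel (EuclideanSpace ℝ (Fin m)) F, Jet (EuclideanSpace ℝ (Fin m)) F V⟯) :
    χ.yy₂ i a b (jet _ x σ) = pderiv χ.chart b (fun z ↦ χ.y₁ i a (σ z)) x := by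
  rw [← jetDeriv_inr hx,
    jetDeriv_jet χ.chart_mem hx χ.isLocalFrame_jet χ.chart.open_source hx]
  refine pderiv_congr hx ?_
  filter_upwards [χ.chart.open_source.mem_nhds hx] with z hz
    using jetFrame_coeff_inr χ.chart_mem χ.isLocalFrame hz i a _

theorem y₁Vec_jet (hx : x ∈ χ.chart.source) (a : Fin m) (s : Cₛ^∞⟮𝓡 m; F, V⟯) :
    χ.y₁Vec a (jet F x s) = fun i ↦ pderiv χ.chart a (fun z ↦ χ.yVec (s z) i) x :=
  funext fun i ↦ jetDeriv_jet χ.chart_mem hx χ.isLocalFrame χ.chart.open_source hx s i a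

theorem end_coeff_inl (hx : x ∈ χ.chart.source) (i j : Fin n)
    (A : JetEnd (EuclideanSpace ℝ (Fin m)) F V x) :
    χ.isLocalFrame_end.coeff (Sum.inl i, j) x A = χ.c₀ A i j :=
  (homFrame_coeff χ.isLocalFrame χ.isLocalFrame_jet χ.chart.open_source hx _ j A).trans
    (jetFrame_coeff_inl χ.chart_mem χ.isLocalFrame hx i _)

theorem end_coeff_inr (hx : x ∈ χ.chart.source) (i j : Fin n) (a : Fin m)
    (A : JetEnd (EuclideanSpace ℝ (Fin m)) F V x) :
    χ.isLocalFrame_end.coeff (Sum.inr (i, a), j) x A = χ.c₁ a A i j :=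
  (homFrame_coeff χ.isLocalFrame χ.isLocalFrame_jet χ.chart.open_source hx _ j A).trans
    (jetFrame_coeff_inr χ.chart_mem χ.isLocalFrame hx i a _)

theorem jetDeriv_end_inl (hx : x ∈ χ.chart.source) (i j : Fin n) (a : Fin m)
    (u : Jet (EuclideanSpace ℝ (Fin m)) (JetEndModel (EuclideanSpace ℝ (Fin m)) F)
      (JetEnd (EuclideanSpace ℝ (Fin m)) F V) x) :
    jetDeriv χ.chart χ.isLocalFrame_end (Sum.inl i, j) a u = χ.dc₀ a u i j := by
  change pderiv χ.chart a (fun z ↦ χ.isLocalFrame_end.coeff (Sum.inl i, j) z (u.rep z)) x =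
    pderiv χ.chart a (fun z ↦ χ.c₀ (u.rep z) i j) x
  refine pderiv_congr hx ?_
  filter_upwards [χ.chart.open_source.mem_nhds hx] with z hz using end_coeff_inl hz i j _

theorem jetDeriv_end_inr (hx : x ∈ χ.chart.source) (i j : Fin n) (a b : Fin m)
    (u : Jet (EuclideanSpace ℝ (Fin m)) (JetEndModel (EuclideanSpace ℝ (Fin m)) F)
      (JetEnd (EuclideanSpace ℝ (Fin m)) F V) x) :
    jetDeriv χ.chart χ.isLocalFrame_end (Sum.inr (i, b), j) a u = χ.dc₁ a b u i j := by
  change pderiv χ.chart a (fun z ↦ χ.isLocalFrame_end.coeff (Sum.inr (i, b), j) z (u.rep z)) x =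
    pderiv χ.chart a (fun z ↦ χ.c₁ b (u.rep z) i j) x
  refine pderiv_congr hx ?_
  filter_upwards [χ.chart.open_source.mem_nhds hx] with z hz using end_coeff_inr hz i j b _

section

variable (α : Cₛ^∞⟮𝓡 m; JetEndModel (EuclideanSpace ℝ (Fin m)) F,
  JetEnd (EuclideanSpace ℝ (Fin m)) F V⟯) (s : Cₛ^∞⟮𝓡 m; F, V⟯)

theorem contMDiffAt_c₀ (hx : x ∈ χ.chart.source) (i j : Fin n) :
    ContMDiffAt (𝓡 m) 𝓘(ℝ) ∞ (fun z ↦ χ.c₀ (α z) i j) x := by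
  refine (contMDiffAt_coeff χ.isLocalFrame_end χ.chart.open_source hx α.contMDiff.contMDiffAt
    (Sum.inl i, j)).congr_of_eventuallyEq ?_
  filter_upwards [χ.chart.open_source.mem_nhds hx] with z hz using (end_coeff_inl hz i j _).symm

theorem contMDiffAt_c₁ (hx : x ∈ χ.chart.source) (a : Fin m) (i j : Fin n) :
    ContMDiffAt (𝓡 m) 𝓘(ℝ) ∞ (fun z ↦ χ.c₁ a (α z) i j) x := by
  refine (contMDiffAt_coeff χ.isLocalFrame_end χ.chart.open_source hx α.contMDiff.contMDiffAt
    (Sum.inr (i, a), j)).congr_of_eventuallyEq ?_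
  filter_upwards [χ.chart.open_source.mem_nhds hx] with z hz using (end_coeff_inr hz i j a _).symm

theorem contMDiffAt_yVec (hx : x ∈ χ.chart.source) (i : Fin n) :
    ContMDiffAt (𝓡 m) 𝓘(ℝ) ∞ (fun z ↦ χ.yVec (s z) i) x :=
  contMDiffAt_coeff χ.isLocalFrame χ.chart.open_source hx s.contMDiff.contMDiffAt i

theorem dc₀_jet (hx : x ∈ χ.chart.source) (a : Fin m) :
    χ.dc₀ a (jet _ x α) = Matrix.of fun i j ↦ pderiv χ.chart a (fun z ↦ χ.c₀ (α z) i j) x := by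
  ext i j
  rw [← jetDeriv_end_inl hx,
    jetDeriv_jet χ.chart_mem hx χ.isLocalFrame_end χ.chart.open_source hx, Matrix.of_apply]
  refine pderiv_congr hx ?_
  filter_upwards [χ.chart.open_source.mem_nhds hx] with z hz using end_coeff_inl hz i j _

theorem dc₁_jet (hx : x ∈ χ.chart.source) (a b : Fin m) :
    χ.dc₁ a b (jet _ x α) = Matrix.of fun i j ↦ pderiv χ.chart a (fun z ↦ χ.c₁ b (α z) i j) x := by
  ext i j
  rw [← jetDeriv_end_inr hx,
    jetDeriv_jet χ.chart_mem hx χ.isLocalFrame_end χ.chart.open_source hx, Matrix.of_apply]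
  refine pderiv_congr hx ?_
  filter_upwards [χ.chart.open_source.mem_nhds hx] with z hz using end_coeff_inr hz i j b _

/-- The product rule for the matrix-vector product that expresses the `y`-part of `α(s)` in
coordinates. -/
theorem yy₁_applySection (hx : x ∈ χ.chart.source) (a : Fin m) :
    (fun i ↦ χ.yy₁ i a (jet _ x (applySection α s))) =
      χ.dc₀ a (jet _ x α) *ᵥ χ.yVec (s x) + χ.c₀ (α x) *ᵥ χ.y₁Vec a (jet F x s) := by
  ext i
  rw [yy₁_jet hx, dc₀_jet α hx, y₁Vec_jet hx, ← pderiv_mulVec χ.chart_mem hx a (w := fun z ↦ χ.yVec (s z))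
    (contMDiffAt_c₀ α hx) (contMDiffAt_yVec s hx)]
  refine pderiv_congr hx ?_
  filter_upwards [χ.chart.open_source.mem_nhds hx] with z hz
    using congrFun (c₀_apply hz (α z) (s z)) i

/-- The product rule for `y_a(α s) = c₁ a α · y(s)`, differentiated along `x^b`. The index of
differentiation comes last in `yy₂ i a b` and first in `dc₁ b a`. -/
theorem yy₂_applySection (hx : x ∈ χ.chart.source) (a b : Fin m) :
    (fun i ↦ χ.yy₂ i a b (jet _ x (applySection α s))) =
      χ.dc₁ b a (jet _ x α) *ᵥ χ.yVec (s x) + χ.c₁ a (α x) *ᵥ χ.y₁Vec b (jet F x s) := by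
  ext i
  rw [yy₂_jet hx, dc₁_jet α hx, y₁Vec_jet hx, ← pderiv_mulVec χ.chart_mem hx b (w := fun z ↦ χ.yVec (s z))
    (contMDiffAt_c₁ α hx a) (contMDiffAt_yVec s hx)]
  refine pderiv_congr hx ?_
  filter_upwards [χ.chart.open_source.mem_nhds hx] with z hz
    using congrFun (c₁_apply hz a (α z) (s z)) i

end

variable (χ)

/-- The partial derivatives `∂_b κ_a`. -/
def dcomp (κ : LinearConnection (EuclideanSpace ℝ (Fin m)) F V) (a b : Fin m) (x : M) :
    Matrix (Fin n) (Fin n) ℝ :=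
  Matrix.of fun i j ↦ pderiv χ.chart b (fun z ↦ χ.comp κ a z i j) x

variable {χ}

theorem c₀_toSection (hx : x ∈ χ.chart.source)
    (κ : LinearConnection (EuclideanSpace ℝ (Fin m)) F V) : χ.c₀ (κ.toSection x) = 1 :=
  (c₀_eq_one hx).2 (κ.proj_apply x)

theorem dc₀_toSection (hx : x ∈ χ.chart.source) (a : Fin m)
    (κ : LinearConnection (EuclideanSpace ℝ (Fin m)) F V) :
    χ.dc₀ a (jet _ x κ.toSection) = 0 := by
  ext i j
  rw [dc₀_jet κ.toSection hx, Matrix.of_apply, pderiv_congr (g := fun _ ↦ (1 : Matrix _ _ ℝ) i j) hx,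
    pderiv_const, Matrix.zero_apply]
  filter_upwards [χ.chart.open_source.mem_nhds hx] with z hz
  rw [c₀_toSection hz]

theorem dc₁_toSection (hx : x ∈ χ.chart.source) (a b : Fin m)
    (κ : LinearConnection (EuclideanSpace ℝ (Fin m)) F V) :
    χ.dc₁ a b (jet _ x κ.toSection) = χ.dcomp κ b a x :=
  dc₁_jet κ.toSection hx a b

variable (χ) in
/-- `w = κ'(u)` in coordinates. -/
def IsProlonged (Γ : CovariantDerivative (𝓡 m) (EuclideanSpace ℝ (Fin m))
      (TangentSpace (𝓡 m) : M → Type _))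
    (κ : LinearConnection (EuclideanSpace ℝ (Fin m)) F V) {x : M}
    (u : Jet (EuclideanSpace ℝ (Fin m)) F V x) (w : JetJet m F V x) : Prop :=
  ((fun i ↦ χ.yy i w) = χ.yVec (Jet.proj F V x u)) ∧
  (∀ a, (fun i ↦ χ.yyBase i a w) = χ.y₁Vec a u) ∧
  (∀ a, (fun i ↦ χ.yy₁ i a w) = χ.comp κ a x *ᵥ χ.yVec (Jet.proj F V x u)) ∧
  (∀ a b, (fun i ↦ χ.yy₂ i a b w) = χ.dcomp κ b a x *ᵥ χ.yVec (Jet.proj F V x u) +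
      χ.comp κ b x *ᵥ χ.y₁Vec a u + ∑ c, χ.christoffel Γ b c a x •
        (χ.comp κ c x *ᵥ χ.yVec (Jet.proj F V x u) - χ.y₁Vec c u))

variable {Γ : CovariantDerivative (𝓡 m) (EuclideanSpace ℝ (Fin m))
    (TangentSpace (𝓡 m) : M → Type _)} {κ : LinearConnection (EuclideanSpace ℝ (Fin m)) F V}
  {u u' : Jet (EuclideanSpace ℝ (Fin m)) F V x} {w w' : JetJet m F V x}

theorem IsProlonged.mk (h0 : (fun i ↦ χ.yy i w) = χ.yVec (Jet.proj F V x u))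
    (h1 : ∀ a, (fun i ↦ χ.yyBase i a w) = χ.y₁Vec a u)
    (h2 : ∀ a, (fun i ↦ χ.yy₁ i a w) = χ.comp κ a x *ᵥ χ.yVec (Jet.proj F V x u))
    (h3 : ∀ a b, (fun i ↦ χ.yy₂ i a b w) = χ.dcomp κ b a x *ᵥ χ.yVec (Jet.proj F V x u) +
        χ.comp κ b x *ᵥ χ.y₁Vec a u + ∑ c, χ.christoffel Γ b c a x •
          (χ.comp κ c x *ᵥ χ.yVec (Jet.proj F V x u) - χ.y₁Vec c u)) :
    χ.IsProlonged Γ κ u w :=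
  ⟨h0, h1, h2, h3⟩

theorem IsProlonged.yy (H : χ.IsProlonged Γ κ u w) :
    (fun i ↦ χ.yy i w) = χ.yVec (Jet.proj F V x u) :=
  H.1

theorem IsProlonged.yyBase (H : χ.IsProlonged Γ κ u w) :
    ∀ a, (fun i ↦ χ.yyBase i a w) = χ.y₁Vec a u :=
  H.2.1

theorem IsProlonged.yy₁ (H : χ.IsProlonged Γ κ u w) :
    ∀ a, (fun i ↦ χ.yy₁ i a w) = χ.comp κ a x *ᵥ χ.yVec (Jet.proj F V x u) :=
  H.2.2.1

theorem IsProlonged.yy₂ (H : χ.IsProlonged Γ κ u w) :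
    ∀ a b, (fun i ↦ χ.yy₂ i a b w) = χ.dcomp κ b a x *ᵥ χ.yVec (Jet.proj F V x u) +
        χ.comp κ b x *ᵥ χ.y₁Vec a u + ∑ c, χ.christoffel Γ b c a x •
          (χ.comp κ c x *ᵥ χ.yVec (Jet.proj F V x u) - χ.y₁Vec c u) :=
  H.2.2.2

theorem IsProlonged.proj_eq (hx : x ∈ χ.chart.source) (h : χ.IsProlonged Γ κ u w) :
    Jet.proj _ _ x w = u := by
  refine ext_jet_vec hx ?_ fun a ↦ ?_
  · rw [← h.yy]
    simp only [FibredChart.yy, rep_apply]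
    rfl
  · rw [← h.yyBase]
    simp only [FibredChart.yyBase, rep_apply]
    rfl

/-- Since `κ` lies over the identity, its matrix `c₀` is constantly 1. Hence `j(κ ∘ φ)` has base
coordinates `κ_a φ` and first derivatives `∂_a φ`, which `s_Γ` interchanges; its second-order
coordinates are the derivatives of `κ_b φ`, taken along `x^a` after the swap of indices. -/
theorem isProlonged_of_isExchange (hx : x ∈ χ.chart.source)
    {s : ∀ x : M, JetJet m F V x → JetJet m F V x} (hs : IsExchange n Γ s)
    (φ : Cₛ^∞⟮𝓡 m; F, V⟯) :
    χ.IsProlonged Γ κ (jet F x φ) (s x (jet _ x (applySection κ.toSection φ))) := by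
  have H := hs χ x hx (jet _ x (applySection κ.toSection φ))
  have hκ : Jet.proj _ _ x (jet _ x (applySection κ.toSection φ)) = κ.toSection x (φ x) := rfl
  have hBase : ∀ a, (fun i ↦ χ.yyBase i a (jet _ x (applySection κ.toSection φ))) =
      χ.comp κ a x *ᵥ χ.yVec (φ x) := by
    intro a
    rw [comp, ← c₁_apply hx]
    simp only [FibredChart.yyBase, rep_apply]
    rfl
  have h1 : ∀ a, (fun i ↦ χ.yy₁ i a (jet _ x (applySection κ.toSection φ))) =
      χ.y₁Vec a (jet F x φ) := by
    intro a
    rw [yy₁_applySection κ.toSection φ hx, dc₀_toSection hx, c₀_toSection hx, zero_mulVec,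
      one_mulVec, zero_add]
  refine .mk ?_ (fun a ↦ ?_) (fun a ↦ ?_) fun a b ↦ ?_
  · ext i
    rw [(H i).1, FibredChart.yy, rep_apply, hκ, κ.proj_apply]
    rfl
  · rw [← h1]
    exact funext fun i ↦ (H i).2.1 a
  · rw [proj_jet, ← hBase]
    exact funext fun i ↦ (H i).2.2.1 a
  · rw [proj_jet]
    have h2 := yy₂_applySection κ.toSection φ hx b a
    rw [dc₁_toSection hx] at h2
    rw [show χ.comp κ b x = χ.c₁ b (κ.toSection x) from rfl, ← h2]
    simp only [← hBase, ← h1]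
    ext i
    rw [(H i).2.2.2]
    simp

theorem IsProlonged.unique (hx : x ∈ χ.chart.source) (h : χ.IsProlonged Γ κ u w)
    (h' : χ.IsProlonged Γ κ u w') : w = w' :=
  FibredChart.jetJet_ext hx (fun i ↦ congrFun (h.yy.trans h'.yy.symm) i)
    (fun i a ↦ congrFun ((h.yyBase a).trans (h'.yyBase a).symm) i)
    (fun i a ↦ congrFun ((h.yy₁ a).trans (h'.yy₁ a).symm) i)
    (fun i a b ↦ congrFun ((h.yy₂ a b).trans (h'.yy₂ a b).symm) i)

theorem yy_add (w w' : JetJet m F V x) : (fun i ↦ χ.yy i (w + w')) =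
    (fun i ↦ χ.yy i w) + fun i ↦ χ.yy i w' := by
  ext i
  simp [yy, rep_apply]

theorem yyBase_add (hx : x ∈ χ.chart.source) (a : Fin m) (w w' : JetJet m F V x) :
    (fun i ↦ χ.yyBase i a (w + w')) = (fun i ↦ χ.yyBase i a w) + fun i ↦ χ.yyBase i a w' := by
  simp only [yyBase, rep_apply, map_add]
  exact y₁Vec_add hx a _ _

theorem yy₁_add (hx : x ∈ χ.chart.source) (a : Fin m) (w w' : JetJet m F V x) :
    (fun i ↦ χ.yy₁ i a (w + w')) = (fun i ↦ χ.yy₁ i a w) + fun i ↦ χ.yy₁ i a w' := by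
  simp only [← jetDeriv_inl hx]
  exact funext fun i ↦ jetDeriv_add χ.chart_mem hx _ χ.chart.open_source hx _ _ _ _

theorem yy₂_add (hx : x ∈ χ.chart.source) (a b : Fin m) (w w' : JetJet m F V x) :
    (fun i ↦ χ.yy₂ i a b (w + w')) = (fun i ↦ χ.yy₂ i a b w) + fun i ↦ χ.yy₂ i a b w' := by
  simp only [← jetDeriv_inr hx]
  exact funext fun i ↦ jetDeriv_add χ.chart_mem hx _ χ.chart.open_source hx _ _ _ _

theorem yy_smul (c : ℝ) (w : JetJet m F V x) : (fun i ↦ χ.yy i (c • w)) =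
    c • fun i ↦ χ.yy i w := by
  ext i
  simp [yy, rep_apply]

theorem yyBase_smul (hx : x ∈ χ.chart.source) (a : Fin m) (c : ℝ) (w : JetJet m F V x) :
    (fun i ↦ χ.yyBase i a (c • w)) = c • fun i ↦ χ.yyBase i a w := by
  simp only [yyBase, rep_apply, map_smul]
  exact y₁Vec_smul hx a _ _

theorem yy₁_smul (hx : x ∈ χ.chart.source) (a : Fin m) (c : ℝ) (w : JetJet m F V x) :
    (fun i ↦ χ.yy₁ i a (c • w)) = c • fun i ↦ χ.yy₁ i a w := by
  simp only [← jetDeriv_inl hx]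
  exact funext fun i ↦ jetDeriv_smul χ.chart_mem hx _ χ.chart.open_source hx _ _ _ _

theorem yy₂_smul (hx : x ∈ χ.chart.source) (a b : Fin m) (c : ℝ) (w : JetJet m F V x) :
    (fun i ↦ χ.yy₂ i a b (c • w)) = c • fun i ↦ χ.yy₂ i a b w := by
  simp only [← jetDeriv_inr hx]
  exact funext fun i ↦ jetDeriv_smul χ.chart_mem hx _ χ.chart.open_source hx _ _ _ _

/-- The equations are linear in the pair `(u, w)`. Together with `IsProlonged.unique` this makes
`κ'` additive. -/
theorem IsProlonged.add (hx : x ∈ χ.chart.source) (h : χ.IsProlonged Γ κ u w)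
    (h' : χ.IsProlonged Γ κ u' w') : χ.IsProlonged Γ κ (u + u') (w + w') := by
  refine .mk ?_ ?_ ?_ ?_
  · rw [yy_add, h.yy, h'.yy, map_add, yVec_add]
  · intro a
    rw [yyBase_add hx, h.yyBase, h'.yyBase, y₁Vec_add hx]
  · intro a
    rw [yy₁_add hx, h.yy₁, h'.yy₁, map_add, yVec_add, mulVec_add]
  · intro a b
    rw [yy₂_add hx, h.yy₂, h'.yy₂, map_add, yVec_add]
    simp only [y₁Vec_add hx, mulVec_add, add_sub_add_comm, smul_add, Finset.sum_add_distrib]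
    abel

theorem IsProlonged.smul (hx : x ∈ χ.chart.source) (c : ℝ) (h : χ.IsProlonged Γ κ u w) :
    χ.IsProlonged Γ κ (c • u) (c • w) := by
  refine .mk ?_ ?_ ?_ ?_
  · rw [yy_smul, h.yy, map_smul, yVec_smul]
  · intro a
    rw [yyBase_smul hx, h.yyBase, y₁Vec_smul hx]
  · intro a
    rw [yy₁_smul hx, h.yy₁, map_smul, yVec_smul, mulVec_smul]
  · intro a b
    rw [yy₂_smul hx, h.yy₂, map_smul, yVec_smul]
    simp only [y₁Vec_smul hx, mulVec_smul, smul_add, Finset.smul_sum, ← smul_sub]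
    congr 1
    exact Finset.sum_congr rfl fun d _ ↦ smul_comm _ _ _

end FibredChart

/-! ### The prolonged connection -/

variable {Γ : CovariantDerivative (𝓡 m) (EuclideanSpace ℝ (Fin m))
    (TangentSpace (𝓡 m) : M → Type _)}

/-- A smooth family of linear sections of the jet projection is a linear connection. -/
theorem exists_linearConnection (L : ∀ x, V x →ₗ[ℝ] Jet (EuclideanSpace ℝ (Fin m)) F V x)
    (hL : ∀ x v, Jet.proj F V x (L x v) = v)
    (hs : ∀ (σ : Cₛ^∞⟮𝓡 m; F, V⟯) (x : M),
      ContMDiffAt (𝓡 m) ((𝓡 m).prod 𝓘(ℝ, JetModel (EuclideanSpace ℝ (Fin m)) F)) ∞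
      (fun z ↦ TotalSpace.mk' (JetModel (EuclideanSpace ℝ (Fin m)) F) z (L z (σ z))) x) :
    ∃ K : LinearConnection (EuclideanSpace ℝ (Fin m)) F V, ∀ x v, K.toSection x v = L x v :=
  ⟨⟨⟨fun x ↦ fibreCLM F (L x), fun x ↦ contMDiffAt_hom_of_apply fun σ ↦ hs σ x⟩, hL⟩,
    fun _ _ ↦ rfl⟩

theorem exists_prolonged (hcov : ∀ x : M, ∃ χ : FibredChart m n F V, x ∈ χ.chart.source)
    (hΓ : CovariantDerivative.ContMDiffCovariantDerivative Γ ∞)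
    (κ : LinearConnection (EuclideanSpace ℝ (Fin m)) F V)
    {s : ∀ x : M, JetJet m F V x → JetJet m F V x} (hs : IsExchange n Γ s) :
    ∃ κ' : LinearConnection (EuclideanSpace ℝ (Fin m)) (JetModel (EuclideanSpace ℝ (Fin m)) F)
        (Jet (EuclideanSpace ℝ (Fin m)) F V),
      ∀ (x : M) (φ : Cₛ^∞⟮𝓡 m; F, V⟯),
        κ'.toSection x (jet F x φ) = s x (jet _ x (applySection κ.toSection φ)) := by
  choose χ hχ using hcov
  -- Evaluated at a chosen representative. The choice is harmless, since `IsProlonged` expresses the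
  -- result through the jet alone.
  let k : ∀ x, Jet (EuclideanSpace ℝ (Fin m)) F V x → JetJet m F V x := fun x u ↦
    s x (jet _ x (applySection κ.toSection u.rep))
  have hk : ∀ (χ : FibredChart m n F V) x, x ∈ χ.chart.source → ∀ u,
      χ.IsProlonged Γ κ u (k x u) := by
    intro χ x hx u
    have := FibredChart.isProlonged_of_isExchange (κ := κ) hx hs u.rep
    rwa [Jet.jet_rep] at this
  let L : ∀ x, Jet (EuclideanSpace ℝ (Fin m)) F V x →ₗ[ℝ] JetJet m F V x := fun x ↦
    { toFun := k x
      map_add' := fun u u' ↦ (hk (χ x) x (hχ x) (u + u')).unique (hχ x)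
        ((hk (χ x) x (hχ x) u).add (hχ x) (hk (χ x) x (hχ x) u'))
      map_smul' := fun c u ↦ (hk (χ x) x (hχ x) (c • u)).unique (hχ x)
        ((hk (χ x) x (hχ x) u).smul (hχ x) c) }
  obtain ⟨κ', h'⟩ : ∃ K : LinearConnection (EuclideanSpace ℝ (Fin m))
      (JetModel (EuclideanSpace ℝ (Fin m)) F) (Jet (EuclideanSpace ℝ (Fin m)) F V),
      ∀ x v, K.toSection x v = L x v := by
    refine exists_linearConnection L (fun x u ↦ (hk (χ x) x (hχ x) u).proj_eq (hχ x)) fun σ x ↦ ?_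
    have hx := hχ x
    obtain ⟨hσ₀, hσ₁⟩ := (contMDiffAt_jet_section_iff (χ x).chart_mem (χ x).isLocalFrame hx).1
      σ.contMDiff.contMDiffAt
    have hJ := (χ x).isLocalFrame_jet
    have hκ := fun a i j ↦ FibredChart.contMDiffAt_c₁ κ.toSection hx a i j
    rw [contMDiffAt_jet_section_iff (χ x).chart_mem (χ x).isLocalFrame_jet hx]
    have hev : ∀ᶠ z in 𝓝 x, (χ x).IsProlonged Γ κ (σ z) (L z (σ z)) := by
      filter_upwards [(χ x).chart.open_source.mem_nhds hx] with z hz using hk _ z hz _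
    refine ⟨fun p ↦ ?_, ?_⟩
    · refine (contMDiffAt_coeff (χ x).isLocalFrame_jet (χ x).chart.open_source hx
        σ.contMDiff.contMDiffAt p).congr_of_eventuallyEq ?_
      filter_upwards [hev, (χ x).chart.open_source.mem_nhds hx] with z hz hz'
      rw [hz.proj_eq hz']
    · rintro (i | ⟨i, a⟩) b
      · refine (contMDiffAt_mulVec (w := fun z ↦ (χ x).yVec (Jet.proj F V z (σ z)))
          (hκ b) hσ₀ i).congr_of_eventuallyEq ?_
        filter_upwards [hev, (χ x).chart.open_source.mem_nhds hx] with z hz hz'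
        rw [FibredChart.jetDeriv_inl hz']
        exact congrFun (hz.yy₁ b) i
      · have hsm := ((contMDiffAt_mulVec (w := fun z ↦ (χ x).yVec (Jet.proj F V z (σ z)))
          (fun i j ↦ contMDiffAt_pderiv (χ x).chart_mem hx a (hκ b i j)) hσ₀ i).add
          (contMDiffAt_mulVec (w := fun z ↦ (χ x).y₁Vec a (σ z)) (hκ b) (fun j ↦ hσ₁ j a) i)).add
          (ContMDiffAt.sum (t := Finset.univ) fun (c : Fin m) _ ↦
            (contMDiffAt_chartChristoffel Γ hΓ (χ x).chart_mem hx b c a).mul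
            ((contMDiffAt_mulVec (w := fun z ↦ (χ x).yVec (Jet.proj F V z (σ z)))
              (hκ c) hσ₀ i).sub (hσ₁ i c)))
        refine hsm.congr_of_eventuallyEq ?_
        filter_upwards [hev, (χ x).chart.open_source.mem_nhds hx] with z hz hz'
        rw [FibredChart.jetDeriv_inr hz']
        refine (congrFun (hz.yy₂ a b) i).trans ?_
        simp only [Pi.add_apply, Finset.sum_apply, Pi.smul_apply, Pi.sub_apply, smul_eq_mul]
        rfl
  refine ⟨κ', fun x φ ↦ ?_⟩
  rw [h']
  exact (hk (χ x) x (hχ x) _).unique (hχ x) (FibredChart.isProlonged_of_isExchange (hχ x) hs φ)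

end

/-! ### The coordinate expression of `κ↑` -/

section

variable {m n : ℕ} {M : Type*} [TopologicalSpace M] [T2Space M]
  [ChartedSpace (EuclideanSpace ℝ (Fin m)) M] [IsManifold (𝓡 m) ∞ M]
  {F : Type*} [NormedAddCommGroup F] [NormedSpace ℝ F] [FiniteDimensional ℝ F]
  {V : M → Type*} [∀ x, AddCommGroup (V x)] [∀ x, Module ℝ (V x)] [∀ x, TopologicalSpace (V x)]
  [TopologicalSpace (TotalSpace F V)] [FiberBundle F V] [VectorBundle ℝ F V]
  [ContMDiffVectorBundle ∞ F V (𝓡 m)]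

/-- The fibre over `x` of the jet bundle of `J E ⊗ E*`. -/
abbrev JetJetEnd (m : ℕ) (F : Type*) [NormedAddCommGroup F] [NormedSpace ℝ F]
    {M : Type*} [TopologicalSpace M] [T2Space M]
    [ChartedSpace (EuclideanSpace ℝ (Fin m)) M] [IsManifold (𝓡 m) ∞ M]
    (V : M → Type*) [∀ x, AddCommGroup (V x)] [∀ x, Module ℝ (V x)] [∀ x, TopologicalSpace (V x)]
    [TopologicalSpace (TotalSpace F V)] [FiberBundle F V] [VectorBundle ℝ F V]
    [ContMDiffVectorBundle ∞ F V (𝓡 m)] (x : M) :=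
  Jet (EuclideanSpace ℝ (Fin m)) (JetEndModel (EuclideanSpace ℝ (Fin m)) F)
    (JetEnd (EuclideanSpace ℝ (Fin m)) F V) x

theorem contMDiffAt_matrix_mul {B C : M → Matrix (Fin n) (Fin n) ℝ} {x : M}
    (hB : ∀ i j, ContMDiffAt (𝓡 m) 𝓘(ℝ) ∞ (fun z ↦ B z i j) x)
    (hC : ∀ i j, ContMDiffAt (𝓡 m) 𝓘(ℝ) ∞ (fun z ↦ C z i j) x) (i j : Fin n) :
    ContMDiffAt (𝓡 m) 𝓘(ℝ) ∞ (fun z ↦ (B z * C z) i j) x := by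
  simp only [Matrix.mul_apply]
  exact ContMDiffAt.sum fun k _ ↦ (hB i k).mul (hC k j)

namespace FibredChart

open Matrix

variable {χ : FibredChart m n F V} {x : M}

/-- The matrices of the section are affine functions of the coordinates of `M` near `x`. Besides the
jet at `x`, this explicit form is kept in the conclusion, since it is what later places the section
inside `C` or `C_G` at nearby points. -/
theorem exists_end_section (hx : x ∈ χ.chart.source) (A₀ : Matrix (Fin n) (Fin n) ℝ)
    (A₁ D₀ : Fin m → Matrix (Fin n) (Fin n) ℝ) (D₁ : Fin m → Fin m → Matrix (Fin n) (Fin n) ℝ) :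
    ∃ α : Cₛ^∞⟮𝓡 m; JetEndModel (EuclideanSpace ℝ (Fin m)) F,
        JetEnd (EuclideanSpace ℝ (Fin m)) F V⟯,
      (∀ᶠ z in 𝓝 x, χ.c₀ (α z) = A₀ + ∑ a, (χ.chart z a - χ.chart x a) • D₀ a ∧
        ∀ b, χ.c₁ b (α z) = A₁ b + ∑ a, (χ.chart z a - χ.chart x a) • D₁ a b) ∧
      χ.c₀ (α x) = A₀ ∧ (∀ b, χ.c₁ b (α x) = A₁ b) ∧
      (∀ a, χ.dc₀ a (jet _ x α) = D₀ a) ∧ ∀ a b, χ.dc₁ a b (jet _ x α) = D₁ a b := by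
  obtain ⟨α, h0, h1, h2⟩ := exists_section_affine χ.chart_mem hx χ.isLocalFrame_end
    (fun p ↦ Sum.elim (fun i ↦ A₀ i p.2) (fun q ↦ A₁ q.2 q.1 p.2) p.1)
    (fun p a ↦ Sum.elim (fun i ↦ D₀ a i p.2) (fun q ↦ D₁ a q.2 q.1 p.2) p.1)
  refine ⟨α, ?_, ?_, fun b ↦ ?_, fun a ↦ ?_, fun a b ↦ ?_⟩
  · filter_upwards [h0, χ.chart.open_source.mem_nhds hx] with z hz hz'
    refine ⟨?_, fun b ↦ ?_⟩
    · ext i j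
      rw [← end_coeff_inl hz', hz]
      simp [Matrix.add_apply, Matrix.sum_apply, mul_comm]
    · ext i j
      rw [← end_coeff_inr hz', hz]
      simp [Matrix.add_apply, Matrix.sum_apply, mul_comm]
  · ext i j
    rw [← end_coeff_inl hx, h1]
    rfl
  · ext i j
    rw [← end_coeff_inr hx, h1]
    rfl
  · ext i j
    rw [← jetDeriv_end_inl hx, h2]
    rfl
  · ext i j
    rw [← jetDeriv_end_inr hx, h2]
    rfl

theorem dc₀_add (hx : x ∈ χ.chart.source) (a : Fin m) (u w : JetJetEnd m F V x) :
    χ.dc₀ a (u + w) = χ.dc₀ a u + χ.dc₀ a w := by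
  ext i j
  simp only [Matrix.add_apply, ← jetDeriv_end_inl hx]
  exact jetDeriv_add χ.chart_mem hx _ χ.chart.open_source hx _ _ _ _

theorem dc₁_add (hx : x ∈ χ.chart.source) (a b : Fin m) (u w : JetJetEnd m F V x) :
    χ.dc₁ a b (u + w) = χ.dc₁ a b u + χ.dc₁ a b w := by
  ext i j
  simp only [Matrix.add_apply, ← jetDeriv_end_inr hx]
  exact jetDeriv_add χ.chart_mem hx _ χ.chart.open_source hx _ _ _ _

theorem dc₀_smul (hx : x ∈ χ.chart.source) (a : Fin m) (c : ℝ) (u : JetJetEnd m F V x) :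
    χ.dc₀ a (c • u) = c • χ.dc₀ a u := by
  ext i j
  simp only [Matrix.smul_apply, ← jetDeriv_end_inl hx]
  exact jetDeriv_smul χ.chart_mem hx _ χ.chart.open_source hx _ _ _ _

theorem dc₁_smul (hx : x ∈ χ.chart.source) (a b : Fin m) (c : ℝ) (u : JetJetEnd m F V x) :
    χ.dc₁ a b (c • u) = c • χ.dc₁ a b u := by
  ext i j
  simp only [Matrix.smul_apply, ← jetDeriv_end_inr hx]
  exact jetDeriv_smul χ.chart_mem hx _ χ.chart.open_source hx _ _ _ _

theorem c₀_add (A B : JetEnd (EuclideanSpace ℝ (Fin m)) F V x) :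
    χ.c₀ (A + B) = χ.c₀ A + χ.c₀ B := by
  ext i j
  simp [c₀]

theorem c₀_smul (c : ℝ) (A : JetEnd (EuclideanSpace ℝ (Fin m)) F V x) :
    χ.c₀ (c • A) = c • χ.c₀ A := by
  ext i j
  simp [c₀]

theorem c₁_add (hx : x ∈ χ.chart.source) (a : Fin m)
    (A B : JetEnd (EuclideanSpace ℝ (Fin m)) F V x) :
    χ.c₁ a (A + B) = χ.c₁ a A + χ.c₁ a B := by
  ext i j
  exact congrFun (y₁Vec_add hx a (A (χ.frame j x)) (B (χ.frame j x))) i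

theorem c₁_smul (hx : x ∈ χ.chart.source) (a : Fin m) (c : ℝ)
    (A : JetEnd (EuclideanSpace ℝ (Fin m)) F V x) : χ.c₁ a (c • A) = c • χ.c₁ a A := by
  ext i j
  exact congrFun (y₁Vec_smul hx a c (A (χ.frame j x))) i

theorem jetJetEnd_ext (hx : x ∈ χ.chart.source) {u w : JetJetEnd m F V x}
    (h : Jet.proj _ _ x u = Jet.proj _ _ x w) (h₀ : ∀ a, χ.dc₀ a u = χ.dc₀ a w)
    (h₁ : ∀ a b, χ.dc₁ a b u = χ.dc₁ a b w) : u = w := by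
  refine jet_ext χ.chart_mem hx χ.isLocalFrame_end χ.chart.open_source hx (fun p ↦ by rw [h]) ?_
  rintro ⟨i | ⟨i, b⟩, j⟩ a
  · rw [jetDeriv_end_inl hx, jetDeriv_end_inl hx, h₀]
  · rw [jetDeriv_end_inr hx, jetDeriv_end_inr hx, h₁]

variable (χ) in
/-- The coordinate expression of `u = κ↑(A)`. -/
def IsOver (Γ : CovariantDerivative (𝓡 m) (EuclideanSpace ℝ (Fin m))
      (TangentSpace (𝓡 m) : M → Type _))
    (κ : LinearConnection (EuclideanSpace ℝ (Fin m)) F V) {x : M}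
    (A : JetEnd (EuclideanSpace ℝ (Fin m)) F V x) (u : JetJetEnd m F V x) : Prop :=
  (Jet.proj _ _ x u = A) ∧
  (∀ a, χ.dc₀ a u = χ.comp κ a x * χ.c₀ A - χ.c₀ A * χ.comp κ a x) ∧
  (∀ a b, χ.dc₁ a b u = χ.dcomp κ a b x * χ.c₀ A + χ.comp κ a x * χ.c₁ b A -
      χ.c₁ b A * χ.comp κ a x +
      ∑ c, χ.christoffel Γ a c b x • (χ.comp κ c x * χ.c₀ A - χ.c₁ c A))

variable {Γ : CovariantDerivative (𝓡 m) (EuclideanSpace ℝ (Fin m))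
    (TangentSpace (𝓡 m) : M → Type _)} {κ : LinearConnection (EuclideanSpace ℝ (Fin m)) F V}
  {A B : JetEnd (EuclideanSpace ℝ (Fin m)) F V x} {u w : JetJetEnd m F V x}
  {α : Cₛ^∞⟮𝓡 m; JetEndModel (EuclideanSpace ℝ (Fin m)) F,
    JetEnd (EuclideanSpace ℝ (Fin m)) F V⟯}

theorem IsOver.mk (h0 : Jet.proj _ _ x u = A)
    (h1 : ∀ a, χ.dc₀ a u = χ.comp κ a x * χ.c₀ A - χ.c₀ A * χ.comp κ a x)
    (h2 : ∀ a b, χ.dc₁ a b u = χ.dcomp κ a b x * χ.c₀ A + χ.comp κ a x * χ.c₁ b A -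
        χ.c₁ b A * χ.comp κ a x +
        ∑ c, χ.christoffel Γ a c b x • (χ.comp κ c x * χ.c₀ A - χ.c₁ c A)) :
    χ.IsOver Γ κ A u :=
  ⟨h0, h1, h2⟩

theorem IsOver.proj (H : χ.IsOver Γ κ A u) :
    Jet.proj _ _ x u = A :=
  H.1

theorem IsOver.dc₀ (H : χ.IsOver Γ κ A u) :
    ∀ a, χ.dc₀ a u = χ.comp κ a x * χ.c₀ A - χ.c₀ A * χ.comp κ a x :=
  H.2.1

theorem IsOver.dc₁ (H : χ.IsOver Γ κ A u) :
    ∀ a b, χ.dc₁ a b u = χ.dcomp κ a b x * χ.c₀ A + χ.comp κ a x * χ.c₁ b A -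
        χ.c₁ b A * χ.comp κ a x +
        ∑ c, χ.christoffel Γ a c b x • (χ.comp κ c x * χ.c₀ A - χ.c₁ c A) :=
  H.2.2

/-- The equations prescribe every coordinate of the jet. The same lemma later yields linearity of
`κ↑` and its uniqueness. -/
theorem IsOver.unique (hx : x ∈ χ.chart.source) (h : χ.IsOver Γ κ A u) (h' : χ.IsOver Γ κ A w) :
    u = w :=
  jetJetEnd_ext hx (h.proj.trans h'.proj.symm) (fun a ↦ (h.dc₀ a).trans (h'.dc₀ a).symm)
    fun a b ↦ (h.dc₁ a b).trans (h'.dc₁ a b).symm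

theorem IsOver.add (hx : x ∈ χ.chart.source) (h : χ.IsOver Γ κ A u) (h' : χ.IsOver Γ κ B w) :
    χ.IsOver Γ κ (A + B) (u + w) := by
  refine .mk ?_ ?_ ?_
  · rw [map_add, h.proj, h'.proj]
  · intro a
    rw [dc₀_add hx, h.dc₀, h'.dc₀, c₀_add, mul_add, add_mul]
    abel
  · intro a b
    rw [dc₁_add hx, h.dc₁, h'.dc₁]
    simp only [c₀_add, c₁_add hx, mul_add, add_mul, add_sub_add_comm, smul_add,
      Finset.sum_add_distrib]
    abel

theorem IsOver.smul (hx : x ∈ χ.chart.source) (c : ℝ) (h : χ.IsOver Γ κ A u) :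
    χ.IsOver Γ κ (c • A) (c • u) := by
  refine .mk ?_ ?_ ?_
  · rw [map_smul, h.proj]
  · intro a
    rw [dc₀_smul hx, h.dc₀, c₀_smul, mul_smul_comm, smul_mul_assoc, smul_sub]
  · intro a b
    rw [dc₁_smul hx, h.dc₁]
    simp only [c₀_smul, c₁_smul hx, mul_smul_comm, smul_mul_assoc, smul_add, smul_sub,
      Finset.smul_sum, smul_comm c]

theorem exists_isOver (hx : x ∈ χ.chart.source) (A : JetEnd (EuclideanSpace ℝ (Fin m)) F V x) :
    ∃ u, χ.IsOver Γ κ A u := by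
  obtain ⟨α, -, h0, h1, h2, h3⟩ := exists_end_section hx (χ.c₀ A) (fun a ↦ χ.c₁ a A)
    (fun a ↦ χ.comp κ a x * χ.c₀ A - χ.c₀ A * χ.comp κ a x)
    (fun a b ↦ χ.dcomp κ a b x * χ.c₀ A + χ.comp κ a x * χ.c₁ b A - χ.c₁ b A * χ.comp κ a x +
      ∑ c, χ.christoffel Γ a c b x • (χ.comp κ c x * χ.c₀ A - χ.c₁ c A))
  exact ⟨jet _ x α, .mk (ext_end hx h0 h1) h2 h3⟩

theorem y₁Vec_parallel (hx : x ∈ χ.chart.source) {s : Cₛ^∞⟮𝓡 m; F, V⟯}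
    (hs : jet F x s = κ.toSection x (s x)) (a : Fin m) :
    χ.y₁Vec a (jet F x s) = χ.comp κ a x *ᵥ χ.yVec (s x) := by
  rw [hs, c₁_apply hx]
  rfl

/-- The element `κ(v)` is itself a jet over `v`, and any section that represents it is parallel at
`x`. -/
theorem exists_parallel (κ : LinearConnection (EuclideanSpace ℝ (Fin m)) F V) (x : M) (v : V x) :
    ∃ s : Cₛ^∞⟮𝓡 m; F, V⟯, s x = v ∧ jet F x s = κ.toSection x (s x) := by
  obtain ⟨s, hs⟩ := jet_surjective F V x (κ.toSection x v)
  have h : s x = v := by rw [← κ.proj_apply x v, ← hs, proj_jet]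
  exact ⟨s, h, by rw [hs, h]⟩

/-- With `∂_a s = κ_a s` at `x`, the terms `-Y κ_a` and `-y_b κ_a` in the derivative of `α` cancel
those in which the product rule differentiates `s`. What remains is the expression of `κ'` at
`α(s)`. -/
theorem IsOver.isProlonged (hx : x ∈ χ.chart.source) (h : χ.IsOver Γ κ (α x) (jet _ x α))
    {s : Cₛ^∞⟮𝓡 m; F, V⟯} (hs : jet F x s = κ.toSection x (s x)) :
    χ.IsProlonged Γ κ (α x (s x)) (jet _ x (applySection α s)) := by
  refine .mk ?_ ?_ ?_ ?_
  · simp only [FibredChart.yy, rep_apply]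
    rfl
  · intro a
    simp only [FibredChart.yyBase, rep_apply]
    rfl
  · intro a
    rw [yy₁_applySection α s hx, h.dc₀, y₁Vec_parallel hx hs, c₀_apply hx, mulVec_mulVec,
      mulVec_mulVec, ← add_mulVec, sub_add_cancel]
  · intro a b
    rw [yy₂_applySection α s hx, h.dc₁, y₁Vec_parallel hx hs]
    simp only [c₁_apply hx, c₀_apply hx, mulVec_mulVec, ← sub_mulVec, ← smul_mulVec, ← sum_mulVec,
      ← add_mulVec]
    congr 1
    abel

/-- Parallel sections pass through every vector of the frame, so they detect each column of a
matrix. -/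
theorem eq_of_mulVec_parallel (κ : LinearConnection (EuclideanSpace ℝ (Fin m)) F V)
    (hx : x ∈ χ.chart.source) {N N' : Matrix (Fin n) (Fin n) ℝ}
    (h : ∀ s : Cₛ^∞⟮𝓡 m; F, V⟯, jet F x s = κ.toSection x (s x) →
      N *ᵥ χ.yVec (s x) = N' *ᵥ χ.yVec (s x)) : N = N' := by
  refine Matrix.ext_of_mulVec_single fun j ↦ ?_
  obtain ⟨s, hs, hp⟩ := exists_parallel κ x (χ.frame j x)
  rw [← yVec_frame hx j, ← hs]
  exact h s hp

/-- The computation of `IsOver.isProlonged` read backwards: the product rule is solved for the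
derivatives of `α`, first as an identity on `s(x)`, then as an identity of matrices. -/
theorem isOver_of_isProlonged (hx : x ∈ χ.chart.source)
    (H : ∀ s : Cₛ^∞⟮𝓡 m; F, V⟯, jet F x s = κ.toSection x (s x) →
      χ.IsProlonged Γ κ (α x (s x)) (jet _ x (applySection α s))) :
    χ.IsOver Γ κ (α x) (jet _ x α) := by
  refine .mk (proj_jet _) (fun a ↦ ?_) fun a b ↦ ?_
  · refine eq_of_mulVec_parallel κ hx fun s hp ↦ ?_
    have h1 := (yy₁_applySection α s hx a).symm.trans ((H s hp).yy₁ a)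
    rw [y₁Vec_parallel hx hp, c₀_apply hx, mulVec_mulVec, mulVec_mulVec] at h1
    rw [sub_mulVec, ← h1, add_sub_cancel_right]
  · refine eq_of_mulVec_parallel κ hx fun s hp ↦ ?_
    -- The pair of indices is reversed: `yy₂ i b a` differentiates `y_b` along `x^a`, as `dc₁ a b`
    -- does.
    have h1 := (yy₂_applySection α s hx b a).symm.trans ((H s hp).yy₂ b a)
    rw [y₁Vec_parallel hx hp, ← eq_sub_iff_add_eq] at h1
    simp only [c₁_apply hx, c₀_apply hx, mulVec_mulVec, ← sub_mulVec,
      ← smul_mulVec, ← sum_mulVec, ← add_mulVec] at h1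
    refine h1.trans (congrArg (· *ᵥ _) ?_)
    abel

end FibredChart

/-- The equations of `IsOver` are linear in `A` and determine the jet, so `k` is linear in each
fibre; their coefficients are smooth, so `k` is smooth. -/
theorem exists_linearConnection_of_isOver (hcov : ∀ x : M, ∃ χ : FibredChart m n F V, x ∈ χ.chart.source)
    {Γ : CovariantDerivative (𝓡 m) (EuclideanSpace ℝ (Fin m)) (TangentSpace (𝓡 m) : M → Type _)}
    (hΓ : CovariantDerivative.ContMDiffCovariantDerivative Γ ∞)
    (κ : LinearConnection (EuclideanSpace ℝ (Fin m)) F V)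
    {k : ∀ x : M, JetEnd (EuclideanSpace ℝ (Fin m)) F V x → JetJetEnd m F V x}
    (hk : ∀ χ : FibredChart m n F V, ∀ x ∈ χ.chart.source, ∀ A, χ.IsOver Γ κ A (k x A)) :
    ∃ K : LinearConnection (EuclideanSpace ℝ (Fin m)) (JetEndModel (EuclideanSpace ℝ (Fin m)) F)
      (JetEnd (EuclideanSpace ℝ (Fin m)) F V), ∀ x A, K.toSection x A = k x A := by
  choose χ hχ using hcov
  let L : ∀ x, JetEnd (EuclideanSpace ℝ (Fin m)) F V x →ₗ[ℝ] JetJetEnd m F V x := fun x ↦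
    { toFun := k x
      map_add' := fun A B ↦ (hk (χ x) x (hχ x) (A + B)).unique (hχ x)
        ((hk (χ x) x (hχ x) A).add (hχ x) (hk (χ x) x (hχ x) B))
      map_smul' := fun c A ↦ (hk (χ x) x (hχ x) (c • A)).unique (hχ x)
        ((hk (χ x) x (hχ x) A).smul (hχ x) c) }
  refine exists_linearConnection L (fun x A ↦ (hk (χ x) x (hχ x) A).proj) fun σ x ↦ ?_
  have hx := hχ x
  have hσ₀ := fun i j ↦ FibredChart.contMDiffAt_c₀ σ hx i j
  have hσ₁ := fun a i j ↦ FibredChart.contMDiffAt_c₁ σ hx a i j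
  have hκ : ∀ a i j, ContMDiffAt (𝓡 m) 𝓘(ℝ) ∞ (fun z ↦ (χ x).comp κ a z i j) x :=
    fun a i j ↦ FibredChart.contMDiffAt_c₁ κ.toSection hx a i j
  have hdκ : ∀ a b i j, ContMDiffAt (𝓡 m) 𝓘(ℝ) ∞ (fun z ↦ (χ x).dcomp κ a b z i j) x :=
    fun a b i j ↦ contMDiffAt_pderiv (χ x).chart_mem hx b (hκ a i j)
  rw [contMDiffAt_jet_section_iff (χ x).chart_mem (χ x).isLocalFrame_end hx]
  have hev : ∀ᶠ z in 𝓝 x, (χ x).IsOver Γ κ (σ z) (L z (σ z)) := by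
    filter_upwards [(χ x).chart.open_source.mem_nhds hx] with z hz using hk _ z hz _
  refine ⟨fun p ↦ ?_, ?_⟩
  · refine (contMDiffAt_coeff (χ x).isLocalFrame_end (χ x).chart.open_source hx
      σ.contMDiff.contMDiffAt p).congr_of_eventuallyEq ?_
    filter_upwards [hev] with z hz
    rw [hz.proj]
  · rintro ⟨i | ⟨i, b⟩, j⟩ a
    · refine ((contMDiffAt_matrix_mul (hκ a) hσ₀ i j).sub
        (contMDiffAt_matrix_mul hσ₀ (hκ a) i j)).congr_of_eventuallyEq ?_
      filter_upwards [hev, (χ x).chart.open_source.mem_nhds hx] with z hz hz'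
      rw [FibredChart.jetDeriv_end_inl hz', hz.dc₀]
      rfl
    · refine ((((contMDiffAt_matrix_mul (hdκ a b) hσ₀ i j).add
        (contMDiffAt_matrix_mul (hκ a) (hσ₁ b) i j)).sub
        (contMDiffAt_matrix_mul (hσ₁ b) (hκ a) i j)).add
        (ContMDiffAt.sum (t := Finset.univ) fun (c : Fin m) _ ↦
          (contMDiffAt_chartChristoffel Γ hΓ (χ x).chart_mem hx a c b).mul
          ((contMDiffAt_matrix_mul (hκ c) hσ₀ i j).sub
            (hσ₁ c i j)))).congr_of_eventuallyEq ?_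
      filter_upwards [hev, (χ x).chart.open_source.mem_nhds hx] with z hz hz'
      rw [FibredChart.jetDeriv_end_inr hz', hz.dc₁]
      simp only [Matrix.add_apply, Matrix.sub_apply, Matrix.sum_apply, Matrix.smul_apply,
        smul_eq_mul]
      rfl

end

/-! ### The criterion by parallel sections; existence and uniqueness of `κ↑` -/

section

variable {m n : ℕ} {M : Type*} [TopologicalSpace M] [T2Space M]
  [ChartedSpace (EuclideanSpace ℝ (Fin m)) M] [IsManifold (𝓡 m) ∞ M]
  {F : Type*} [NormedAddCommGroup F] [NormedSpace ℝ F] [FiniteDimensional ℝ F]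
  {V : M → Type*} [∀ x, AddCommGroup (V x)] [∀ x, Module ℝ (V x)] [∀ x, TopologicalSpace (V x)]
  [TopologicalSpace (TotalSpace F V)] [FiberBundle F V] [VectorBundle ℝ F V]
  [ContMDiffVectorBundle ∞ F V (𝓡 m)]


theorem isProlonged_of_prolonged {Γ : CovariantDerivative (𝓡 m) (EuclideanSpace ℝ (Fin m))
      (TangentSpace (𝓡 m) : M → Type _)}
    {κ : LinearConnection (EuclideanSpace ℝ (Fin m)) F V}
    {s : ∀ x : M, JetJet m F V x → JetJet m F V x} (hs : IsExchange n Γ s)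
    {κ' : LinearConnection (EuclideanSpace ℝ (Fin m))
      (JetModel (EuclideanSpace ℝ (Fin m)) F) (Jet (EuclideanSpace ℝ (Fin m)) F V)}
    (h : ∀ (x : M) (φ : Cₛ^∞⟮𝓡 m; F, V⟯),
        κ'.toSection x (jet F x φ) = s x (jet _ x (applySection κ.toSection φ)))
    (χ : FibredChart m n F V) {x : M} (hx : x ∈ χ.chart.source)
    (u : Jet (EuclideanSpace ℝ (Fin m)) F V x) : χ.IsProlonged Γ κ u (κ'.toSection x u) := by
  obtain ⟨φ, rfl⟩ := jet_surjective F V x u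
  rw [h]
  exact FibredChart.isProlonged_of_isExchange hx hs φ

section

variable {Γ : CovariantDerivative (𝓡 m) (EuclideanSpace ℝ (Fin m))
      (TangentSpace (𝓡 m) : M → Type _)}
    {κ : LinearConnection (EuclideanSpace ℝ (Fin m)) F V}
    {κ' : LinearConnection (EuclideanSpace ℝ (Fin m))
      (JetModel (EuclideanSpace ℝ (Fin m)) F) (Jet (EuclideanSpace ℝ (Fin m)) F V)}
    {χ χ' : FibredChart m n F V} {x : M}

/-- The right-hand side is intrinsic, whereas the left-hand side refers to the chart `χ`. This
replaces a direct check that the formula for `κ↑` transforms correctly. -/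
theorem FibredChart.isOver_iff_parallel
    (hκ' : ∀ (χ : FibredChart m n F V) (x : M), x ∈ χ.chart.source →
      ∀ u, χ.IsProlonged Γ κ u (κ'.toSection x u))
    (hx : x ∈ χ.chart.source) {α : Cₛ^∞⟮𝓡 m; JetEndModel (EuclideanSpace ℝ (Fin m)) F,
      JetEnd (EuclideanSpace ℝ (Fin m)) F V⟯} :
    χ.IsOver Γ κ (α x) (jet _ x α) ↔
      ∀ s : Cₛ^∞⟮𝓡 m; F, V⟯, jet F x s = κ.toSection x (s x) →
        jet _ x (applySection α s) = κ'.toSection x (α x (s x)) := by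
  constructor
  · intro h s hs
    exact (h.isProlonged hx hs).unique hx (hκ' χ x hx _)
  · intro h
    refine FibredChart.isOver_of_isProlonged hx fun s hs ↦ ?_
    rw [h s hs]
    exact hκ' χ x hx _

theorem FibredChart.IsOver.change
    (hκ' : ∀ (χ : FibredChart m n F V) (x : M), x ∈ χ.chart.source →
      ∀ u, χ.IsProlonged Γ κ u (κ'.toSection x u))
    (hx : x ∈ χ.chart.source) (hx' : x ∈ χ'.chart.source) {A : JetEnd (EuclideanSpace ℝ (Fin m)) F V x}
    {u : JetJetEnd m F V x} (h : χ.IsOver Γ κ A u) : χ'.IsOver Γ κ A u := by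
  obtain ⟨α, rfl⟩ := jet_surjective _ _ x u
  obtain rfl : α x = A := by rw [← h.proj, proj_jet]
  rw [isOver_iff_parallel hκ' hx] at h
  rwa [isOver_iff_parallel hκ' hx']

end

set_option maxHeartbeats 400000 in
-- Every element of the jet fibre is the jet of some section. Applied to `K(A)` this yields a
-- section `α` through `A` that is parallel for `K`, and the tensor-dual condition on `α` is the
-- criterion of `FibredChart.isOver_iff_parallel`.
theorem isTensorDual_iff (hcov : ∀ x : M, ∃ χ : FibredChart m n F V, x ∈ χ.chart.source)
    {Γ : CovariantDerivative (𝓡 m) (EuclideanSpace ℝ (Fin m)) (TangentSpace (𝓡 m) : M → Type _)}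
    {κ : LinearConnection (EuclideanSpace ℝ (Fin m)) F V}
    {κ' : LinearConnection (EuclideanSpace ℝ (Fin m))
      (JetModel (EuclideanSpace ℝ (Fin m)) F) (Jet (EuclideanSpace ℝ (Fin m)) F V)}
    (hκ' : ∀ (χ : FibredChart m n F V) (x : M), x ∈ χ.chart.source →
      ∀ u, χ.IsProlonged Γ κ u (κ'.toSection x u))
    {K : LinearConnection (EuclideanSpace ℝ (Fin m)) (JetEndModel (EuclideanSpace ℝ (Fin m)) F)
      (JetEnd (EuclideanSpace ℝ (Fin m)) F V)} :
    IsTensorDual κ' κ K ↔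
      ∀ χ : FibredChart m n F V, ∀ x ∈ χ.chart.source, ∀ A, χ.IsOver Γ κ A (K.toSection x A) := by
  constructor
  · intro h χ x hx A
    obtain ⟨α, hα⟩ := jet_surjective _ _ x (K.toSection x A)
    obtain rfl : α x = A := by rw [← K.proj_apply x A, ← hα, proj_jet]
    rw [← hα, FibredChart.isOver_iff_parallel hκ' hx]
    exact fun s hs ↦ h x α s hα hs
  · intro h x α s hα hs
    obtain ⟨χ, hx⟩ := hcov x
    have h1 := h χ x hx (α x)
    rw [← hα] at h1
    exact (FibredChart.isOver_iff_parallel hκ' hx).1 h1 s hs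

set_option maxHeartbeats 400000 in
/-- Existence and coordinate expression of the overconnection. -/
theorem exists_overconnection (hcov : ∀ x : M, ∃ χ : FibredChart m n F V, x ∈ χ.chart.source)
    {Γ : CovariantDerivative (𝓡 m) (EuclideanSpace ℝ (Fin m)) (TangentSpace (𝓡 m) : M → Type _)}
    (hΓ : CovariantDerivative.ContMDiffCovariantDerivative Γ ∞)
    (κ : LinearConnection (EuclideanSpace ℝ (Fin m)) F V) :
    ∃ K : LinearConnection (EuclideanSpace ℝ (Fin m)) (JetEndModel (EuclideanSpace ℝ (Fin m)) F)
      (JetEnd (EuclideanSpace ℝ (Fin m)) F V),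
      IsOverconnection n Γ κ K ∧
      ∀ χ : FibredChart m n F V, ∀ x ∈ χ.chart.source, ∀ A, χ.IsOver Γ κ A (K.toSection x A) := by
  obtain ⟨s, hs⟩ := exists_isExchange hcov Γ
  obtain ⟨κ', hκ'⟩ := exists_prolonged hcov hΓ κ hs
  have hpro : ∀ (χ : FibredChart m n F V) (x : M), x ∈ χ.chart.source →
      ∀ u, χ.IsProlonged Γ κ u (κ'.toSection x u) := fun χ x hx u ↦
    isProlonged_of_prolonged hs hκ' χ hx u
  -- A solution of the equations in one chart around `x` solves them in every chart.
  have hex : ∀ x (A : JetEnd (EuclideanSpace ℝ (Fin m)) F V x), ∃ u : JetJetEnd m F V x, ∀ χ : FibredChart m n F V, x ∈ χ.chart.source → χ.IsOver Γ κ A u := by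
    intro x A
    obtain ⟨χ, hx⟩ := hcov x
    obtain ⟨u, hu⟩ := FibredChart.exists_isOver (Γ := Γ) (κ := κ) hx A
    exact ⟨u, fun χ' hx' ↦ FibredChart.IsOver.change hpro hx hx' hu⟩
  choose k hk using hex
  obtain ⟨K, hK⟩ := exists_linearConnection_of_isOver hcov hΓ κ fun χ x hx A ↦ hk x A χ hx
  have h : ∀ χ : FibredChart m n F V, ∀ x ∈ χ.chart.source, ∀ A,
      χ.IsOver Γ κ A (K.toSection x A) := fun χ x hx A ↦ by
    rw [hK]
    exact hk x A χ hx
  exact ⟨K, ⟨s, hs, κ', hκ', (isTensorDual_iff hcov hpro).2 h⟩, h⟩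

/-- The resulting equations involve only `Γ` and `κ`, not the witnesses `s` and `κ'`. Hence
uniqueness holds whichever witnesses are used. -/
theorem IsOverconnection.isOver
    (hcov : ∀ x : M, ∃ χ : FibredChart m n F V, x ∈ χ.chart.source)
    {Γ : CovariantDerivative (𝓡 m) (EuclideanSpace ℝ (Fin m)) (TangentSpace (𝓡 m) : M → Type _)}
    {κ : LinearConnection (EuclideanSpace ℝ (Fin m)) F V}
    {K : LinearConnection (EuclideanSpace ℝ (Fin m)) (JetEndModel (EuclideanSpace ℝ (Fin m)) F)
      (JetEnd (EuclideanSpace ℝ (Fin m)) F V)} (h : IsOverconnection n Γ κ K)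
    (χ : FibredChart m n F V) {x : M} (hx : x ∈ χ.chart.source)
    (A : JetEnd (EuclideanSpace ℝ (Fin m)) F V x) : χ.IsOver Γ κ A (K.toSection x A) := by
  obtain ⟨s, hs, κ', hκ', hK⟩ := h
  exact (isTensorDual_iff hcov fun χ x hx u ↦ isProlonged_of_prolonged hs hκ' χ hx u).1 hK χ x hx A

theorem LinearConnection.ext_of_toSection {K K' : LinearConnection (EuclideanSpace ℝ (Fin m)) F V}
    (h : ∀ x v, K.toSection x v = K'.toSection x v) : K = K' := by
  have : K.toSection = K'.toSection :=
    ContMDiffSection.ext fun x ↦ ContinuousLinearMap.ext fun v ↦ h x v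
  cases K
  cases K'
  congr

theorem IsOverconnection.unique
    (hcov : ∀ x : M, ∃ χ : FibredChart m n F V, x ∈ χ.chart.source)
    {Γ : CovariantDerivative (𝓡 m) (EuclideanSpace ℝ (Fin m)) (TangentSpace (𝓡 m) : M → Type _)}
    {κ : LinearConnection (EuclideanSpace ℝ (Fin m)) F V}
    {K K' : LinearConnection (EuclideanSpace ℝ (Fin m)) (JetEndModel (EuclideanSpace ℝ (Fin m)) F)
      (JetEnd (EuclideanSpace ℝ (Fin m)) F V)} (h : IsOverconnection n Γ κ K)
    (h' : IsOverconnection n Γ κ K') : K = K' := by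
  refine LinearConnection.ext_of_toSection fun x A ↦ ?_
  obtain ⟨χ, hx⟩ := hcov x
  exact (h.isOver hcov χ hx A).unique hx (h'.isOver hcov χ hx A)

end

section

variable {m n : ℕ} {M : Type*} [TopologicalSpace M] [T2Space M]
  [ChartedSpace (EuclideanSpace ℝ (Fin m)) M] [IsManifold (𝓡 m) ∞ M]
  {F : Type*} [NormedAddCommGroup F] [NormedSpace ℝ F] [FiniteDimensional ℝ F]
  {V : M → Type*} [∀ x, AddCommGroup (V x)] [∀ x, Module ℝ (V x)] [∀ x, TopologicalSpace (V x)]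
  [TopologicalSpace (TotalSpace F V)] [FiberBundle F V] [VectorBundle ℝ F V]
  [ContMDiffVectorBundle ∞ F V (𝓡 m)]


/-! ### Derivatives of functions with values in matrix spaces and in `G` -/

section MatrixFunctions

open Matrix

variable {φ : OpenPartialHomeomorph M (EuclideanSpace ℝ (Fin m))} {x : M}

theorem linear_eq_sum (f : Matrix (Fin n) (Fin n) ℝ →ₗ[ℝ] ℝ) (B : Matrix (Fin n) (Fin n) ℝ) :
    f B = ∑ i, ∑ j, f (Matrix.single i j 1) * B i j := by
  conv_lhs => rw [Matrix.matrix_eq_sum_single B]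
  simp only [map_sum]
  refine Finset.sum_congr rfl fun i _ ↦ Finset.sum_congr rfl fun j _ ↦ ?_
  rw [show Matrix.single i j (B i j) = B i j • Matrix.single i j (1 : ℝ) by simp, map_smul,
    smul_eq_mul, mul_comm]

theorem pderiv_linear (hφ : φ ∈ IsManifold.maximalAtlas (𝓡 m) ∞ M) (hx : x ∈ φ.source) (a : Fin m)
    {B : M → Matrix (Fin n) (Fin n) ℝ}
    (hB : ∀ i j, ContMDiffAt (𝓡 m) 𝓘(ℝ) ∞ (fun z ↦ B z i j) x)
    (f : Matrix (Fin n) (Fin n) ℝ →ₗ[ℝ] ℝ) :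
    pderiv φ a (fun z ↦ f (B z)) x = f (Matrix.of fun i j ↦ pderiv φ a (fun z ↦ B z i j) x) := by
  have h : ∀ i j, ContMDiffAt (𝓡 m) 𝓘(ℝ) ∞ (fun z ↦ f (Matrix.single i j 1) * B z i j) x :=
    fun i j ↦ contMDiffAt_const.mul (hB i j)
  rw [funext fun z ↦ linear_eq_sum f (B z), linear_eq_sum f (Matrix.of _),
    pderiv_sum _ hφ hx a (f := fun i z ↦ ∑ j, f (Matrix.single i j 1) * B z i j)
    fun i ↦ ContMDiffAt.sum fun j _ ↦ h i j]
  refine Finset.sum_congr rfl fun i _ ↦ ?_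
  rw [pderiv_sum _ hφ hx a (f := fun j z ↦ f (Matrix.single i j 1) * B z i j) (h i)]
  refine Finset.sum_congr rfl fun j _ ↦ ?_
  rw [pderiv_const_mul hφ hx a _ (hB i j), Matrix.of_apply]

/-- The derivative of a function with values in a linear subspace lies in the subspace. -/
theorem pderiv_mem (hφ : φ ∈ IsManifold.maximalAtlas (𝓡 m) ∞ M) (hx : x ∈ φ.source) (a : Fin m)
    {B : M → Matrix (Fin n) (Fin n) ℝ}
    (hB : ∀ i j, ContMDiffAt (𝓡 m) 𝓘(ℝ) ∞ (fun z ↦ B z i j) x)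
    {p : Submodule ℝ (Matrix (Fin n) (Fin n) ℝ)} (hp : ∀ᶠ z in 𝓝 x, B z ∈ p) :
    (Matrix.of fun i j ↦ pderiv φ a (fun z ↦ B z i j) x) ∈ p := by
  -- A subspace is cut out by the linear forms that vanish on it, and linear forms commute with
  -- derivatives.
  refine (Subspace.forall_mem_dualAnnihilator_apply_eq_zero_iff p _).1 fun f hf ↦ ?_
  rw [← pderiv_linear hφ hx a hB f, pderiv_congr (g := fun _ ↦ 0) hx, pderiv_const]
  filter_upwards [hp] with z hz using (Submodule.mem_dualAnnihilator _).1 hf _ hz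

theorem pderiv_matrix_mul (hφ : φ ∈ IsManifold.maximalAtlas (𝓡 m) ∞ M) (hx : x ∈ φ.source)
    (a : Fin m) {B C : M → Matrix (Fin n) (Fin n) ℝ}
    (hB : ∀ i j, ContMDiffAt (𝓡 m) 𝓘(ℝ) ∞ (fun z ↦ B z i j) x)
    (hC : ∀ i j, ContMDiffAt (𝓡 m) 𝓘(ℝ) ∞ (fun z ↦ C z i j) x) (i j : Fin n) :
    pderiv φ a (fun z ↦ (B z * C z) i j) x =
      ((Matrix.of fun i j ↦ pderiv φ a (fun z ↦ B z i j) x) * C x +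
        B x * Matrix.of fun i j ↦ pderiv φ a (fun z ↦ C z i j) x) i j := by
  simp only [Matrix.mul_apply, Matrix.add_apply, Matrix.of_apply]
  rw [pderiv_sum _ hφ hx a (f := fun k z ↦ B z i k * C z k j) fun k ↦ (hB i k).mul (hC k j),
    ← Finset.sum_add_distrib]
  exact Finset.sum_congr rfl fun k _ ↦ pderiv_mul hφ hx a (hB i k) (hC k j)

/-- The right logarithmic derivative of a smooth function with values in `G` is in the Lie algebra. -/
theorem pderiv_mul_inv_mem_tangentAtOne (hφ : φ ∈ IsManifold.maximalAtlas (𝓡 m) ∞ M)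
    {G : Subgroup (Matrix.GeneralLinearGroup (Fin n) ℝ)}
    {W : Set M} (hW : IsOpen W) (hWφ : W ⊆ φ.source) (hx : x ∈ W)
    {g : M → Matrix.GeneralLinearGroup (Fin n) ℝ} (hg : ∀ z ∈ W, g z ∈ G)
    (hs : ∀ z ∈ W, ∀ i j, ContMDiffAt (𝓡 m) 𝓘(ℝ) ∞
      (fun z ↦ (g z : Matrix (Fin n) (Fin n) ℝ) i j) z) (a : Fin m) :
    (Matrix.of fun i j ↦ pderiv φ a (fun z ↦ (g z : Matrix (Fin n) (Fin n) ℝ) i j) x) *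
      ((g x)⁻¹ : Matrix.GeneralLinearGroup (Fin n) ℝ) ∈ tangentAtOne G := by
  have hxφ := hWφ hx
  let e : EuclideanSpace ℝ (Fin m) := EuclideanSpace.single a 1
  have hO : IsOpen (φ.target ∩ φ.symm ⁻¹' W) := φ.symm.isOpen_inter_preimage hW
  obtain ⟨ε, hε, hball⟩ := Metric.isOpen_iff.1 hO (φ x)
    ⟨φ.map_source hxφ, by simpa [φ.left_inv hxφ] using hx⟩
  -- A velocity in the sense of `IsVelocity` belongs to a curve defined on all of `ℝ`. The
  -- coordinate line is therefore run through with parameter `δ sin(t/δ)`, which is at most `δ < ε`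
  -- in absolute value and has derivative 1 at 0.
  let δ : ℝ := ε / 2
  have hδ : 0 < δ := half_pos hε
  let c : ℝ → EuclideanSpace ℝ (Fin m) := fun t ↦ φ x + (δ * Real.sin (t / δ)) • e
  have hc0 : c 0 = φ x := by simp [c]
  have hcs : ContDiff ℝ ∞ c := contDiff_const.add
    ((contDiff_const.mul (Real.contDiff_sin.comp (contDiff_id.div_const δ))).smul contDiff_const)
  have hcd : HasDerivAt c e 0 := by
    have h1 : HasDerivAt (fun t : ℝ ↦ δ * Real.sin (t / δ)) 1 0 := by
      have := (((hasDerivAt_id (0 : ℝ)).div_const δ).sin).const_mul δ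
      simpa [hδ.ne'] using this
    have h2 := (h1.smul_const e).const_add (φ x)
    rwa [one_smul] at h2
  have hcm : ∀ t, c t ∈ φ.target ∩ φ.symm ⁻¹' W := fun t ↦ hball (by
    have he : ‖e‖ = 1 := by simp [e]
    rw [Metric.mem_ball, dist_eq_norm]
    simp only [c, add_sub_cancel_left, norm_smul, he, mul_one, Real.norm_eq_abs, abs_mul,
      abs_of_pos hδ]
    calc δ * |Real.sin (t / δ)| ≤ δ * 1 := by gcongr; exact Real.abs_sin_le_one _
      _ < ε := by rw [mul_one]; exact half_lt_self hε)
  have hsm : ∀ t i j, ContDiffAt ℝ ∞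
      (fun u ↦ (g (φ.symm u) : Matrix (Fin n) (Fin n) ℝ) i j) (c t) := by
    intro t i j
    have h1 := hWφ (hcm t).2
    have h2 := contDiffAt_comp_symm hφ h1 (hs _ (hcm t).2 i j)
    rwa [φ.right_inv (hcm t).1] at h2
  -- Right translation by `g(x)⁻¹` makes the curve in `G` start at the identity.
  refine ⟨fun t ↦ g (φ.symm (c t)) * (g x)⁻¹, fun t ↦ G.mul_mem (hg _ (hcm t).2)
    (G.inv_mem (hg _ hx)), by simp [hc0, φ.left_inv hxφ], fun i j ↦ ?_, fun i j ↦ ?_⟩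
  · simp only [Units.val_mul, Matrix.mul_apply]
    refine ContDiff.sum fun k _ ↦ ContDiff.mul (contDiff_iff_contDiffAt.2 fun t ↦ ?_) contDiff_const
    exact (hsm t i k).comp t hcs.contDiffAt
  · simp only [Units.val_mul, Matrix.mul_apply, Matrix.of_apply]
    refine HasDerivAt.deriv (HasDerivAt.fun_sum fun k _ ↦ HasDerivAt.mul_const ?_ _)
    have h1 := hsm 0 i k
    rw [hc0] at h1
    exact (h1.differentiableAt (by simp)).hasFDerivAt.comp_hasDerivAt_of_eq 0 hcd hc0.symm

/-- There is a smooth function with values in `G` and with given derivatives at a point. -/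
theorem exists_group_function (hφ : φ ∈ IsManifold.maximalAtlas (𝓡 m) ∞ M) (hx : x ∈ φ.source)
    {G : Subgroup (Matrix.GeneralLinearGroup (Fin n) ℝ)}
    {B : Fin m → Matrix (Fin n) (Fin n) ℝ} (hB : ∀ a, B a ∈ tangentAtOne G) :
    ∃ g : M → Matrix.GeneralLinearGroup (Fin n) ℝ, (∀ z, g z ∈ G) ∧ g x = 1 ∧
      (∀ z ∈ φ.source, ∀ i j, ContMDiffAt (𝓡 m) 𝓘(ℝ) ∞
        (fun z ↦ (g z : Matrix (Fin n) (Fin n) ℝ) i j) z) ∧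
      ∀ a i j, pderiv φ a (fun z ↦ (g z : Matrix (Fin n) (Fin n) ℝ) i j) x = B a i j := by
  -- The function is a product over `c` of factors `γ_c(x^c - x^c(x))`, where `γ_c` is a curve in
  -- `G` with velocity `B c`. All factors are 1 at `x`, so derivatives add up, and only the factor
  -- of index `a` contributes to `∂_a`. A list fixes the order of the factors for the induction.
  suffices H : ∀ l : List (Fin m), ∃ g : M → Matrix.GeneralLinearGroup (Fin n) ℝ,
      (∀ z, g z ∈ G) ∧ g x = 1 ∧ (∀ z ∈ φ.source, ∀ i j, ContMDiffAt (𝓡 m) 𝓘(ℝ) ∞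
        (fun z ↦ (g z : Matrix (Fin n) (Fin n) ℝ) i j) z) ∧
      ∀ a, (Matrix.of fun i j ↦ pderiv φ a (fun z ↦ (g z : Matrix (Fin n) (Fin n) ℝ) i j) x) =
        (l.map fun c ↦ if c = a then B c else 0).sum by
    obtain ⟨g, h1, h2, h3, h4⟩ := H (List.finRange m)
    refine ⟨g, h1, h2, h3, fun a i j ↦ ?_⟩
    have := h4 a
    rw [← Fin.sum_univ_def, Finset.sum_ite_eq' Finset.univ a B, if_pos (Finset.mem_univ a)] at this
    exact congrFun (congrFun this i) j
  intro l
  induction l with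
  | nil =>
    refine ⟨fun _ ↦ 1, fun _ ↦ G.one_mem, rfl, fun _ _ _ _ ↦ contMDiffAt_const, fun a ↦ ?_⟩
    ext i j
    simp [pderiv_const]
  | cons c l ih =>
    obtain ⟨g, h1, h2, h3, h4⟩ := ih
    obtain ⟨γ, hγ, hγ0, hγs, hγd⟩ := hB c
    have hk : ∀ z ∈ φ.source, ContMDiffAt (𝓡 m) 𝓘(ℝ) ∞ (fun z ↦ φ z c - φ x c) z :=
      fun z hz ↦ (contMDiffAt_coord hφ hz c).sub contMDiffAt_const
    have hs : ∀ z ∈ φ.source, ∀ i j, ContMDiffAt (𝓡 m) 𝓘(ℝ) ∞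
        (fun z ↦ (γ (φ z c - φ x c) : Matrix (Fin n) (Fin n) ℝ) i j) z := fun z hz i j ↦
      ((hγs i j).contDiffAt.contMDiffAt (x := φ z c - φ x c)).comp z (hk z hz)
    have hd : ∀ a i j, pderiv φ a (fun z ↦ (γ (φ z c - φ x c) : Matrix (Fin n) (Fin n) ℝ) i j) x =
        if c = a then B c i j else 0 := by
      intro a i j
      have hcd : HasFDerivAt (fun u ↦ φ (φ.symm u) c - φ x c)
          (fderiv ℝ (fun u ↦ φ (φ.symm u) c - φ x c) (φ x)) (φ x) :=
        (differentiableAt_comp_symm hφ hx (hk x hx)).hasFDerivAt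
      have hg : HasDerivAt (fun t ↦ (γ t : Matrix (Fin n) (Fin n) ℝ) i j) (B c i j) 0 := by
        rw [← hγd]
        exact ((hγs i j).differentiable (by simp)).differentiableAt.hasDerivAt
      have h0 : φ (φ.symm (φ x)) c - φ x c = 0 := by rw [φ.left_inv hx, sub_self]
      have h5 := (hg.comp_hasFDerivAt_of_eq (φ x) hcd h0.symm).fderiv
      have h6 : pderiv φ a (fun z ↦ φ z c - φ x c) x = if c = a then 1 else 0 := by
        rw [pderiv_sub hφ hx a (contMDiffAt_coord hφ hx c) contMDiffAt_const, pderiv_const,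
          pderiv_coord hx, sub_zero]
      rw [pderiv] at h6 ⊢
      refine (congrArg (fun L ↦ L (EuclideanSpace.single a 1)) h5).trans ?_
      rw [_root_.smul_apply, h6]
      split_ifs <;> simp
    refine ⟨fun z ↦ γ (φ z c - φ x c) * g z, fun z ↦ G.mul_mem (hγ _) (h1 z), by simp [hγ0, h2],
      fun z hz i j ↦ ?_, fun a ↦ ?_⟩
    · simp only [Units.val_mul]
      exact contMDiffAt_matrix_mul (hs z hz) (h3 z hz) i j
    · simp only [Units.val_mul]
      have h7 : (Matrix.of fun i j ↦ pderiv φ a (fun z ↦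
          (γ (φ z c - φ x c) : Matrix (Fin n) (Fin n) ℝ) i j) x) = if c = a then B c else 0 := by
        ext i j
        rw [Matrix.of_apply, hd]
        split_ifs <;> rfl
      ext i j
      rw [Matrix.of_apply, pderiv_matrix_mul hφ hx a (hs x hx) (h3 x hx), h7, h4, h2, sub_self, hγ0,
        List.map_cons, List.sum_cons]
      simp

end MatrixFunctions

/-! ### Components in a basis of the Lie algebra -/

section LieComponents

variable {G : Subgroup (Matrix.GeneralLinearGroup (Fin n) ℝ)} {ι : Type*}
  (l : Module.Basis ι ℝ (tangentAtOne G))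

theorem lieComp_of_mem {A : Matrix (Fin n) (Fin n) ℝ} (h : A ∈ tangentAtOne G) (I : ι) :
    lieComp l A I = l.repr ⟨A, h⟩ I := dif_pos h

/-- The components with respect to a basis of the Lie algebra extend to linear forms. -/
theorem exists_linear_lieComp (I : ι) : ∃ f : Matrix (Fin n) (Fin n) ℝ →ₗ[ℝ] ℝ,
    ∀ A ∈ tangentAtOne G, lieComp l A I = f A := by
  -- `lieComp` is zero outside the Lie algebra, so it need not be linear on all matrices. The
  -- extended coordinate form is linear everywhere, and it can be moved through sums and
  -- derivatives.
  obtain ⟨f, hf⟩ := LinearMap.exists_extend (l.coord I)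
  refine ⟨f, fun A hA ↦ ?_⟩
  rw [lieComp_of_mem l hA]
  exact (LinearMap.congr_fun hf ⟨A, hA⟩).symm

theorem eq_sum_lieComp [Fintype ι] {A : Matrix (Fin n) (Fin n) ℝ} (h : A ∈ tangentAtOne G) :
    A = ∑ J, lieComp l A J • (l J : Matrix (Fin n) (Fin n) ℝ) := by
  have h1 := congrArg Subtype.val (l.sum_repr ⟨A, h⟩)
  simp only [lieComp_of_mem l h]
  rw [Submodule.coe_sum] at h1
  exact h1.symm

theorem lieComp_bracket [Fintype ι] {A B : Matrix (Fin n) (Fin n) ℝ} (hA : A ∈ tangentAtOne G)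
    (hB : B ∈ tangentAtOne G) (I : ι) :
    lieComp l (A * B - B * A) I =
      ∑ J, ∑ H, structConst l I J H * lieComp l A J * lieComp l B H := by
  obtain ⟨f, hf⟩ := exists_linear_lieComp l I
  have hs : ∀ J H, structConst l I J H =
      f ((l J : Matrix (Fin n) (Fin n) ℝ) * l H - l H * l J) := fun J H ↦ by
    rw [← hf _ (bracket_mem G (l J).2 (l H).2), lieComp_of_mem l (bracket_mem G (l J).2 (l H).2)]
    rfl
  rw [hf _ (bracket_mem G hA hB)]
  have h1 : A * B = ∑ J, ∑ H, (lieComp l A J * lieComp l B H) •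
      ((l J : Matrix (Fin n) (Fin n) ℝ) * l H) := by
    conv_lhs => rw [eq_sum_lieComp l hA, eq_sum_lieComp l hB, Finset.sum_mul_sum]
    simp only [smul_mul_smul_comm]
  have h2 : B * A = ∑ J, ∑ H, (lieComp l A J * lieComp l B H) •
      ((l H : Matrix (Fin n) (Fin n) ℝ) * l J) := by
    conv_lhs => rw [eq_sum_lieComp l hA, eq_sum_lieComp l hB, Finset.sum_mul_sum, Finset.sum_comm]
    simp only [smul_mul_smul_comm, mul_comm (lieComp l A _)]
  rw [h1, h2]
  simp only [← Finset.sum_sub_distrib, ← smul_sub, map_sum, map_smul, ← hs, smul_eq_mul]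
  exact Finset.sum_congr rfl fun J _ ↦ Finset.sum_congr rfl fun H _ ↦ by ring

end LieComponents

end

/-! ### Gauge fields in charts with special frame -/

section

variable {m n : ℕ} {M : Type*} [TopologicalSpace M] [T2Space M]
  [ChartedSpace (EuclideanSpace ℝ (Fin m)) M] [IsManifold (𝓡 m) ∞ M]
  {F : Type*} [NormedAddCommGroup F] [NormedSpace ℝ F] [FiniteDimensional ℝ F]
  {V : M → Type*} [∀ x, AddCommGroup (V x)] [∀ x, Module ℝ (V x)] [∀ x, TopologicalSpace (V x)]
  [TopologicalSpace (TotalSpace F V)] [FiberBundle F V] [VectorBundle ℝ F V]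
  [ContMDiffVectorBundle ∞ F V (𝓡 m)]


variable {G : Subgroup (Matrix.GeneralLinearGroup (Fin n) ℝ)}

/-- There are fibred charts with special frames around every point. -/
theorem exists_special_chart (P : FibreStructure m F V G) (x : M) :
    ∃ χ : FibredChart m n F V, x ∈ χ.chart.source ∧ χ.IsSpecial P := by
  obtain ⟨U, hU, hx, s, h, hs⟩ := P.exists_local x
  have hsub : ((chartAt (EuclideanSpace ℝ (Fin m)) x).restr U).source ⊆ U := by
    rw [OpenPartialHomeomorph.restr_source, hU.interior_eq]
    exact inter_subset_right
  refine ⟨⟨(chartAt (EuclideanSpace ℝ (Fin m)) x).restr U, restr_mem_maximalAtlas _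
    (IsManifold.chart_mem_maximalAtlas x) hU, s, h.mono hsub⟩, ?_, fun y hy ↦ ?_⟩
  · change x ∈ ((chartAt (EuclideanSpace ℝ (Fin m)) x).restr U).source
    rw [OpenPartialHomeomorph.restr_source, hU.interior_eq]
    exact ⟨mem_chart_source _ x, hx⟩
  · convert hs y (hsub hy) using 1
    exact Module.Basis.eq_of_apply_eq fun i ↦ by simp

/-- The values at `x` of a special frame form a basis, and `A` sends each of them to a jet over
itself. -/
theorem gaugeFiber_subset_connFiber (P : FibreStructure m F V G) {x : M}
    {A : JetEnd (EuclideanSpace ℝ (Fin m)) F V x} (hA : A ∈ gaugeFiber P x) :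
    A ∈ connFiber (EuclideanSpace ℝ (Fin m)) F V x := by
  obtain ⟨β, hb, hβ⟩ := hA
  obtain ⟨b, -, hb⟩ := hb.self_of_nhds
  intro v
  rw [← b.sum_repr v]
  simp only [map_sum, map_smul, hb, ← hβ, proj_jet]

namespace FibredChart

open Matrix

variable {χ : FibredChart m n F V} {x : M} {P : FibreStructure m F V G}

theorem IsSpecial.exists_group (hχ : χ.IsSpecial P) {z : M} (hz : z ∈ χ.chart.source)
    {b : Module.Basis (Fin n) ℝ (V z)} (hb : b ∈ P.special z) :
    ∃ g ∈ G, ∀ i j, χ.yVec (b j) i = (g : Matrix (Fin n) (Fin n) ℝ) i j := by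
  obtain ⟨g, hg, h⟩ := (P.special_iff z _ (hχ z hz) b).1 hb
  refine ⟨g, hg, fun i j ↦ ?_⟩
  rw [h]
  simp only [IsLocalFrameOn.toBasisAt_coe]
  exact coeff_sum_smul χ.isLocalFrame hz (fun i ↦ (g : Matrix (Fin n) (Fin n) ℝ) i j) i

theorem IsSpecial.exists_basis (hχ : χ.IsSpecial P) {z : M} (hz : z ∈ χ.chart.source)
    {g : Matrix.GeneralLinearGroup (Fin n) ℝ} (hg : g ∈ G) :
    ∃ b ∈ P.special z, ∀ j, b j = ∑ i, (g : Matrix (Fin n) (Fin n) ℝ) i j • χ.frame i z := by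
  let b := χ.isLocalFrame.toBasisAt hz
  have h : ∀ j, b.map (Matrix.toLinearEquiv b (g : Matrix (Fin n) (Fin n) ℝ)
      ((Matrix.isUnit_iff_isUnit_det _).1 g.isUnit)) j =
      ∑ i, (g : Matrix (Fin n) (Fin n) ℝ) i j • b i := fun j ↦ by
    rw [Module.Basis.map_apply]
    exact Matrix.toLin_self b b _ j
  refine ⟨_, (P.special_iff z b (hχ z hz) _).2 ⟨g, hg, h⟩, fun j ↦ ?_⟩
  rw [h]
  simp [b]

/-- A special frame `β` that realizes `A` is related to the frame of the chart by a function `g`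
with values in `G`, smooth near `x`. The condition `j_x β_j = A(β_j(x))` then reads `∂_a g = y_a g`,
so `y_a` is the right logarithmic derivative of `g`. -/
theorem IsSpecial.c₁_mem (hχ : χ.IsSpecial P) (hx : x ∈ χ.chart.source)
    {A : JetEnd (EuclideanSpace ℝ (Fin m)) F V x} (hA : A ∈ gaugeFiber P x) (a : Fin m) :
    χ.c₁ a A ∈ tangentAtOne G := by
  obtain ⟨β, hb, hβ⟩ := hA
  obtain ⟨W, hWs, hW, hxW⟩ := mem_nhds_iff.1 (inter_mem hb (χ.chart.open_source.mem_nhds hx))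
  have hg : ∀ z, ∃ g : Matrix.GeneralLinearGroup (Fin n) ℝ, z ∈ W → g ∈ G ∧
      ∀ i j, χ.yVec (β j z) i = (g : Matrix (Fin n) (Fin n) ℝ) i j := by
    intro z
    by_cases hz : z ∈ W
    · obtain ⟨⟨b, hb, hbβ⟩, hz'⟩ := hWs hz
      obtain ⟨g, hg, h⟩ := hχ.exists_group hz' hb
      exact ⟨g, fun _ ↦ ⟨hg, fun i j ↦ by rw [← hbβ, h]⟩⟩
    · exact ⟨1, fun h ↦ absurd h hz⟩
  choose g hg using hg
  have hev : ∀ z ∈ W, ∀ i j, (fun z ↦ χ.yVec (β j z) i) =ᶠ[𝓝 z]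
      fun z ↦ (g z : Matrix (Fin n) (Fin n) ℝ) i j := fun z hz i j ↦ by
    filter_upwards [hW.mem_nhds hz] with w hw using (hg w hw).2 i j
  have hmem := pderiv_mul_inv_mem_tangentAtOne χ.chart_mem hW (fun z hz ↦ (hWs hz).2) hxW
    (fun z hz ↦ (hg z hz).1) (fun z hz i j ↦ (contMDiffAt_yVec (β j)
      (hWs hz).2 i).congr_of_eventuallyEq (hev z hz i j).symm) a
  have hd : (Matrix.of fun i j ↦ pderiv χ.chart a
      (fun z ↦ (g z : Matrix (Fin n) (Fin n) ℝ) i j) x) =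
      χ.c₁ a A * (g x : Matrix (Fin n) (Fin n) ℝ) := by
    ext i j
    rw [Matrix.of_apply, ← pderiv_congr hx (hev x hxW i j)]
    have h1 := congrFun (y₁Vec_jet (χ := χ) hx a (β j)) i
    rw [← h1, hβ, c₁_apply hx, Matrix.mul_apply]
    simp only [mulVec, dotProduct, (hg x hxW).2]
  rwa [hd, mul_assoc, ← Units.val_mul, mul_inv_cancel, Units.val_one, mul_one] at hmem

/-- The frame of the chart is multiplied by a function `g` in `G` with `g(x) = 1` and `∂_a g = y_a`
at `x`. The new frame is special and has the required jets. -/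
theorem IsSpecial.mem_gaugeFiber (hχ : χ.IsSpecial P) (hx : x ∈ χ.chart.source)
    {A : JetEnd (EuclideanSpace ℝ (Fin m)) F V x}
    (hA : A ∈ connFiber (EuclideanSpace ℝ (Fin m)) F V x)
    (h : ∀ a, χ.c₁ a A ∈ tangentAtOne G) : A ∈ gaugeFiber P x := by
  obtain ⟨g, hg, hg1, hgs, hgd⟩ := exists_group_function χ.chart_mem hx h
  have hβ : ∀ j, ∃ β : Cₛ^∞⟮𝓡 m; F, V⟯, ∀ᶠ z in 𝓝 x,
      β z = ∑ i, (g z : Matrix (Fin n) (Fin n) ℝ) i j • χ.frame i z := fun j ↦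
    exists_section_coeff χ.isLocalFrame χ.chart.open_source hx
      (fun i z hz ↦ (hgs z hz i j).contMDiffWithinAt)
  choose β hβ using hβ
  have hev : ∀ j i, (fun z ↦ χ.yVec (β j z) i) =ᶠ[𝓝 x]
      fun z ↦ (g z : Matrix (Fin n) (Fin n) ℝ) i j := fun j i ↦ by
    filter_upwards [hβ j, χ.chart.open_source.mem_nhds hx] with z hz hz'
    rw [hz]
    exact coeff_sum_smul χ.isLocalFrame hz' (fun i ↦ (g z : Matrix (Fin n) (Fin n) ℝ) i j) i
  have hx0 : ∀ j, χ.yVec (β j x) = Pi.single j 1 := fun j ↦ by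
    ext i
    have h1 : χ.yVec (β j x) i = (g x : Matrix (Fin n) (Fin n) ℝ) i j := (hev j i).self_of_nhds
    rw [h1, hg1, Units.val_one, Matrix.one_apply, Pi.single_apply]
  refine ⟨β, ?_, fun j ↦ ext_jet_vec hx ?_ fun a ↦ ?_⟩
  · filter_upwards [eventually_all.2 hβ, χ.chart.open_source.mem_nhds hx] with z hz hz'
    obtain ⟨b, hb, hbj⟩ := hχ.exists_basis hz' (hg z)
    exact ⟨b, hb, fun j ↦ by rw [hbj, hz]⟩
  · rw [proj_jet, hA]
  · rw [y₁Vec_jet hx, c₁_apply hx, hx0]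
    ext i
    rw [pderiv_congr hx (hev j i), hgd]
    simp

theorem IsSpecial.mem_gaugeFiber_iff (hχ : χ.IsSpecial P) (hx : x ∈ χ.chart.source)
    {A : JetEnd (EuclideanSpace ℝ (Fin m)) F V x}
    (hA : A ∈ connFiber (EuclideanSpace ℝ (Fin m)) F V x) :
    A ∈ gaugeFiber P x ↔ ∀ a, χ.c₁ a A ∈ tangentAtOne G :=
  ⟨hχ.c₁_mem hx, hχ.mem_gaugeFiber hx hA⟩

/-! ### Reduction of the overconnection -/

section

variable {Γ : CovariantDerivative (𝓡 m) (EuclideanSpace ℝ (Fin m))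
    (TangentSpace (𝓡 m) : M → Type _)} {κ : LinearConnection (EuclideanSpace ℝ (Fin m)) F V}
  {A : JetEnd (EuclideanSpace ℝ (Fin m)) F V x} {u : JetJetEnd m F V x}

theorem IsOver.dc₀_eq_zero (h : χ.IsOver Γ κ A u) (hA : χ.c₀ A = 1) (a : Fin m) :
    χ.dc₀ a u = 0 := by
  rw [h.dc₀, hA, mul_one, one_mul, sub_self]

theorem IsOver.dc₁_eq (h : χ.IsOver Γ κ A u) (hA : χ.c₀ A = 1) (a b : Fin m) :
    χ.dc₁ a b u = χ.dcomp κ a b x + (χ.comp κ a x * χ.c₁ b A - χ.c₁ b A * χ.comp κ a x) +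
      ∑ c, χ.christoffel Γ a c b x • (χ.comp κ c x - χ.c₁ c A) := by
  rw [h.dc₁, hA]
  simp only [mul_one, add_sub_assoc]

/-- A jet over a point of `C` whose derivatives of `Y` vanish is represented by a section with `Y =
1` near `x`, not only at `x`, and with affine `y_b`. -/
theorem exists_affine_section (hx : x ∈ χ.chart.source) (u : JetJetEnd m F V x)
    (h0 : χ.c₀ (Jet.proj _ _ x u) = 1) (h1 : ∀ a, χ.dc₀ a u = 0) :
    ∃ α : Cₛ^∞⟮𝓡 m; JetEndModel (EuclideanSpace ℝ (Fin m)) F,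
        JetEnd (EuclideanSpace ℝ (Fin m)) F V⟯, jet _ x α = u ∧
      ∀ᶠ z in 𝓝 x, χ.c₀ (α z) = 1 ∧ ∀ b, χ.c₁ b (α z) = χ.c₁ b (Jet.proj _ _ x u) +
        ∑ a, (χ.chart z a - χ.chart x a) • χ.dc₁ a b u := by
  obtain ⟨α, h, h2, h3, h4, h5⟩ := exists_end_section hx 1 (fun b ↦ χ.c₁ b (Jet.proj _ _ x u)) 0
    (fun a b ↦ χ.dc₁ a b u)
  refine ⟨α, jetJetEnd_ext hx (ext_end hx (by rw [proj_jet, h2, h0]) fun a ↦ ?_)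
    (fun a ↦ by rw [h4, h1]; rfl) h5, ?_⟩
  · rw [proj_jet, h3]
  · filter_upwards [h] with z hz
    refine ⟨by rw [hz.1]; simp, hz.2⟩

theorem IsOver.mem_jetsIn_connFiber (h : χ.IsOver Γ κ A u) (hx : x ∈ χ.chart.source)
    (hA : A ∈ connFiber (EuclideanSpace ℝ (Fin m)) F V x) :
    u ∈ jetsIn _ (connFiber (EuclideanSpace ℝ (Fin m)) F V) x := by
  have h0 := (c₀_eq_one hx).2 hA
  obtain ⟨α, hα, h⟩ := exists_affine_section hx u (by rw [h.proj, h0]) (h.dc₀_eq_zero h0)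
  refine ⟨α, hα, ?_⟩
  filter_upwards [h, χ.chart.open_source.mem_nhds hx] with z hz hz' using (c₀_eq_one hz').1 hz.1

theorem contMDiffAt_comp (κ : LinearConnection (EuclideanSpace ℝ (Fin m)) F V)
    (hx : x ∈ χ.chart.source) (a : Fin m) (i j : Fin n) :
    ContMDiffAt (𝓡 m) 𝓘(ℝ) ∞ (fun z ↦ χ.comp κ a z i j) x :=
  contMDiffAt_c₁ κ.toSection hx a i j

theorem IsSpecial.comp_mem (hχ : χ.IsSpecial P) (hκ : IsGaugeField P κ) (hx : x ∈ χ.chart.source)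
    (a : Fin m) : χ.comp κ a x ∈ tangentAtOne G :=
  hχ.c₁_mem hx (hκ x) a

theorem IsSpecial.dcomp_mem (hχ : χ.IsSpecial P) (hκ : IsGaugeField P κ) (hx : x ∈ χ.chart.source)
    (a b : Fin m) : χ.dcomp κ a b x ∈ tangentAtOne G := by
  refine pderiv_mem χ.chart_mem hx b (contMDiffAt_comp κ hx a) ?_
  filter_upwards [χ.chart.open_source.mem_nhds hx] with z hz using hχ.comp_mem hκ hz a

/-- A component is the restriction of a linear form, which commutes with the derivative; near `x`
the matrices `κ_a` stay in the Lie algebra. -/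
theorem IsSpecial.lieComp_dcomp {ι : Type*} (l : Module.Basis ι ℝ (tangentAtOne G))
    (hχ : χ.IsSpecial P) (hκ : IsGaugeField P κ) (hx : x ∈ χ.chart.source) (a b : Fin m) (I : ι) :
    lieComp l (χ.dcomp κ a b x) I = pderiv χ.chart b (χ.gaugeComp l κ a I) x := by
  obtain ⟨f, hf⟩ := exists_linear_lieComp l I
  rw [hf _ (hχ.dcomp_mem hκ hx a b)]
  refine (pderiv_linear χ.chart_mem hx b (contMDiffAt_comp κ hx a) f).symm.trans ?_
  refine pderiv_congr hx ?_
  filter_upwards [χ.chart.open_source.mem_nhds hx] with z hz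
    using (hf _ (hχ.comp_mem hκ hz a)).symm

/-- Each term is a derivative of a function with values in the Lie algebra, a bracket, or a linear
combination of its elements. -/
theorem IsSpecial.dc₁_mem (hχ : χ.IsSpecial P) (hκ : IsGaugeField P κ) (hx : x ∈ χ.chart.source)
    (hA : A ∈ gaugeFiber P x) (h : χ.IsOver Γ κ A u) (a b : Fin m) :
    χ.dc₁ a b u ∈ tangentAtOne G := by
  rw [h.dc₁_eq ((c₀_eq_one hx).2 (gaugeFiber_subset_connFiber P hA))]
  refine Submodule.add_mem _ (Submodule.add_mem _ (hχ.dcomp_mem hκ hx a b)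
    (bracket_mem G (hχ.comp_mem hκ hx a) (hχ.c₁_mem hx hA b))) (Submodule.sum_mem _ fun c _ ↦
    Submodule.smul_mem _ _ (Submodule.sub_mem _ (hχ.comp_mem hκ hx c) (hχ.c₁_mem hx hA c)))

/-- The affine representative has matrices `y_b(A) + (x^a - x^a(x)) dc₁ a b`. Both parts lie in the
linear space `𝔤`, so the section is in `C_G` at all points near `x`. -/
theorem IsSpecial.mem_jetsIn_gaugeFiber (hχ : χ.IsSpecial P) (hκ : IsGaugeField P κ)
    (hx : x ∈ χ.chart.source) (hA : A ∈ gaugeFiber P x) (h : χ.IsOver Γ κ A u) :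
    u ∈ jetsIn _ (gaugeFiber P) x := by
  have h0 := (c₀_eq_one hx).2 (gaugeFiber_subset_connFiber P hA)
  obtain ⟨α, hα, hev⟩ := exists_affine_section hx u (by rw [h.proj, h0]) (h.dc₀_eq_zero h0)
  refine ⟨α, hα, ?_⟩
  filter_upwards [hev, χ.chart.open_source.mem_nhds hx] with z hz hz'
  refine hχ.mem_gaugeFiber hz' ((c₀_eq_one hz').1 hz.1) fun b ↦ ?_
  rw [hz.2, h.proj]
  exact Submodule.add_mem _ (hχ.c₁_mem hx hA b)
    (Submodule.sum_mem _ fun a _ ↦ Submodule.smul_mem _ _ (hχ.dc₁_mem hκ hx hA h a b))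

theorem IsSpecial.lieComp_dc₁ {ι : Type*} [Fintype ι] (l : Module.Basis ι ℝ (tangentAtOne G))
    (hχ : χ.IsSpecial P) (hκ : IsGaugeField P κ) (hx : x ∈ χ.chart.source)
    (hA : A ∈ gaugeFiber P x) (h : χ.IsOver Γ κ A u) (a b : Fin m) (I : ι) :
    lieComp l (χ.dc₁ a b u) I = pderiv χ.chart b (χ.gaugeComp l κ a I) x +
      ∑ J, ∑ H, structConst l I J H * χ.gaugeComp l κ a J x * lieComp l (χ.c₁ b A) H +
      ∑ c, χ.christoffel Γ a c b x *
        (χ.gaugeComp l κ c I x - lieComp l (χ.c₁ c A) I) := by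
  obtain ⟨f, hf⟩ := exists_linear_lieComp l I
  have hd := hχ.dcomp_mem hκ hx a b
  have hc := hχ.comp_mem hκ hx
  have hA' := hχ.c₁_mem hx hA
  have hb := lieComp_bracket l (hc a) (hA' b) I
  rw [hf _ (bracket_mem G (hc a) (hA' b))] at hb
  rw [hf _ (hχ.dc₁_mem hκ hx hA h a b),
    h.dc₁_eq ((c₀_eq_one hx).2 (gaugeFiber_subset_connFiber P hA)), map_add, map_add, hb,
    ← hχ.lieComp_dcomp l hκ hx, hf _ hd]
  simp only [gaugeComp, map_sum, map_smul, map_sub, smul_eq_mul, hf _ (hc _), hf _ (hA' _)]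

theorem curvature_eq (κ : LinearConnection (EuclideanSpace ℝ (Fin m)) F V) (a b : Fin m) :
    χ.curvature κ a b x = χ.dcomp κ a b x - χ.dcomp κ b a x +
      (χ.comp κ a x * χ.comp κ b x - χ.comp κ b x * χ.comp κ a x) := rfl

theorem IsSpecial.curvature_mem (hχ : χ.IsSpecial P) (hκ : IsGaugeField P κ)
    (hx : x ∈ χ.chart.source) (a b : Fin m) : χ.curvature κ a b x ∈ tangentAtOne G :=
  Submodule.add_mem _ (Submodule.sub_mem _ (hχ.dcomp_mem hκ hx a b) (hχ.dcomp_mem hκ hx b a))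
    (bracket_mem G (hχ.comp_mem hκ hx a) (hχ.comp_mem hκ hx b))

theorem IsSpecial.lieComp_curvature {ι : Type*} [Fintype ι] (l : Module.Basis ι ℝ (tangentAtOne G))
    (hχ : χ.IsSpecial P) (hκ : IsGaugeField P κ) (hx : x ∈ χ.chart.source) (a b : Fin m) (I : ι) :
    lieComp l (χ.curvature κ a b x) I =
      pderiv χ.chart b (χ.gaugeComp l κ a I) x - pderiv χ.chart a (χ.gaugeComp l κ b I) x +
      ∑ J, ∑ H, structConst l I J H * χ.gaugeComp l κ a J x * χ.gaugeComp l κ b H x := by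
  obtain ⟨f, hf⟩ := exists_linear_lieComp l I
  have hc := hχ.comp_mem hκ hx
  rw [hf _ (hχ.curvature_mem hκ hx a b), curvature_eq, map_add, map_sub,
    ← hf _ (hχ.dcomp_mem hκ hx a b), ← hf _ (hχ.dcomp_mem hκ hx b a),
    ← hf _ (bracket_mem G (hc a) (hc b)), hχ.lieComp_dcomp l hκ hx, hχ.lieComp_dcomp l hκ hx,
    lieComp_bracket l (hc a) (hc b)]
  rfl

theorem lieComp_neg {ι : Type*} (l : Module.Basis ι ℝ (tangentAtOne G))
    {B : Matrix (Fin n) (Fin n) ℝ} (hB : B ∈ tangentAtOne G) (I : ι) :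
    lieComp l (-B) I = -lieComp l B I := by
  obtain ⟨f, hf⟩ := exists_linear_lieComp l I
  rw [hf _ hB, hf _ (Submodule.neg_mem _ hB), map_neg]

end

end FibredChart

/-! ### The covariant derivative of a connection -/

section

variable {Γ : CovariantDerivative (𝓡 m) (EuclideanSpace ℝ (Fin m))
    (TangentSpace (𝓡 m) : M → Type _)} {κ : LinearConnection (EuclideanSpace ℝ (Fin m)) F V}
  {K : LinearConnection (EuclideanSpace ℝ (Fin m)) (JetEndModel (EuclideanSpace ℝ (Fin m)) F)
    (JetEnd (EuclideanSpace ℝ (Fin m)) F V)}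

theorem LinearConnection.proj_covDeriv (κ : LinearConnection (EuclideanSpace ℝ (Fin m)) F V)
    (s : Cₛ^∞⟮𝓡 m; F, V⟯) (x : M) : Jet.proj F V x (κ.covDeriv s x) = 0 := by
  rw [covDeriv, map_sub, proj_jet, κ.proj_apply, sub_self]

variable {χ : FibredChart m n F V} {x : M}

theorem covDeriv_add_apply :
    K.covDeriv κ.toSection x + K.toSection x (κ.toSection x) = jet _ x κ.toSection :=
  sub_add_cancel _ _

theorem FibredChart.dc₀_covDeriv
    (hx : x ∈ χ.chart.source)
    (h : χ.IsOver Γ κ (κ.toSection x) (K.toSection x (κ.toSection x))) (a : Fin m) :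
    χ.dc₀ a (K.covDeriv κ.toSection x) = 0 := by
  have h1 := (congrArg (χ.dc₀ a) covDeriv_add_apply).symm.trans
    (dc₀_add hx a (K.covDeriv κ.toSection x) (K.toSection x (κ.toSection x)))
  rw [dc₀_toSection hx, h.dc₀_eq_zero (c₀_toSection hx κ), add_zero] at h1
  exact h1.symm

/-- The jet of `κ` contributes `∂_a κ_b`, and `κ↑` at `κ` contributes `∂_b κ_a + [κ_a, κ_b]`. The
connection `Γ` leaves no trace, as it multiplies `κ_c - y_c`, which is zero at `κ`. -/
theorem FibredChart.dc₁_covDeriv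
    (hx : x ∈ χ.chart.source)
    (h : χ.IsOver Γ κ (κ.toSection x) (K.toSection x (κ.toSection x))) (a b : Fin m) :
    χ.dc₁ a b (K.covDeriv κ.toSection x) = -χ.curvature κ a b x := by
  have h1 := (congrArg (χ.dc₁ a b) covDeriv_add_apply).symm.trans
    (dc₁_add hx a b (K.covDeriv κ.toSection x) (K.toSection x (κ.toSection x)))
  have h2 : ∀ c, χ.c₁ c (κ.toSection x) = χ.comp κ c x := fun _ ↦ rfl
  rw [dc₁_toSection hx, h.dc₁_eq (c₀_toSection hx κ)] at h1
  simp only [h2, sub_self, smul_zero, Finset.sum_const_zero, add_zero] at h1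
  rw [eq_comm, ← eq_sub_iff_add_eq] at h1
  rw [h1, curvature_eq]
  abel

end

end

end JetConnection

end

theorem mainTheorem3 {m n : ℕ} {M : Type*} [TopologicalSpace M] [T2Space M]
    [ChartedSpace (EuclideanSpace ℝ (Fin m)) M] [IsManifold (𝓡 m) ∞ M]
    {F : Type*} [NormedAddCommGroup F] [NormedSpace ℝ F] [FiniteDimensional ℝ F]
    {V : M → Type*} [∀ x, AddCommGroup (V x)] [∀ x, Module ℝ (V x)] [∀ x, TopologicalSpace (V x)]
    [TopologicalSpace (TotalSpace F V)] [FiberBundle F V] [VectorBundle ℝ F V]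
    [ContMDiffVectorBundle ∞ F V (𝓡 m)]
    -- the fibre structure of `E = V`, and a basis of the Lie algebra of its structure group
    {G : Subgroup (Matrix.GeneralLinearGroup (Fin n) ℝ)} (P : FibreStructure m F V G)
    {ι : Type*} [Fintype ι] (l : Module.Basis ι ℝ (tangentAtOne G))
    -- a smooth torsion-free linear connection of `T M`
    (Γ : CovariantDerivative (𝓡 m) (EuclideanSpace ℝ (Fin m)) (TangentSpace (𝓡 m) : M → Type _))
    (_hΓ : CovariantDerivative.ContMDiffCovariantDerivative Γ ∞) (_hT : Γ.torsion = 0)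
    -- a gauge field
    (κ : LinearConnection (EuclideanSpace ℝ (Fin m)) F V) (_hκ : IsGaugeField P κ) :
    ∃ K : LinearConnection (EuclideanSpace ℝ (Fin m)) (JetEndModel (EuclideanSpace ℝ (Fin m)) F)
        (JetEnd (EuclideanSpace ℝ (Fin m)) F V),
      -- `Γ` and `κ` determine the overconnection `K = κ↑`
      IsOverconnection n Γ κ K ∧ (∀ K', IsOverconnection n Γ κ K' → K' = K) ∧
      -- it is reducible to a connection of `C`
      (∀ x, ∀ A ∈ connFiber (EuclideanSpace ℝ (Fin m)) F V x,
        K.toSection x A ∈ jetsIn _ (connFiber (EuclideanSpace ℝ (Fin m)) F V) x) ∧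
      -- it is reducible to a connection of `C_G`
      (∀ x, ∀ A ∈ gaugeFiber P x, K.toSection x A ∈ jetsIn _ (gaugeFiber P) x) ∧
      -- in special fibred charts, `C_G` is the affine subbundle of `C` given by `y_a ∈ 𝔤`
      (∀ χ : FibredChart m n F V, χ.IsSpecial P → ∀ x ∈ χ.chart.source,
        ∀ A ∈ connFiber (EuclideanSpace ℝ (Fin m)) F V x,
          A ∈ gaugeFiber P x ↔ ∀ a, χ.c₁ a A ∈ tangentAtOne G) ∧
      -- the coordinate expression of `κ↑` on `C_G`
      (∀ χ : FibredChart m n F V, χ.IsSpecial P → ∀ x ∈ χ.chart.source,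
        ∀ A ∈ gaugeFiber P x, ∀ a b,
          χ.dc₀ a (K.toSection x A) = 0 ∧
          χ.dc₁ a b (K.toSection x A) ∈ tangentAtOne G ∧
          ∀ I, lieComp l (χ.dc₁ a b (K.toSection x A)) I =
            pderiv χ.chart b (χ.gaugeComp l κ a I) x +
            ∑ J, ∑ H, structConst l I J H * χ.gaugeComp l κ a J x * lieComp l (χ.c₁ b A) H +
            ∑ c, χ.christoffel Γ a c b x *
              (χ.gaugeComp l κ c I x - lieComp l (χ.c₁ c A) I)) ∧
      -- the covariant derivative of `κ` with respect to `κ↑` is minus the curvature of `κ`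
      (∀ x, Jet.proj _ _ x (K.covDeriv κ.toSection x) = 0) ∧
      (∀ χ : FibredChart m n F V, ∀ x ∈ χ.chart.source, ∀ a b,
        χ.dc₀ a (K.covDeriv κ.toSection x) = 0 ∧
        χ.dc₁ a b (K.covDeriv κ.toSection x) = -χ.curvature κ a b x) ∧
      (∀ χ : FibredChart m n F V, χ.IsSpecial P → ∀ x ∈ χ.chart.source, ∀ a b,
        χ.curvature κ a b x ∈ tangentAtOne G ∧
        (∀ I, lieComp l (χ.dc₁ a b (K.covDeriv κ.toSection x)) I =
          -lieComp l (χ.curvature κ a b x) I) ∧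
        ∀ I, lieComp l (χ.curvature κ a b x) I =
            pderiv χ.chart b (χ.gaugeComp l κ a I) x - pderiv χ.chart a (χ.gaugeComp l κ b I) x +
            ∑ J, ∑ H, structConst l I J H * χ.gaugeComp l κ a J x * χ.gaugeComp l κ b H x) := by
  -- The rank `n` is not tied to `F` by a hypothesis; the local special frames, which have `n`
  -- members, supply fibred charts around every point.
  have hcov : ∀ x : M, ∃ χ : FibredChart m n F V, x ∈ χ.chart.source := fun x ↦
    (exists_special_chart P x).imp fun _ h ↦ h.1
  have hex := exists_overconnection hcov _hΓ κ
  refine hex.imp fun K hKo ↦ ?_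
  have hK := hKo.1
  have hover := hKo.2
  have hc : ∀ (χ : FibredChart m n F V) (x : M), x ∈ χ.chart.source → ∀ A ∈ gaugeFiber P x,
      χ.c₀ A = 1 := fun χ x hx A hA ↦
    (FibredChart.c₀_eq_one hx).2 (gaugeFiber_subset_connFiber P hA)
  refine ⟨hK, ?_, ?_, ?_, ?_, ?_, ?_, ?_, ?_⟩
  · intro K' hK'
    exact hK'.unique hcov hK
  · intro x A hA
    exact (hcov x).elim fun χ hx ↦ (hover χ x hx A).mem_jetsIn_connFiber hx hA
  · intro x A hA
    exact (exists_special_chart P x).elim fun χ h ↦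
      h.2.mem_jetsIn_gaugeFiber _hκ h.1 hA (hover χ x h.1 A)
  · intro χ hχ x hx A hA
    exact hχ.mem_gaugeFiber_iff hx hA
  · intro χ hχ x hx A hA a b
    have h := hover χ x hx A
    exact ⟨h.dc₀_eq_zero (hc χ x hx A hA) a, hχ.dc₁_mem _hκ hx hA h a b,
      hχ.lieComp_dc₁ l _hκ hx hA h a b⟩
  · intro x
    exact K.proj_covDeriv _ x
  · intro χ x hx a b
    have h := hover χ x hx (κ.toSection x)
    exact ⟨FibredChart.dc₀_covDeriv hx h a, FibredChart.dc₁_covDeriv hx h a b⟩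
  · intro χ hχ x hx a b
    have h := hover χ x hx (κ.toSection x)
    refine ⟨hχ.curvature_mem _hκ hx a b, fun I ↦ ?_, hχ.lieComp_curvature l _hκ hx a b⟩
    rw [FibredChart.dc₁_covDeriv hx h a b,
      FibredChart.lieComp_neg l (hχ.curvature_mem _hκ hx a b)]
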